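/- Let $\Sigma$ be a compact smooth $3$-manifold without boundary, let $\beta:\mathbb R\times\Sigma\to(0,\infty)$ be smooth and let $(h_t)_{t\in\mathbb R}$ be a smooth one-parameter family of Riemannian metrics on $\Sigma$. Let $\mathsf M=\mathbb R\times\Sigma$ carry the Lorentzian metric $g=-\beta^2dt^2+h_t$, time-oriented by $\partial_t$. Write $\mathsf T'\Sigma=\mathsf T^*\Sigma\setminus\{0\}$ and $\|\eta\|_{h_s}=\sqrt{h_s^{\alpha\beta}(y)\eta_\alpha\eta_\beta}$. For $Y=(s,y)\in\mathsf M$ and $\eta\in \mathsf T^*_y\Sigma\setminus\{0\}$ let $\eta_+$ (resp. $\eta_-$) be the unique future (resp. past) pointing null covector in $\mathsf T_Y^*\mathsf M$ whose restriction to $\mathsf T_y\Sigma$ is $\eta$. Let $\tilde X^\pm(\,\cdot\,;s,y,\eta)$ be the affinely parameterised null geodesic of $g$ starting at $Y$ with initial cotangent vector $\pm\eta_\pm/\|\eta\|_{h_s}$, and let $\tilde\Xi^\pm$ be the parallel transport of $\eta_\pm$ along it. Reparameterise this curve and this covector field by the time coordinate $t$, and denote the result by $t\mapsto (X^\pm(t;s,y,\eta),\Xi^\pm(t;s,y,\eta))$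 with $X^\pm(t;s,y,\eta)=(t,x^\pm(t;s,y,\eta))$ (the positive and negative Levi-Civita flows). Set $$\Phi^\pm:=\{(t,x^\pm(t;s,y,\eta);s,y,\eta)\ :\ t,s\in\mathbb R,\ (y,\eta)\in \mathsf T'\Sigma\}.$$ For a convex normal neighbourhood $C\subset\mathsf M$ (an open set that is a normal neighbourhood of each of its points) let $\sigma_C(X,Z)=\tfrac12 g(\dot\gamma(0),\dot\gamma(0))$, where $\gamma:[0,1]\to C$ is the unique geodesic in $C$ from $X$ to $Z$ (Ruse–Synge world function). A positive (resp. negative) Lorentzian Levi-Civita phase function is a smooth function $\varphi^\pm:\mathsf M\times\mathbb R\times \mathsf T'\Sigma\to\mathbb C$ with the following properties. Let $\mathcal G^\pm$ be the open set of all points which have a neighbourhood in $\mathsf M\times\mathbb R\times \mathsf T'\Sigma$ on which, for some fixed convex normal neighbourhood $C$, both $X=(t,x)$ and $X^\pm(t;s,y,\eta)$ lie in $C$ and $$\varphi^\pm(t,x;s,y,\eta)=-\big\langle \Xi^\pm(t;s,y,\eta),\ \operatorname{grad}_Z\sigma_C(X,Z)\big|_{Z=X^\pm(t;s,y,\eta)}\big\rangle+i\,\|\eta\|_{h_s}\,\sigma_C\big(X,X^\pm(t;s,y,\eta)\big).$$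 Then $\Phi^\pm\subset\mathcal G^\pm$; moreover $\operatorname{Im}\varphi^\pm\ge0$ everywhere, and $\partial_\eta\varphi^\pm\neq0$ at every point outside $\mathcal G^\pm$. Here $\partial_\eta$ is the derivative along the fibre $\mathsf T^*_y\Sigma$, the other variables being fixed. Then, for every positive (resp. negative) Lorentzian Levi-Civita phase function $\varphi^\pm$, $$\{(t,x;s,y,\eta)\in\mathsf M\times\mathbb R\times \mathsf T'\Sigma\ :\ \partial_\eta\varphi^\pm(t,x;s,y,\eta)=0\}=\Phi^\pm .$$ -/

import Mathlib

open scoped Manifold ContDiff Topology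
open Set Filter Bundle

/-- The model space of the three-dimensional Cauchy surface. -/
abbrev E3 : Type := EuclideanSpace ℝ (Fin 3)

/-- The model with corners of the Cauchy surface. -/
noncomputable abbrev I3 : ModelWithCorners ℝ E3 E3 := 𝓘(ℝ, E3)

/-- The model space of spacetime; it is also the tangent space at each point `(t, x)` of
`ℝ × S`: the first component is the coefficient of `∂_t`, the second one is tangent to `S`. -/
abbrev E4 : Type := ℝ × E3

/-- The model with corners of spacetime `ℝ × S`. -/
noncomputable abbrev I4 : ModelWithCorners ℝ (ℝ × E3) (ModelProd ℝ E3) := 𝓘(ℝ, ℝ).prod I3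

section

variable (S : Type*) [TopologicalSpace S] [ChartedSpace E3 S] [IsManifold I3 ∞ S]

/-- The cotangent bundle of `S`. -/
abbrev Cot : Type _ :=
  TotalSpace (E3 →L[ℝ] ℝ) (fun y : S => TangentSpace I3 y →L[ℝ] ℝ)

/-- The manifold `M × ℝ × T*S`, with points `((t, x), s, ⟨y, η⟩)`. -/
abbrev PhasePoint : Type _ := (ℝ × S) × ℝ × Cot S

/-- The model with corners of `M × ℝ × T*S`. -/
noncomputable abbrev IPhase : ModelWithCorners ℝ ((ℝ × E3) × ℝ × E3 × (E3 →L[ℝ] ℝ))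
    (ModelProd (ModelProd ℝ E3) (ModelProd ℝ (ModelProd E3 (E3 →L[ℝ] ℝ)))) :=
  I4.prod (𝓘(ℝ, ℝ).prod (I3.prod 𝓘(ℝ, E3 →L[ℝ] ℝ)))

/-- The data of the spacetime `M = ℝ × S` with Lorentzian metric `g = - β² dt² + h_t`: a smooth
positive lapse function `β` and a smooth one-parameter family of Riemannian metrics `h_t`. -/
structure Spacetime where
  /-- the lapse function `β` -/
  lapse : ℝ × S → ℝ
  lapse_pos : ∀ p, 0 < lapse p
  lapse_smooth : ContMDiff I4 𝓘(ℝ, ℝ) ∞ lapse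
  /-- the family of Riemannian metrics `h_t` -/
  spatial : ℝ → ContMDiffRiemannianMetric I3 ∞ E3 (fun x : S => TangentSpace I3 x)
  /-- `h_t` is smooth jointly in `(t, x)` -/
  spatial_smooth : ContMDiff I4 (I3.prod 𝓘(ℝ, E3 →L[ℝ] E3 →L[ℝ] ℝ)) ∞
    (fun p : ℝ × S =>
      TotalSpace.mk' (E3 →L[ℝ] E3 →L[ℝ] ℝ)
        (E := fun x : S => TangentSpace I3 x →L[ℝ] TangentSpace I3 x →L[ℝ] ℝ) p.2
        ((spatial p.1).inner p.2))

end

namespace Spacetime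

variable {S : Type*} [TopologicalSpace S] [ChartedSpace E3 S] [IsManifold I3 ∞ S]
  (g : Spacetime S)

/-! ### Metric and musical isomorphisms -/

/-- The Riemannian metric `h_t` at the point `x`, where `p = (t, x)`. -/
noncomputable def h (p : ℝ × S) (v w : E3) : ℝ := (g.spatial p.1).inner p.2 v w

/-- The Lorentzian metric `g = - β² dt² + h_t` at the point `p = (t, x)`. -/
noncomputable def metric (p : ℝ × S) (v w : E4) : ℝ :=
  -(g.lapse p) ^ 2 * v.1 * w.1 + g.h p v.2 w.2

/-- The vector tangent to `S` dual to the covector `η` with respect to `h_t`. -/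
noncomputable def spatialSharp (p : ℝ × S) (η : E3 →L[ℝ] ℝ) : E3 :=
  Classical.epsilon fun v => ∀ w, g.h p v w = η w

/-- The vector dual to the covector `ξ` with respect to the Lorentzian metric. -/
noncomputable def sharp (p : ℝ × S) (ξ : E4 →L[ℝ] ℝ) : E4 :=
  Classical.epsilon fun v => ∀ w, g.metric p v w = ξ w

/-- The norm `‖η‖_{h_s} = √(h_s^{αβ} η_α η_β)` of a covector `η` at `y`, where `p = (s, y)`. -/
noncomputable def conorm (p : ℝ × S) (η : E3 →L[ℝ] ℝ) : ℝ :=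
  Real.sqrt (η (g.spatialSharp p η))

/-- The lift of `η ∈ T*_y S` to a null covector `η_± ∈ T*_{(s, y)} M`, namely
`η_± = ∓ β ‖η‖ dt + η`. That it is the unique future (`ε = 1`), respectively past (`ε = -1`),
pointing null covector which restricts to `η` is `nullLift_unique` below. -/
noncomputable def nullLift (ε : ℤˣ) (p : ℝ × S) (η : E3 →L[ℝ] ℝ) : E4 →L[ℝ] ℝ :=
  (-((ε : ℤ) : ℝ) * g.lapse p * g.conorm p η) • ContinuousLinearMap.fst ℝ ℝ E3
    + η.comp (ContinuousLinearMap.snd ℝ ℝ E3)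

theorem spatialSharp_spec (p : ℝ × S) (η : E3 →L[ℝ] ℝ) (w : E3) :
    g.h p (g.spatialSharp p η) w = η w := by
  have hex : ∃ v : E3, ∀ w, g.h p v w = η w := by
    let B : E3 →ₗ[ℝ] Module.Dual ℝ E3 :=
      LinearMap.mk₂ ℝ (g.h p)
        (fun a b c => by
          have := congrArg (fun L => L c) (((g.spatial p.1).inner p.2).map_add a b)
          exact this)
        (fun r a c => by
          have := congrArg (fun L => L c) (((g.spatial p.1).inner p.2).map_smul r a)
          exact this)
        (fun a b c => ((g.spatial p.1).inner p.2 a).map_add b c)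
        (fun r a c => ((g.spatial p.1).inner p.2 a).map_smul r c)
    have hinj : Function.Injective B := by
      rw [injective_iff_map_eq_zero]
      intro a ha
      by_contra hne
      have h1 := (g.spatial p.1).pos p.2 a hne
      have h2 : g.h p a a = 0 := by
        have := congrArg (fun L => L a) ha
        exact this
      exact absurd h2 (ne_of_gt h1)
    have hsurj : Function.Surjective B :=
      (LinearMap.injective_iff_surjective_of_finrank_eq_finrank
        (Subspace.dual_finrank_eq (K := ℝ) (V := E3)).symm).1 hinj
    obtain ⟨v, hv⟩ := hsurj (η : E3 →ₗ[ℝ] ℝ)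
    exact ⟨v, fun w => congrArg (fun L => L w) hv⟩
  exact Classical.epsilon_spec hex w

theorem h_sub_left (p : ℝ × S) (a b w : E3) : g.h p (a - b) w = g.h p a w - g.h p b w := by
  have := congrArg (fun L => L w) (((g.spatial p.1).inner p.2).map_sub a b)
  exact this

theorem h_pos (p : ℝ × S) (v : E3) (hv : v ≠ 0) : 0 < g.h p v v :=
  (g.spatial p.1).pos p.2 v hv

theorem h_zero_right (p : ℝ × S) (v : E3) : g.h p v 0 = 0 :=
  ((g.spatial p.1).inner p.2 v).map_zero

theorem eq_of_h_eq (p : ℝ × S) (a b : E3) (hab : ∀ w, g.h p a w = g.h p b w) : a = b := by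
  by_contra hne
  have h1 := g.h_pos p (a - b) (sub_ne_zero.2 hne)
  rw [g.h_sub_left, hab, sub_self] at h1
  exact lt_irrefl _ h1

theorem sharp_eq (p : ℝ × S) (ξ : E4 →L[ℝ] ℝ) :
    g.sharp p ξ = (-(ξ (1, 0)) / (g.lapse p) ^ 2,
      g.spatialSharp p (ξ.comp (ContinuousLinearMap.inr ℝ ℝ E3))) := by
  have hb := g.lapse_pos p
  have hsplit : ∀ w : E4, ξ w = w.1 * ξ (1, 0) + ξ (0, w.2) := by
    intro w
    have : w = w.1 • ((1, 0) : E4) + (0, w.2) := by ext <;> simp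
    conv_lhs => rw [this]
    rw [map_add, map_smul, smul_eq_mul]
  have hex : ∃ v : E4, ∀ w, g.metric p v w = ξ w := by
    refine ⟨(-(ξ (1, 0)) / (g.lapse p) ^ 2,
      g.spatialSharp p (ξ.comp (ContinuousLinearMap.inr ℝ ℝ E3))), fun w => ?_⟩
    rw [hsplit w]
    simp only [metric, spatialSharp_spec, ContinuousLinearMap.comp_apply,
      ContinuousLinearMap.inr_apply]
    field_simp
  have hspec : ∀ w, g.metric p (g.sharp p ξ) w = ξ w := Classical.epsilon_spec hex
  refine Prod.ext ?_ ?_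
  · have := hspec (1, 0)
    simp only [metric, h_zero_right] at this
    field_simp
    linarith
  · refine g.eq_of_h_eq p _ _ fun w => ?_
    have := hspec (0, w)
    simp only [metric, mul_zero, zero_add] at this
    rw [this, spatialSharp_spec]
    rfl

/-- `η_±` is null, future, respectively past, pointing, restricts to `η`, and is the only such
covector. -/
theorem nullLift_unique (ε : ℤˣ) (p : ℝ × S) (η : E3 →L[ℝ] ℝ) (hη : η ≠ 0)
    (ξ : E4 →L[ℝ] ℝ) :
    ξ = g.nullLift ε p η ↔
      ξ.comp (ContinuousLinearMap.inr ℝ ℝ E3) = η ∧ ξ (g.sharp p ξ) = 0 ∧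
        0 < ((ε : ℤ) : ℝ) * (g.sharp p ξ).1 := by
  have hb := g.lapse_pos p
  have hsplit : ∀ w : E4, ξ w = w.1 * ξ (1, 0) + ξ (0, w.2) := by
    intro w
    have : w = w.1 • ((1, 0) : E4) + (0, w.2) := by ext <;> simp
    conv_lhs => rw [this]
    rw [map_add, map_smul, smul_eq_mul]
  have hne : g.spatialSharp p η ≠ 0 := by
    intro h0
    apply hη
    ext w
    have h1 := g.spatialSharp_spec p η w
    rw [h0] at h1
    have h2 := g.h_sub_left p 0 0 w
    simp only [sub_self] at h2
    rw [← h1, h2]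
    rfl
  have hpos : 0 < η (g.spatialSharp p η) := by
    rw [← g.spatialSharp_spec p η]
    exact g.h_pos p _ hne
  have hc : 0 < g.conorm p η := Real.sqrt_pos.2 hpos
  have hc2 : g.conorm p η ^ 2 = η (g.spatialSharp p η) := Real.sq_sqrt hpos.le
  have hkey : ξ.comp (ContinuousLinearMap.inr ℝ ℝ E3) = η →
      ξ (g.sharp p ξ) = -(ξ (1, 0)) ^ 2 / (g.lapse p) ^ 2 + g.conorm p η ^ 2 := by
    intro h1
    have h2 : ξ (0, g.spatialSharp p η) = η (g.spatialSharp p η) :=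
      congrArg (fun L => L (g.spatialSharp p η)) h1
    rw [hsplit, g.sharp_eq, h1, h2, hc2]
    ring
  have hε : ((ε : ℤ) : ℝ) = 1 ∨ ((ε : ℤ) : ℝ) = -1 := by
    rcases Int.units_eq_one_or ε with rfl | rfl <;> simp
  constructor
  · intro hx
    have h1 : ξ.comp (ContinuousLinearMap.inr ℝ ℝ E3) = η := by
      rw [hx]; ext w; simp [nullLift]
    have h3 : ξ (1, 0) = -((ε : ℤ) : ℝ) * g.lapse p * g.conorm p η := by
      rw [hx]; simp [nullLift]
    refine ⟨h1, ?_, ?_⟩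
    · rw [hkey h1, h3]
      rcases hε with h | h <;> rw [h] <;> field_simp <;> ring
    · rw [g.sharp_eq, h3]
      have : ((ε : ℤ) : ℝ) * (-(-((ε : ℤ) : ℝ) * g.lapse p * g.conorm p η) / g.lapse p ^ 2)
          = g.conorm p η / g.lapse p := by
        rcases hε with h | h <;> rw [h] <;> field_simp
      simp only [this]
      positivity
  · rintro ⟨h1, h2, h3⟩
    rw [hkey h1] at h2
    rw [g.sharp_eq] at h3
    have h4 : ξ (1, 0) ^ 2 = (g.lapse p * g.conorm p η) ^ 2 := by
      field_simp at h2
      linarith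
    have h5 : 0 < -(((ε : ℤ) : ℝ) * ξ (1, 0)) := by
      have : 0 < -(((ε : ℤ) : ℝ) * ξ (1, 0)) / g.lapse p ^ 2 := by
        convert h3 using 1
        ring
      have hb2 : 0 < g.lapse p ^ 2 := by positivity
      exact (div_pos_iff_of_pos_right hb2).1 this
    have h6 : ξ (1, 0) = -((ε : ℤ) : ℝ) * g.lapse p * g.conorm p η := by
      have hbc : 0 < g.lapse p * g.conorm p η := by positivity
      rcases hε with h | h <;> rw [h] at h5 ⊢ <;>
        rcases sq_eq_sq_iff_eq_or_eq_neg.1 h4 with h' | h' <;> rw [h'] at h5 ⊢ <;> linarith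
    ext w
    · simpa [nullLift] using h6
    · have := congrArg (fun L => L w) h1
      simpa [nullLift] using this

/-! ### Parallel transport and geodesics -/

/-- The components of the metric in the chart of `M` at `p₀`: the pull-back of `g` by the inverse
chart, at the point `u` of the model space. -/
noncomputable def chartMetric (p₀ : ℝ × S) (u v w : E4) : ℝ :=
  g.metric ((extChartAt I4 p₀).symm u)
    (mfderiv 𝓘(ℝ, E4) I4 (extChartAt I4 p₀).symm u v)
    (mfderiv 𝓘(ℝ, E4) I4 (extChartAt I4 p₀).symm u w)

/-- The Christoffel symbols of the first kind in the chart at `p₀`: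
`Γ(a, b; w) = ½ (∂_a g(b, w) + ∂_b g(a, w) - ∂_w g(a, b))`. -/
noncomputable def christoffel (p₀ : ℝ × S) (u a b w : E4) : ℝ :=
  (1 / 2) * (fderiv ℝ (fun z => g.chartMetric p₀ z b w) u a
    + fderiv ℝ (fun z => g.chartMetric p₀ z a w) u b
    - fderiv ℝ (fun z => g.chartMetric p₀ z a b) u w)

/-- The velocity of a curve in spacetime. -/
noncomputable def velocity (c : ℝ → ℝ × S) (τ : ℝ) : E4 :=
  mfderiv 𝓘(ℝ, ℝ) I4 c τ (1 : ℝ)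

/-- The vector field `V` along the curve `c` is parallel over `J` for the Levi-Civita connection
of `g`: in each chart, `V' + Γ(c', V) = 0` (the equation is paired with an arbitrary vector `w`
by means of the metric). -/
def IsParallelOn (c : ℝ → ℝ × S) (V : ℝ → E4) (J : Set ℝ) : Prop :=
  ∀ p₀ : ℝ × S, ∀ τ ∈ J, c τ ∈ (extChartAt I4 p₀).source →
    DifferentiableAt ℝ
      (fun r => (mfderiv I4 𝓘(ℝ, E4) (extChartAt I4 p₀) (c r) (V r) : E4)) τ ∧
    ∀ w : E4,
      g.chartMetric p₀ (extChartAt I4 p₀ (c τ))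
        (deriv (fun r => (mfderiv I4 𝓘(ℝ, E4) (extChartAt I4 p₀) (c r) (V r) : E4)) τ) w
      + g.christoffel p₀ (extChartAt I4 p₀ (c τ))
        (deriv (fun r => extChartAt I4 p₀ (c r)) τ)
        (mfderiv I4 𝓘(ℝ, E4) (extChartAt I4 p₀) (c τ) (V τ)) w = 0

/-- The curve `c` is an (affinely parameterised) geodesic of `g` on the open interval `J`. -/
structure IsGeodesicOn (c : ℝ → ℝ × S) (J : Set ℝ) : Prop where
  isOpen : IsOpen J
  ordConnected : J.OrdConnected
  smooth : ContMDiffOn 𝓘(ℝ, ℝ) I4 2 c J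
  parallel : g.IsParallelOn c (velocity c) J

/-! ### Convex normal neighbourhoods and the world function -/

/-- `C` is a normal neighbourhood of `p`: the exponential map at `p`, `e v = c_v 1` with `c_v` the
geodesic with `c_v 0 = p` and initial velocity `v`, is a diffeomorphism (with inverse `l`) of a
star-shaped open neighbourhood `D` of `0` in the tangent space onto the open set `C`. -/
def IsNormalNhd (p : ℝ × S) (C : Set (ℝ × S)) : Prop :=
  IsOpen C ∧ ∃ (D : Set E4) (e : E4 → ℝ × S) (l : ℝ × S → E4),
    IsOpen D ∧ (0 : E4) ∈ D ∧ StarConvex ℝ (0 : E4) D ∧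
    (∀ v ∈ D, ∃ (c : ℝ → ℝ × S) (J : Set ℝ), g.IsGeodesicOn c J ∧ Icc (0 : ℝ) 1 ⊆ J ∧
      c 0 = p ∧ velocity c 0 = v ∧ c 1 = e v) ∧
    ContMDiffOn 𝓘(ℝ, E4) I4 ∞ e D ∧ ContMDiffOn I4 𝓘(ℝ, E4) ∞ l C ∧
    MapsTo e D C ∧ MapsTo l C D ∧ LeftInvOn l e D ∧ RightInvOn l e C

/-- `C` is a (geodesically) convex normal neighbourhood: a normal neighbourhood of each of its
points. -/
def IsConvexNormal (C : Set (ℝ × S)) : Prop :=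
  IsOpen C ∧ ∀ p ∈ C, g.IsNormalNhd p C

/-- The Ruse-Synge world function of a convex normal neighbourhood `C`: half the squared length,
with sign, of the geodesic from `X` to `Z` in `C`, that is `½ g(c'(0), c'(0))` for the unique
geodesic `c : [0, 1] → C` with `c 0 = X` and `c 1 = Z`. -/
noncomputable def worldFunction (C : Set (ℝ × S)) (X Z : ℝ × S) : ℝ :=
  Classical.epsilon fun r : ℝ => ∃ (c : ℝ → ℝ × S) (J : Set ℝ), g.IsGeodesicOn c J ∧
    Icc (0 : ℝ) 1 ⊆ J ∧ MapsTo c (Icc 0 1) C ∧ c 0 = X ∧ c 1 = Z ∧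
    r = (1 / 2) * g.metric X (velocity c 0) (velocity c 0)

/-- The gradient `grad_Z σ(X, Z)` of the world function in its second argument. -/
noncomputable def gradWorldFunction (C : Set (ℝ × S)) (X Z : ℝ × S) : E4 :=
  g.sharp Z (mfderiv I4 𝓘(ℝ, ℝ) (fun Z' => g.worldFunction C X Z') Z : E4 →L[ℝ] ℝ)

/-! ### The Levi-Civita flow -/

/-- `(x, Ξ)` is the value `(x^±(t; s, y, η), Ξ^±(t; s, y, η))` at global time `t` of the positive
(`ε = 1`) or negative (`ε = -1`) Levi-Civita flow. The flow line is the null geodesic `c` through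
`(s, y)` with initial cotangent vector `± η_± / ‖η‖`, and `Ξ` is the parallel transport of `η_±`
along `c`; the latter is expressed by the parallel vector field `V` that is metrically dual to it.
The flow line is intersected with the Cauchy surface `{t} × S`; as time is strictly monotone along
null geodesics, they meet in one point only. -/
def IsFlowValue (ε : ℤˣ) (t s : ℝ) (y : S) (η : E3 →L[ℝ] ℝ) (x : S) (Ξ : E4 →L[ℝ] ℝ) : Prop :=
  ∃ (c : ℝ → ℝ × S) (V : ℝ → E4) (J : Set ℝ) (τ : ℝ),
    g.IsGeodesicOn c J ∧ g.IsParallelOn c V J ∧ (0 : ℝ) ∈ J ∧ τ ∈ J ∧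
    c 0 = (s, y) ∧
    velocity c 0 =
      g.sharp (s, y) ((((ε : ℤ) : ℝ) / g.conorm (s, y) η) • g.nullLift ε (s, y) η) ∧
    V 0 = g.sharp (s, y) (g.nullLift ε (s, y) η) ∧
    c τ = (t, x) ∧ V τ = g.sharp (t, x) Ξ

/-- The set `Φ^±` generated by the Levi-Civita flow: the points
`(t, x^±(t; s, y, η); s, y, η)` with `t, s` real, `y ∈ S` and `η ∈ T*_y S \ {0}`. -/
def flowSet (ε : ℤˣ) : Set (PhasePoint S) :=
  {p | ∃ (t s : ℝ) (y : S) (η : TangentSpace I3 y →L[ℝ] ℝ) (x : S) (Ξ : E4 →L[ℝ] ℝ),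
    η ≠ 0 ∧ g.IsFlowValue ε t s y η x Ξ ∧ p = ((t, x), s, ⟨y, η⟩)}

/-! ### Levi-Civita phase functions -/

/-- `M × ℝ × T'S`, with the zero section removed. -/
def puncturedPhase (S : Type*) [TopologicalSpace S] [ChartedSpace E3 S] [IsManifold I3 ∞ S] :
    Set (PhasePoint S) :=
  {p | p.2.2.2 ≠ 0}

/-- The derivative `∂_η φ (t, x; s, y, η)`: the derivative at `η` of the restriction of `φ` to the
fibre `T*_y S`, the other variables being fixed. -/
noncomputable def dEta (φ : PhasePoint S → ℂ) (p : PhasePoint S) :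
    (TangentSpace I3 p.2.2.1 →L[ℝ] ℝ) →L[ℝ] ℂ :=
  fderiv ℝ (fun η : TangentSpace I3 p.2.2.1 →L[ℝ] ℝ => φ (p.1, p.2.1, ⟨p.2.2.1, η⟩)) p.2.2.2

/-- The geometric expression `- ⟨Ξ, grad_Z σ(X, Z)⟩ + i ‖η‖ σ(X, Z)`. -/
noncomputable def localPhase (C : Set (ℝ × S)) (X Z : ℝ × S) (Ξ : E4 →L[ℝ] ℝ) (normEta : ℝ) : ℂ :=
  -((Ξ (g.gradWorldFunction C X Z) : ℝ) : ℂ)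
    + Complex.I * (normEta : ℂ) * ((g.worldFunction C X Z : ℝ) : ℂ)

/-- The points near which `φ` is given by the geometric expression: for some convex normal
neighbourhood `C`, and for all `(t, x; s, y, η)` near the given point, `X = (t, x)` and `X^±` lie
in `C` and `φ = - ⟨Ξ^±, grad_Z σ(X, Z)|_{Z = X^±}⟩ + i ‖η‖ σ(X, X^±)`. -/
def geometricRegion (ε : ℤˣ) (φ : PhasePoint S → ℂ) : Set (PhasePoint S) :=
  {p | ∃ C : Set (ℝ × S), g.IsConvexNormal C ∧ ∀ᶠ q in 𝓝 p,
    ∃ (x : S) (Ξ : E4 →L[ℝ] ℝ), g.IsFlowValue ε q.1.1 q.2.1 q.2.2.1 q.2.2.2 x Ξ ∧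
      q.1 ∈ C ∧ (q.1.1, x) ∈ C ∧
      φ q = g.localPhase C q.1 (q.1.1, x) Ξ (g.conorm (q.2.1, q.2.2.1) q.2.2.2)}

/-- `φ` is a positive (`ε = 1`) or negative (`ε = -1`) Lorentzian Levi-Civita phase function: a
smooth function on `M × ℝ × T'S`, given by the geometric expression near the Levi-Civita flow and
continued elsewhere in such a way that `Im φ ≥ 0` and `∂_η φ ≠ 0`. -/
structure IsLeviCivitaPhase (ε : ℤˣ) (φ : PhasePoint S → ℂ) : Prop where
  smooth : ContMDiffOn (IPhase) 𝓘(ℝ, ℂ) ∞ φ (puncturedPhase S)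
  geometric : g.flowSet ε ⊆ g.geometricRegion ε φ
  im_nonneg : ∀ p ∈ puncturedPhase S, 0 ≤ (φ p).im
  elsewhere : ∀ p ∈ puncturedPhase S, p ∉ g.geometricRegion ε φ → dEta φ p ≠ 0

/-- The critical set `{∂_η φ = 0}` in `M × ℝ × T'S`. -/
def criticalSet (φ : PhasePoint S → ℂ) : Set (PhasePoint S) :=
  {p | p ∈ puncturedPhase S ∧ dEta φ p = 0}

end Spacetime

/-! Fix `X = (t, x)`, `(s, y)`, and let `Z(η)` be the position at time `t` of the flow line of `η`.
Positive rescaling of `η` leaves the initial velocity `± η_±^♯ / ‖η‖` unchanged, so `Z` is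
homogeneous of degree 0 and `Im φ = ‖η‖ σ(X, Z(η))` is homogeneous of degree 1 wherever the
geometric formula holds.

Critical points lie on the flow (`mem_flowSet_of_dEta_eq_zero`). A critical point lies in the
geometric region. By Euler's identity the radial derivative of `Im φ` is `‖η‖ σ(X, Z)`, hence `σ(X,
Z) = 0`. The geodesic of the normal neighbourhood from `X` to `Z` is then null or constant. Time is
injective along a nonconstant null geodesic, whereas `X` and `Z` have the same time, so `X = Z`.

Flow points are critical (`dEta_eq_zero_of_isFlowValue`). Let `Z(η) = X`, let `η'` be near `η`, and
put `e = ‖η' - η‖`. The covector `Ξ` is metrically dual to `± ‖η‖` times the velocity of the flow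
line. With the logarithm `ℓ` at `X` one has `σ(X, ·) = ½ g(ℓ, ℓ)`, so `φ` is a combination of `‖η'‖
g(ℓ(Z'), dℓ(c''s velocity))` and `‖η'‖ g(ℓ(Z'), ℓ(Z'))`, where `c'` is the flow line of `η'` and `Z'
= Z(η')`. Since `ℓ(Z') = O(e)`, the second is `O(e²)`. Since `dℓ = id` at `X`, the first is `g(δ,
c'(τ)) + o(e)` up to the factor, with `δ` the displacement from `X` to `Z'` and the velocity now
that of the limiting flow line. It remains to see that this velocity is orthogonal to `δ` up to
`o(e)`, which is a form of the Gauss lemma.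

The Gauss lemma is proved by finite differences, without Jacobi fields or smooth dependence on
initial data. In a chart the pairing of the velocity of one geodesic with the displacement to
another has as derivative the linearised energy (`hasDerivAt_pairing`). For two null geodesics this
is `O(e²)` by Taylor's formula and conservation of energy, and the pairing vanishes at the common
starting point. Grönwall's inequality and a chain of charts carry the estimate along the flow line
(`IsGeodesicOn.isCloseAt`). The two geodesics reach time `t` at parameters differing by `O(e)`. This
shifts the displacement along a null velocity, which is orthogonal to itself, so the pairing changes
only by `o(e)` (`IsNearFamily.final`). -/

set_option maxSynthPendingDepth 3
set_option linter.unusedSectionVars false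

/-! ### Estimates near compact sets -/

section Analysis

variable {E F : Type*} [NormedAddCommGroup E] [NormedSpace ℝ E] [FiniteDimensional ℝ E]
  [NormedAddCommGroup F] [NormedSpace ℝ F]

/-- A `C¹` map is uniformly Lipschitz on the balls of a small radius around a compact set. -/
theorem IsCompact.exists_lipschitz_closedBall {f : E → F} {U K : Set E} (hK : IsCompact K)
    (hU : IsOpen U) (hKU : K ⊆ U) (hf : ContDiffOn ℝ 1 f U) :
    ∃ κ > 0, ∃ L ≥ 0, ∀ z ∈ K, Metric.closedBall z κ ⊆ U ∧
      ∀ x ∈ Metric.closedBall z κ, ∀ y ∈ Metric.closedBall z κ, ‖f y - f x‖ ≤ L * ‖y - x‖ := by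
  obtain ⟨κ, hκ, hsub⟩ := hK.exists_cthickening_subset_open hU hKU
  have hc : IsCompact (Metric.cthickening κ K) := by
    have := FiniteDimensional.proper ℝ E
    exact hK.cthickening
  have hcont : ContinuousOn (fun z => fderiv ℝ f z) (Metric.cthickening κ K) :=
    (hf.continuousOn_fderiv_of_isOpen hU le_rfl).mono hsub
  obtain ⟨L, hL⟩ := hc.exists_bound_of_continuousOn hcont
  refine ⟨κ, hκ, max L 0, le_max_right _ _, fun z hz => ?_⟩
  have hb : Metric.closedBall z κ ⊆ Metric.cthickening κ K :=
    Metric.closedBall_subset_cthickening hz κ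
  refine ⟨hb.trans hsub, fun x hx y hy => ?_⟩
  refine (convex_closedBall z κ).norm_image_sub_le_of_norm_fderiv_le (𝕜 := ℝ)
    (fun w hw => ?_) (fun w hw => (hL w (hb hw)).trans (le_max_left _ _)) hx hy
  exact (hf.differentiableOn one_ne_zero).differentiableAt (hU.mem_nhds (hsub (hb hw)))

/-- Second order Taylor estimate of a `C²` map, uniform around a compact set. -/
theorem IsCompact.exists_taylor_closedBall {f : E → F} {U K : Set E} (hK : IsCompact K)
    (hU : IsOpen U) (hKU : K ⊆ U) (hf : ContDiffOn ℝ 2 f U) :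
    ∃ κ > 0, ∃ L ≥ 0, ∀ z ∈ K, Metric.closedBall z κ ⊆ U ∧
      ∀ x ∈ Metric.closedBall z κ, ‖f x - f z - fderiv ℝ f z (x - z)‖ ≤ L * ‖x - z‖ ^ 2 := by
  obtain ⟨κ, hκ, L, hL, h⟩ := hK.exists_lipschitz_closedBall hU hKU
    (hf.fderiv_of_isOpen hU (m := 1) (by norm_num))
  refine ⟨κ, hκ, L, hL, fun z hz => ⟨(h z hz).1, fun x hx => ?_⟩⟩
  have hsub : Metric.closedBall z ‖x - z‖ ⊆ Metric.closedBall z κ :=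
    Metric.closedBall_subset_closedBall (by simpa [dist_eq_norm] using hx)
  have hz0 : z ∈ Metric.closedBall z κ := Metric.mem_closedBall_self hκ.le
  -- On the ball of radius `‖x - z‖` the derivative differs from its value at `z` by at most `L * ‖x
  -- - z‖`; the mean value inequality contributes the second factor.
  have := (convex_closedBall z ‖x - z‖).norm_image_sub_le_of_norm_fderiv_le' (𝕜 := ℝ)
    (f := f) (φ := fderiv ℝ f z) (C := L * ‖x - z‖) (x := z) (y := x)
    (fun w hw => (hf.differentiableOn two_ne_zero).differentiableAt
      (hU.mem_nhds ((h z hz).1 (hsub hw))))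
    (fun w hw => ((h z hz).2 z hz0 w (hsub hw)).trans (by
      have : ‖w - z‖ ≤ ‖x - z‖ := by simpa [dist_eq_norm] using hw
      gcongr))
    (Metric.mem_closedBall_self (norm_nonneg _)) (by simp [dist_eq_norm])
  exact this.trans (le_of_eq (by ring))

end Analysis

/-! ### Geodesics of a metric on an open set of a vector space -/

namespace MetricCoeff

variable {E : Type*} [NormedAddCommGroup E] [NormedSpace ℝ E]

/-- The Christoffel symbols of the first kind, as a bilinear form in the last two arguments. -/
noncomputable def chr (G : E → E →L[ℝ] E →L[ℝ] ℝ) (u a : E) : E →L[ℝ] E →L[ℝ] ℝ :=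
  (1 / 2 : ℝ) • (fderiv ℝ G u a + (fderiv ℝ G u).flip a - ((fderiv ℝ G u).flip a).flip)

theorem chr_apply (G : E → E →L[ℝ] E →L[ℝ] ℝ) (u a b w : E) :
    chr G u a b w =
      (1 / 2) * (fderiv ℝ G u a b w + fderiv ℝ G u b a w - fderiv ℝ G u w a b) := by
  simp [chr]

/-- The acceleration of the geodesic through `u` with velocity `v`. -/
noncomputable def accel (G : E → E →L[ℝ] E →L[ℝ] ℝ) (z : E × E) : E :=
  -((G z.1).inverse (chr G z.1 z.2 z.2))

/-- The kinetic energy. -/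
noncomputable def energy (G : E → E →L[ℝ] E →L[ℝ] ℝ) (z : E × E) : ℝ :=
  (1 / 2) * G z.1 z.2 z.2

variable {G : E → E →L[ℝ] E →L[ℝ] ℝ} {Ω : Set E}

theorem contDiffOn_chr (hΩ : IsOpen Ω) (hG : ContDiffOn ℝ ∞ G Ω) :
    ContDiffOn ℝ ∞ (fun z : E × E => chr G z.1 z.2) (Ω ×ˢ univ) := by
  have hD : ContDiffOn ℝ ∞ (fun z : E × E => fderiv ℝ G z.1) (Ω ×ˢ univ) :=
    (hG.fderiv_of_isOpen hΩ (m := ∞) (by simp)).comp contDiff_fst.contDiffOn (fun z hz => hz.1)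
  have ha : ContDiffOn ℝ ∞ (fun z : E × E => z.2) (Ω ×ˢ univ) := contDiff_snd.contDiffOn
  have hfl : ContDiffOn ℝ ∞ (fun z : E × E => (fderiv ℝ G z.1).flip z.2) (Ω ×ˢ univ) :=
    ((ContinuousLinearMap.flipₗᵢ ℝ E E (E →L[ℝ] ℝ)).contDiff.comp_contDiffOn hD).clm_apply ha
  exact (((hD.clm_apply ha).add hfl).sub
    ((ContinuousLinearMap.flipₗᵢ ℝ E E ℝ).contDiff.comp_contDiffOn hfl)).const_smul (1 / 2 : ℝ)

variable [FiniteDimensional ℝ E]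

/-- A nondegenerate bilinear form as a linear equivalence onto the dual space. -/
noncomputable def dualEquiv (B : E →L[ℝ] E →L[ℝ] ℝ) (hB : ∀ v, (∀ w, B v w = 0) → v = 0) :
    E ≃L[ℝ] (E →L[ℝ] ℝ) :=
  (LinearEquiv.ofInjectiveOfFinrankEq (B : E →ₗ[ℝ] (E →L[ℝ] ℝ))
    (by
      rw [injective_iff_map_eq_zero]
      intro v hv
      exact hB v fun w => congrArg (fun L : E →L[ℝ] ℝ => L w) hv)
    (by
      rw [← (LinearMap.toContinuousLinearMap (𝕜 := ℝ) (E := E) (F' := ℝ)).finrank_eq]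
      exact (Subspace.dual_finrank_eq (K := ℝ) (V := E)).symm)).toContinuousLinearEquiv

theorem dualEquiv_coe (B : E →L[ℝ] E →L[ℝ] ℝ) (hB : ∀ v, (∀ w, B v w = 0) → v = 0) :
    ((dualEquiv B hB : E ≃L[ℝ] (E →L[ℝ] ℝ)) : E →L[ℝ] (E →L[ℝ] ℝ)) = B := by
  ext v w
  rfl

/-- The metric coefficients `G` are smooth on the open set `Ω`, and symmetric and nondegenerate
there. -/
structure IsMetricOn (G : E → E →L[ℝ] E →L[ℝ] ℝ) (Ω : Set E) : Prop where
  isOpen : IsOpen Ω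
  smooth : ContDiffOn ℝ ∞ G Ω
  symm : ∀ u ∈ Ω, ∀ v w, G u v w = G u w v
  nondeg : ∀ u ∈ Ω, ∀ v, (∀ w, G u v w = 0) → v = 0

namespace IsMetricOn

/-- In finite dimension nondegeneracy means invertibility, and inversion of operators is smooth at
invertible ones. -/
theorem contDiffOn_inverse (h : IsMetricOn G Ω) :
    ContDiffOn ℝ ∞ (fun u => (G u).inverse) Ω := by
  intro u hu
  have := contDiffAt_map_inverse (𝕜 := ℝ) (n := ∞) (dualEquiv (G u) (h.nondeg u hu))
  rw [dualEquiv_coe] at this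
  exact this.comp_contDiffWithinAt u (h.smooth u hu)

theorem apply_inverse (h : IsMetricOn G Ω) {u : E} (hu : u ∈ Ω) (ξ : E →L[ℝ] ℝ) :
    G u ((G u).inverse ξ) = ξ := by
  have he := dualEquiv_coe (G u) (h.nondeg u hu)
  conv_lhs => rw [← he]
  rw [ContinuousLinearMap.inverse_equiv]
  simp

theorem eq_of_apply_eq (h : IsMetricOn G Ω) {u : E} (hu : u ∈ Ω) {v w : E}
    (hvw : G u v = G u w) : v = w := by
  rw [← sub_eq_zero]
  refine h.nondeg u hu _ fun x => ?_
  simp [hvw]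

theorem contDiffOn_accel (h : IsMetricOn G Ω) : ContDiffOn ℝ ∞ (accel G) (Ω ×ˢ univ) := by
  have h1 : ContDiffOn ℝ ∞ (fun z : E × E => (G z.1).inverse) (Ω ×ˢ univ) :=
    h.contDiffOn_inverse.comp contDiff_fst.contDiffOn (fun z hz => hz.1)
  exact (h1.clm_apply ((contDiffOn_chr h.isOpen h.smooth).clm_apply
    contDiff_snd.contDiffOn)).neg

theorem contDiffOn_energy (h : IsMetricOn G Ω) : ContDiffOn ℝ ∞ (energy G) (Ω ×ˢ univ) := by
  have h1 : ContDiffOn ℝ ∞ (fun z : E × E => G z.1) (Ω ×ˢ univ) :=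
    h.smooth.comp contDiff_fst.contDiffOn (fun z hz => hz.1)
  exact contDiffOn_const.mul ((h1.clm_apply contDiff_snd.contDiffOn).clm_apply
    contDiff_snd.contDiffOn)

theorem hasFDerivAt (h : IsMetricOn G Ω) {u : E} (hu : u ∈ Ω) :
    HasFDerivAt G (fderiv ℝ G u) u :=
  ((h.smooth.differentiableOn (by simp)).differentiableAt (h.isOpen.mem_nhds hu)).hasFDerivAt

/-- Symmetry of `G` merges the contributions of the two velocity slots. The result is the expression
to which the derivative of the Gauss pairing reduces. -/
theorem fderiv_energy (h : IsMetricOn G Ω) {z : E × E} (hz : z.1 ∈ Ω) (d : E × E) :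
    fderiv ℝ (energy G) z d = (1 / 2) * fderiv ℝ G z.1 d.1 z.2 z.2 + G z.1 z.2 d.2 := by
  have h1 : HasFDerivAt (fun z : E × E => G z.1)
      ((fderiv ℝ G z.1).comp (ContinuousLinearMap.fst ℝ E E)) z :=
    (h.hasFDerivAt hz).comp z hasFDerivAt_fst
  have h2 := ((h1.clm_apply hasFDerivAt_snd).clm_apply hasFDerivAt_snd).const_mul (1 / 2 : ℝ)
  have h3 : fderiv ℝ (energy G) z = _ := h2.fderiv
  rw [h3]
  simp [h.symm z.1 hz d.2 z.2]
  ring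

end IsMetricOn

/-- The state `z = (u, u')` follows the geodesic flow at time `t`. -/
def IsGeodAt (G : E → E →L[ℝ] E →L[ℝ] ℝ) (z : ℝ → E × E) (t : ℝ) : Prop :=
  HasDerivAt z ((z t).2, accel G (z t)) t

/-! ### Geodesic flow in a chart: energy, Gauss pairing and stability. -/

namespace IsMetricOn

theorem apply_accel (h : IsMetricOn G Ω) {z : E × E} (hz : z.1 ∈ Ω) (w : E) :
    G z.1 (accel G z) w = -((1 / 2) * (2 * fderiv ℝ G z.1 z.2 z.2 w
      - fderiv ℝ G z.1 w z.2 z.2)) := by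
  rw [accel, map_neg, h.apply_inverse hz, neg_apply, chr_apply]
  ring

/-- Nondegeneracy turns the geodesic equation paired with test vectors into an explicit ordinary
differential equation. -/
theorem accel_eq (h : IsMetricOn G Ω) {z : E × E} (hz : z.1 ∈ Ω) {a : E}
    (ha : ∀ w, G z.1 a w + chr G z.1 z.2 z.2 w = 0) : a = accel G z := by
  refine h.eq_of_apply_eq hz (ContinuousLinearMap.ext fun w => ?_)
  have := ha w
  rw [h.apply_accel hz, eq_neg_iff_add_eq_zero, ← this, chr_apply]
  ring

/-- The Gauss pairing `G(u)(u', w - u)` of a geodesic `u` with a nearby geodesic `w` varies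
according to the linearised energy. -/
theorem hasDerivAt_pairing (h : IsMetricOn G Ω) {z y : ℝ → E × E} {t : ℝ}
    (hz : IsGeodAt G z t) (hy : IsGeodAt G y t) (hzΩ : (z t).1 ∈ Ω) :
    HasDerivAt (fun r => G (z r).1 (z r).2 ((y r).1 - (z r).1))
      (fderiv ℝ (energy G) (z t) (y t - z t)) t := by
  have hz1 : HasDerivAt (fun r => (z r).1) (z t).2 t := hz.fst
  have hz2 : HasDerivAt (fun r => (z r).2) (accel G (z t)) t := hz.snd
  have hy1 : HasDerivAt (fun r => (y r).1) (y t).2 t := hy.fst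
  have hG : HasDerivAt (fun r => G (z r).1) (fderiv ℝ G (z t).1 (z t).2) t :=
    (h.hasFDerivAt hzΩ).comp_hasDerivAt t hz1
  have h1 : HasDerivAt (fun r => G (z r).1 (z r).2) _ t := hG.clm_apply hz2
  have h2 : HasDerivAt (fun r => G (z r).1 (z r).2 ((y r).1 - (z r).1)) _ t :=
    h1.clm_apply (hy1.sub hz1)
  -- With `δ = w - u`, the term `∂_{u'} G(u', δ)` cancels against the one in `G(u'', δ)`. What is
  -- left, `½ ∂_δ G(u', u') + G(u', w' - u')`, is the differential of the energy.
  refine h2.congr_deriv ?_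
  rw [h.fderiv_energy hzΩ, add_apply, h.apply_accel hzΩ, Prod.fst_sub,
    Prod.snd_sub]
  ring

/-- The energy is conserved along geodesics. -/
theorem hasDerivAt_energy (h : IsMetricOn G Ω) {z : ℝ → E × E} {t : ℝ}
    (hz : IsGeodAt G z t) (hzΩ : (z t).1 ∈ Ω) :
    HasDerivAt (fun r => energy G (z r)) 0 t := by
  have h1 : HasFDerivAt (energy G) (fderiv ℝ (energy G) (z t)) (z t) :=
    ((h.contDiffOn_energy.differentiableOn (by simp)).differentiableAt
      ((h.isOpen.prod isOpen_univ).mem_nhds ⟨hzΩ, mem_univ _⟩)).hasFDerivAt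
  refine (h1.comp_hasDerivAt t hz).congr_deriv ?_
  rw [h.fderiv_energy hzΩ, h.symm _ hzΩ, h.apply_accel hzΩ]
  ring

/-- Quantitative dependence of geodesics on their initial data, on a compact time interval: the
distance to a given geodesic grows at most exponentially, and the Gauss pairing is constant up to
quadratic errors, as long as the geodesics are close. -/
theorem exists_stability (h : IsMetricOn G Ω) {z : ℝ → E × E} {a b : ℝ}
    (hz : ∀ t ∈ Icc a b, IsGeodAt G z t) (hzΩ : ∀ t ∈ Icc a b, (z t).1 ∈ Ω) :
    ∃ κ > 0, ∃ L ≥ 0, (∀ t ∈ Icc a b, Metric.closedBall (z t) κ ⊆ Ω ×ˢ univ) ∧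
      ∀ y : ℝ → E × E, ∀ r₁ r₂, a ≤ r₁ → r₁ ≤ r₂ → r₂ ≤ b →
        (∀ t ∈ Icc r₁ r₂, IsGeodAt G y t) → (∀ t ∈ Icc r₁ r₂, ‖y t - z t‖ ≤ κ) →
        ‖y r₂ - z r₂‖ ≤ ‖y r₁ - z r₁‖ * Real.exp (L * (r₂ - r₁)) ∧
        ∀ m e, (∀ t ∈ Icc r₁ r₂, ‖y t - z t‖ ≤ m) →
          (∀ t ∈ Icc r₁ r₂, |energy G (y t) - energy G (z t)| ≤ e) →
          |G (z r₂).1 (z r₂).2 ((y r₂).1 - (z r₂).1) -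
            G (z r₁).1 (z r₁).2 ((y r₁).1 - (z r₁).1)| ≤ (L * m ^ 2 + e) * (r₂ - r₁) := by
  have hcont : ContinuousOn z (Icc a b) := fun t ht =>
    (hz t ht).continuousAt.continuousWithinAt
  have hK : IsCompact (z '' Icc a b) := isCompact_Icc.image_of_continuousOn hcont
  have hU : IsOpen (Ω ×ˢ (univ : Set E)) := h.isOpen.prod isOpen_univ
  have hKU : z '' Icc a b ⊆ Ω ×ˢ (univ : Set E) := by
    rintro _ ⟨t, ht, rfl⟩
    exact ⟨hzΩ t ht, mem_univ _⟩
  obtain ⟨κ₁, hκ₁, L₁, hL₁, h₁⟩ := hK.exists_lipschitz_closedBall hU hKU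
    (f := fun w : E × E => (w.2, accel G w))
    (contDiff_snd.contDiffOn.prodMk (h.contDiffOn_accel.of_le (by simp)))
  obtain ⟨κ₂, hκ₂, L₂, hL₂, h₂⟩ := hK.exists_taylor_closedBall hU hKU
    (h.contDiffOn_energy.of_le (m := 2) (by norm_cast))
  refine ⟨min κ₁ κ₂, lt_min hκ₁ hκ₂, max L₁ L₂, hL₁.trans (le_max_left _ _), fun t ht =>
    (Metric.closedBall_subset_closedBall (min_le_left _ _)).trans
      (h₁ _ (mem_image_of_mem z ht)).1, ?_⟩
  intro y r₁ r₂ ha h12 hb hy hclose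
  have hsub : Icc r₁ r₂ ⊆ Icc a b := Icc_subset_Icc ha hb
  refine ⟨?_, fun m e hm he => ?_⟩
  -- Grönwall's inequality; the geodesic field is Lipschitz only near `z`, so the admissible set is
  -- a ball moving with `z t`.
  · have hg := dist_le_of_trajectories_ODE_of_mem (E := E × E)
      (v := fun _ w => (w.2, accel G w)) (K := ⟨max L₁ L₂, hL₁.trans (le_max_left _ _)⟩)
      (s := fun t => Metric.closedBall (z t) κ₁) (f := y) (g := z) (a := r₁) (b := r₂)
      (δ := ‖y r₁ - z r₁‖)
      (fun t ht => LipschitzOnWith.of_dist_le_mul fun x hx w hw => by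
        rw [dist_eq_norm, dist_eq_norm]
        refine ((h₁ _ (mem_image_of_mem z (hsub (Ico_subset_Icc_self ht)))).2 w hw x hx).trans ?_
        exact mul_le_mul_of_nonneg_right (le_max_left _ _) (norm_nonneg _))
      (fun t ht => (hy t ht).continuousAt.continuousWithinAt)
      (fun t ht => (hy t (Ico_subset_Icc_self ht)).hasDerivWithinAt)
      (fun t ht => by
        rw [Metric.mem_closedBall, dist_eq_norm]
        exact (hclose t (Ico_subset_Icc_self ht)).trans (min_le_left _ _))
      (hcont.mono hsub)
      (fun t ht => (hz t (hsub (Ico_subset_Icc_self ht))).hasDerivWithinAt)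
      (fun t ht => Metric.mem_closedBall_self hκ₁.le)
      (by rw [dist_eq_norm]) r₂ (right_mem_Icc.2 h12)
    rw [dist_eq_norm] at hg
    exact hg
  -- The derivative of the pairing is the energy difference minus a second order Taylor remainder,
  -- whence `e` and `L * m ^ 2`.
  · have hd : ∀ t ∈ Icc r₁ r₂, ‖fderiv ℝ (energy G) (z t) (y t - z t)‖
        ≤ max L₁ L₂ * m ^ 2 + e := by
      intro t ht
      have e1 := (h₂ _ (mem_image_of_mem z (hsub ht))).2 (y t) (by
        rw [Metric.mem_closedBall, dist_eq_norm]
        exact (hclose t ht).trans (min_le_right _ _))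
      have e2 : L₂ * ‖y t - z t‖ ^ 2 ≤ max L₁ L₂ * m ^ 2 := by
        have := hm t ht
        have := le_max_right L₁ L₂
        gcongr
      have e3 := he t ht
      rw [Real.norm_eq_abs] at e1 ⊢
      rw [abs_le] at e1 e3 ⊢
      constructor <;> linarith [e1.1, e1.2, e3.1, e3.2]
    have := (convex_Icc r₁ r₂).norm_image_sub_le_of_norm_hasDerivWithin_le
      (fun t ht => (h.hasDerivAt_pairing (hz t (hsub ht)) (hy t ht)
        (hzΩ t (hsub ht))).hasDerivWithinAt) hd (left_mem_Icc.2 h12) (right_mem_Icc.2 h12)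
    rw [Real.norm_eq_abs, Real.norm_eq_abs, abs_of_nonneg (sub_nonneg.2 h12)] at this
    exact this

/-- A parallel field along a curve in a chart which vanishes at some time vanishes
identically. -/
theorem parallel_eq_zero (h : IsMetricOn G Ω) {u u' V V' : ℝ → E} {a b t₀ : ℝ}
    (hu : ContinuousOn u (Ioo a b)) (huΩ : MapsTo u (Ioo a b) Ω)
    (hu' : ContinuousOn u' (Ioo a b)) (hV : ∀ t ∈ Ioo a b, HasDerivAt V (V' t) t)
    (hpar : ∀ t ∈ Ioo a b, ∀ w, G (u t) (V' t) w + chr G (u t) (u' t) (V t) w = 0)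
    (ht₀ : t₀ ∈ Ioo a b) (h0 : V t₀ = 0) : EqOn V 0 (Ioo a b) := by
  intro t ht
  -- The equation is linear, `V' = B V`, but `B` is known to be bounded only on compact
  -- subintervals; one is chosen with `t₀` and `t` in its interior.
  obtain ⟨a', ha, ha'⟩ := exists_between (lt_min ht₀.1 ht.1)
  obtain ⟨b', hb', hb⟩ := exists_between (max_lt ht₀.2 ht.2)
  rw [lt_min_iff] at ha'
  rw [max_lt_iff] at hb'
  have hsub : Icc a' b' ⊆ Ioo a b := Icc_subset_Ioo ha hb
  set B : ℝ → E →L[ℝ] E := fun r => -((G (u r)).inverse.comp (chr G (u r) (u' r))) with hB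
  have hVB : ∀ r ∈ Ioo a b, V' r = B r (V r) := fun r hr => by
    refine h.eq_of_apply_eq (huΩ hr) (ContinuousLinearMap.ext fun w => ?_)
    have := hpar r hr w
    simp only [hB, neg_apply, ContinuousLinearMap.comp_apply, map_neg]
    rw [h.apply_inverse (huΩ hr), eq_neg_iff_add_eq_zero, this]
  have hBc : ContinuousOn B (Icc a' b') := by
    have h1 : ContinuousOn (fun r => (G (u r)).inverse) (Icc a' b') :=
      h.contDiffOn_inverse.continuousOn.comp (hu.mono hsub) (huΩ.mono_left hsub)
    have h2 : ContinuousOn (fun r => chr G (u r) (u' r)) (Icc a' b') :=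
      ContinuousOn.comp (g := fun z : E × E => chr G z.1 z.2) (f := fun r => (u r, u' r))
        (t := Ω ×ˢ univ) (contDiffOn_chr h.isOpen h.smooth).continuousOn
        ((hu.mono hsub).prodMk (hu'.mono hsub)) fun r hr => ⟨huΩ (hsub hr), mem_univ _⟩
    exact (h1.clm_comp h2).neg
  obtain ⟨K, hK⟩ := isCompact_Icc.exists_bound_of_continuousOn hBc
  have hsub' : Ioo a' b' ⊆ Icc a' b' := Ioo_subset_Icc_self
  exact ODE_solution_unique_of_mem_Ioo (v := fun r x => B r x) (s := fun _ => univ)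
    (K := ⟨max K 0, le_max_right _ _⟩) (t₀ := t₀) (a := a') (b := b')
    (fun r hr => ((B r).lipschitz.weaken ((hK r (hsub' hr)).trans (le_max_left _ _))).lipschitzOnWith)
    ⟨ha'.1, hb'.1⟩
    (fun r hr => ⟨hVB r (hsub (hsub' hr)) ▸ hV r (hsub (hsub' hr)), mem_univ _⟩)
    (fun r hr => ⟨by simp, mem_univ _⟩)
    h0 ⟨ha'.2, hb'.2⟩

end IsMetricOn

end MetricCoeff

namespace Spacetime

variable {S : Type*} [TopologicalSpace S] [ChartedSpace E3 S] [IsManifold I3 ∞ S]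
  (g : Spacetime S)

/-! ### The metric in charts -/

/-- The Lorentzian metric as a continuous bilinear form. -/
noncomputable def metricL (p : ℝ × S) : E4 →L[ℝ] E4 →L[ℝ] ℝ :=
  (-(g.lapse p) ^ 2) •
    (ContinuousLinearMap.fst ℝ ℝ E3).smulRight (ContinuousLinearMap.fst ℝ ℝ E3)
  + ContinuousLinearMap.bilinearComp
      ((g.spatial p.1).inner p.2 : E3 →L[ℝ] E3 →L[ℝ] ℝ)
      (ContinuousLinearMap.snd ℝ ℝ E3) (ContinuousLinearMap.snd ℝ ℝ E3)

theorem metricL_apply (p : ℝ × S) (v w : E4) : g.metricL p v w = g.metric p v w := by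
  have : g.metricL p v w = (-(g.lapse p) ^ 2) * (v.1 * w.1) + g.h p v.2 w.2 := rfl
  rw [this, metric]
  ring

theorem h_symm (p : ℝ × S) (v w : E3) : g.h p v w = g.h p w v :=
  (g.spatial p.1).symm p.2 v w

theorem metric_symm (p : ℝ × S) (v w : E4) : g.metric p v w = g.metric p w v := by
  rw [metric, metric, g.h_symm]
  ring

theorem metric_nondeg (p : ℝ × S) (v : E4) (hv : ∀ w, g.metric p v w = 0) : v = 0 := by
  have hb := g.lapse_pos p
  refine Prod.ext ?_ ?_
  · have := hv (1, 0)
    simp only [metric, h_zero_right] at this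
    simpa [hb.ne'] using this
  · by_contra hne
    have := hv (0, v.2)
    simp only [metric, mul_zero, zero_add] at this
    exact (g.h_pos p v.2 hne).ne' this

theorem metric_sharp (p : ℝ × S) (ξ : E4 →L[ℝ] ℝ) (w : E4) :
    g.metric p (g.sharp p ξ) w = ξ w := by
  have hsplit : ξ w = w.1 * ξ (1, 0) + ξ (0, w.2) := by
    have : w = w.1 • ((1, 0) : E4) + (0, w.2) := by ext <;> simp
    conv_lhs => rw [this]
    rw [map_add, map_smul, smul_eq_mul]
  have hb := g.lapse_pos p
  rw [g.sharp_eq, hsplit]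
  simp only [metric, spatialSharp_spec, ContinuousLinearMap.comp_apply,
    ContinuousLinearMap.inr_apply]
  field_simp

/-- The derivative of the inverse chart. -/
noncomputable def chartSymmD (p₀ : ℝ × S) (u : E4) : E4 →L[ℝ] E4 :=
  mfderiv 𝓘(ℝ, E4) I4 (extChartAt I4 p₀).symm u

/-- The derivative of the chart. -/
noncomputable def chartD (p₀ p : ℝ × S) : E4 →L[ℝ] E4 :=
  mfderiv I4 𝓘(ℝ, E4) (extChartAt I4 p₀) p

/-- The metric coefficients in the chart at `p₀`. -/
noncomputable def chartG (p₀ : ℝ × S) (u : E4) : E4 →L[ℝ] E4 →L[ℝ] ℝ :=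
  ContinuousLinearMap.bilinearComp (g.metricL ((extChartAt I4 p₀).symm u))
    (chartSymmD p₀ u) (chartSymmD p₀ u)

theorem chartG_apply (p₀ : ℝ × S) (u v w : E4) :
    g.chartG p₀ u v w = g.chartMetric p₀ u v w := by
  rw [chartG, ContinuousLinearMap.bilinearComp_apply, metricL_apply]
  rfl

theorem chartD_comp_chartSymmD {p₀ : ℝ × S} {u : E4} (hu : u ∈ (extChartAt I4 p₀).target)
    (v : E4) : chartD p₀ ((extChartAt I4 p₀).symm u) (chartSymmD p₀ u v) = v := by
  have := mfderiv_extChartAt_comp_mfderivWithin_extChartAt_symm (I := I4) hu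
  rw [I4.range_eq_univ, mfderivWithin_univ] at this
  exact congrArg (fun L => L v) this

theorem chartSymmD_comp_chartD {p₀ p : ℝ × S} (hp : p ∈ (extChartAt I4 p₀).source)
    (v : E4) : chartSymmD p₀ (extChartAt I4 p₀ p) (chartD p₀ p v) = v := by
  have := mfderivWithin_extChartAt_symm_comp_mfderiv_extChartAt' (I := I4) hp
  rw [I4.range_eq_univ, mfderivWithin_univ] at this
  exact congrArg (fun L => L v) this

theorem chartMetric_chartD {p₀ p : ℝ × S} (hp : p ∈ (extChartAt I4 p₀).source) (v w : E4) :
    g.chartMetric p₀ (extChartAt I4 p₀ p) (chartD p₀ p v) (chartD p₀ p w) = g.metric p v w := by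
  have h1 := chartSymmD_comp_chartD hp
  have h2 : (extChartAt I4 p₀).symm (extChartAt I4 p₀ p) = p := (extChartAt I4 p₀).left_inv hp
  rw [← chartG_apply, chartG, ContinuousLinearMap.bilinearComp_apply, h1, h1, h2, metricL_apply]

/-- The chart of the factor `ℝ` is the identity, so global time is a coordinate of every chart. -/
theorem extChartAt_symm_fst (p₀ : ℝ × S) (u : E4) : ((extChartAt I4 p₀).symm u).1 = u.1 := rfl

theorem contMDiffOn_chart_symm (p₀ : ℝ × S) :
    ContMDiffOn 𝓘(ℝ, E4) I4 ∞ (extChartAt I4 p₀).symm (extChartAt I4 p₀).target :=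
  contMDiffOn_extChartAt_symm p₀

theorem mdifferentiableAt_chart_symm {p₀ : ℝ × S} {u : E4}
    (hu : u ∈ (extChartAt I4 p₀).target) :
    MDifferentiableAt 𝓘(ℝ, E4) I4 (extChartAt I4 p₀).symm u :=
  ((contMDiffOn_chart_symm p₀).contMDiffAt
    ((isOpen_extChartAt_target p₀).mem_nhds hu)).mdifferentiableAt (by simp)

theorem chartSymmD_fst {p₀ : ℝ × S} {u : E4} (hu : u ∈ (extChartAt I4 p₀).target) (v : E4) :
    (chartSymmD p₀ u v).1 = v.1 := by
  have h1 : mfderiv 𝓘(ℝ, E4) 𝓘(ℝ, ℝ) (Prod.fst ∘ (extChartAt I4 p₀).symm) u =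
      (mfderiv I4 𝓘(ℝ, ℝ) Prod.fst ((extChartAt I4 p₀).symm u)).comp
        (mfderiv 𝓘(ℝ, E4) I4 (extChartAt I4 p₀).symm u) :=
    mfderiv_comp u mdifferentiableAt_fst (mdifferentiableAt_chart_symm hu)
  have h2 : (Prod.fst ∘ (extChartAt I4 p₀).symm) = (Prod.fst : E4 → ℝ) :=
    funext fun u => extChartAt_symm_fst p₀ u
  rw [h2, mfderiv_fst, mfderiv_eq_fderiv, fderiv_fst] at h1
  exact (congrArg (fun L : E4 →L[ℝ] ℝ => L v) h1).symm

/-- The spatial metric is smooth as a section of a bundle, so its arguments are needed as smooth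
maps into the tangent bundle. Here a constant field is pushed forward by the tangent map of the
spatial part of the inverse chart. -/
theorem contMDiffOn_chartSymmD_snd (p₀ : ℝ × S) (v : E4) :
    ContMDiffOn 𝓘(ℝ, E4) (I3.prod 𝓘(ℝ, E3)) ∞
      (fun u => TotalSpace.mk' E3 (E := fun x : S => TangentSpace I3 x)
        ((extChartAt I4 p₀).symm u).2 (chartSymmD p₀ u v).2) (extChartAt I4 p₀).target := by
  set T := (extChartAt I4 p₀).target with hT
  have hTo : IsOpen T := isOpen_extChartAt_target p₀
  have h1 : ContMDiffOn 𝓘(ℝ, E4) I3 ∞ (Prod.snd ∘ (extChartAt I4 p₀).symm) T :=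
    contMDiff_snd.comp_contMDiffOn (contMDiffOn_chart_symm p₀)
  have h2 := h1.contMDiffOn_tangentMapWithin (m := ∞) (by simp) hTo.uniqueMDiffOn
  have h3 : ContMDiffOn 𝓘(ℝ, E4) (𝓘(ℝ, E4).prod 𝓘(ℝ, E4)) ∞
      (fun u : E4 => (⟨u, v⟩ : TangentBundle 𝓘(ℝ, E4) E4)) T := by
    intro u hu
    rw [contMDiffWithinAt_totalSpace]
    refine ⟨contMDiffWithinAt_id, ?_⟩
    simpa using contMDiffWithinAt_const
  have h4 := h2.comp h3 (fun u hu => hu)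
  refine h4.congr fun u hu => ?_
  have h5 : mfderivWithin 𝓘(ℝ, E4) I3 (Prod.snd ∘ (extChartAt I4 p₀).symm) T u =
      (mfderiv I4 I3 Prod.snd ((extChartAt I4 p₀).symm u)).comp
        (mfderiv 𝓘(ℝ, E4) I4 (extChartAt I4 p₀).symm u) := by
    rw [mfderivWithin_of_isOpen hTo hu]
    exact mfderiv_comp u mdifferentiableAt_snd (mdifferentiableAt_chart_symm hu)
  simp only [Function.comp_apply, tangentMapWithin, h5, mfderiv_snd]
  rfl

/-- Charts preserve the `∂_t` component, so the lapse term has constant factors `v.1` and `w.1`, and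
the spatial term is a contraction of smooth sections. -/
theorem contDiffOn_chartMetric (p₀ : ℝ × S) (v w : E4) :
    ContDiffOn ℝ ∞ (fun u => g.chartMetric p₀ u v w) (extChartAt I4 p₀).target := by
  set T := (extChartAt I4 p₀).target with hT
  have hs := contMDiffOn_chart_symm p₀
  have hl : ContDiffOn ℝ ∞ (fun u => g.lapse ((extChartAt I4 p₀).symm u)) T :=
    contMDiffOn_iff_contDiffOn.1 (g.lapse_smooth.comp_contMDiffOn hs)
  have hi := g.spatial_smooth.comp_contMDiffOn hs
  have hb := ContMDiffOn.clm_bundle_apply₂ (F₁ := E3) (F₂ := E3) (F₃ := ℝ)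
    (E₁ := fun x : S => TangentSpace I3 x) (E₂ := fun x : S => TangentSpace I3 x)
    (E₃ := Bundle.Trivial S ℝ) hi
    (contMDiffOn_chartSymmD_snd p₀ v) (contMDiffOn_chartSymmD_snd p₀ w)
  have hb' : ContDiffOn ℝ ∞ (fun u => g.h ((extChartAt I4 p₀).symm u)
      (chartSymmD p₀ u v).2 (chartSymmD p₀ u w).2) T := by
    rw [← contMDiffOn_iff_contDiffOn]
    intro u hu
    have := (contMDiffWithinAt_totalSpace.1 (hb u hu)).2
    exact this
  have hm : ContDiffOn ℝ ∞ (fun u => -(g.lapse ((extChartAt I4 p₀).symm u)) ^ 2 * v.1 * w.1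
      + g.h ((extChartAt I4 p₀).symm u) (chartSymmD p₀ u v).2 (chartSymmD p₀ u w).2) T :=
    (((hl.pow 2).neg.mul contDiffOn_const).mul contDiffOn_const).add hb'
  refine hm.congr fun u hu => ?_
  have e1 := chartSymmD_fst hu v
  have e2 := chartSymmD_fst hu w
  rw [← e1, ← e2]
  rfl

theorem isMetricOn_chartG (p₀ : ℝ × S) :
    MetricCoeff.IsMetricOn (g.chartG p₀) (extChartAt I4 p₀).target where
  isOpen := isOpen_extChartAt_target p₀
  smooth := by
    rw [contDiffOn_clm_apply]
    intro v
    rw [contDiffOn_clm_apply]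
    intro w
    exact (g.contDiffOn_chartMetric p₀ v w).congr fun u _ => g.chartG_apply p₀ u v w
  symm u _ v w := by
    rw [chartG_apply, chartG_apply]
    exact g.metric_symm _ _ _
  nondeg u hu v hv := by
    have h1 : chartSymmD p₀ u v = 0 := by
      refine g.metric_nondeg ((extChartAt I4 p₀).symm u) _ fun w => ?_
      have hw := hv (chartD p₀ ((extChartAt I4 p₀).symm u) w)
      have h2 := chartSymmD_comp_chartD ((extChartAt I4 p₀).map_target hu) w
      rw [(extChartAt I4 p₀).right_inv hu] at h2
      rw [chartG, ContinuousLinearMap.bilinearComp_apply, h2, metricL_apply] at hw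
      exact hw
    rw [← chartD_comp_chartSymmD hu v, h1, map_zero]

theorem chr_chartG {p₀ : ℝ × S} {u : E4} (hu : u ∈ (extChartAt I4 p₀).target) (a b w : E4) :
    MetricCoeff.chr (g.chartG p₀) u a b w = g.christoffel p₀ u a b w := by
  have key : ∀ x y z : E4, fderiv ℝ (g.chartG p₀) u x y z =
      fderiv ℝ (fun q => g.chartMetric p₀ q y z) u x := by
    intro x y z
    have h1 := (g.isMetricOn_chartG p₀).hasFDerivAt hu
    have h2 := (h1.clm_apply (hasFDerivAt_const y u)).clm_apply (hasFDerivAt_const z u)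
    have h3 : (fun q => g.chartMetric p₀ q y z) = fun q => g.chartG p₀ q y z :=
      funext fun q => (g.chartG_apply p₀ q y z).symm
    rw [h3, h2.fderiv]
    simp
  rw [MetricCoeff.chr_apply, christoffel, key, key, key]

end Spacetime

namespace Spacetime

variable {S : Type*} [TopologicalSpace S] [ChartedSpace E3 S] [IsManifold I3 ∞ S]
  {g : Spacetime S}

/-! ### Curves in charts -/

/-- Position and velocity of a curve in the chart at `p₀`. -/
noncomputable def chartState (p₀ : ℝ × S) (c : ℝ → ℝ × S) (r : ℝ) : E4 × E4 :=
  (extChartAt I4 p₀ (c r), chartD p₀ (c r) (velocity c r))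

theorem mdifferentiableAt_chart {p₀ p : ℝ × S} (hp : p ∈ (extChartAt I4 p₀).source) :
    MDifferentiableAt I4 𝓘(ℝ, E4) (extChartAt I4 p₀) p :=
  mdifferentiableAt_extChartAt (by rwa [extChartAt_source] at hp)

theorem hasDerivAt_chart {p₀ : ℝ × S} {c : ℝ → ℝ × S} {τ : ℝ}
    (hc : MDifferentiableAt 𝓘(ℝ, ℝ) I4 c τ) (hs : c τ ∈ (extChartAt I4 p₀).source) :
    HasDerivAt (fun r => extChartAt I4 p₀ (c r)) (chartD p₀ (c τ) (velocity c τ)) τ := by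
  have h1 := (mdifferentiableAt_chart hs).hasMFDerivAt.comp τ hc.hasMFDerivAt
  have h2 : HasFDerivAt (fun r => extChartAt I4 p₀ (c r))
      ((chartD p₀ (c τ)).comp (mfderiv 𝓘(ℝ, ℝ) I4 c τ : ℝ →L[ℝ] E4)) τ := h1.hasFDerivAt
  exact h2.hasDerivAt

/-- The equation of parallel transport in a chart. -/
theorem isParallelOn_iff {c : ℝ → ℝ × S} {V : ℝ → E4} {J : Set ℝ}
    (hc : ∀ τ ∈ J, MDifferentiableAt 𝓘(ℝ, ℝ) I4 c τ) :
    g.IsParallelOn c V J ↔ ∀ p₀ : ℝ × S, ∀ τ ∈ J, c τ ∈ (extChartAt I4 p₀).source →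
      ∃ V' : E4, HasDerivAt (fun r => chartD p₀ (c r) (V r)) V' τ ∧
        ∀ w, g.chartG p₀ (extChartAt I4 p₀ (c τ)) V' w +
          MetricCoeff.chr (g.chartG p₀) (extChartAt I4 p₀ (c τ))
            (chartD p₀ (c τ) (velocity c τ)) (chartD p₀ (c τ) (V τ)) w = 0 := by
  have key : ∀ p₀ : ℝ × S, ∀ τ ∈ J, c τ ∈ (extChartAt I4 p₀).source → ∀ V' w : E4,
      g.chartG p₀ (extChartAt I4 p₀ (c τ)) V' w +
          MetricCoeff.chr (g.chartG p₀) (extChartAt I4 p₀ (c τ))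
            (chartD p₀ (c τ) (velocity c τ)) (chartD p₀ (c τ) (V τ)) w =
      g.chartMetric p₀ (extChartAt I4 p₀ (c τ)) V' w
      + g.christoffel p₀ (extChartAt I4 p₀ (c τ))
        (deriv (fun r => extChartAt I4 p₀ (c r)) τ) (chartD p₀ (c τ) (V τ)) w := by
    intro p₀ τ hτ hs V' w
    rw [(hasDerivAt_chart (hc τ hτ) hs).deriv, g.chartG_apply,
      g.chr_chartG ((extChartAt I4 p₀).map_source hs)]
  constructor
  · intro h p₀ τ hτ hs
    obtain ⟨hd, hp⟩ := h p₀ τ hτ hs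
    exact ⟨_, hd.hasDerivAt, fun w => (key p₀ τ hτ hs _ w).trans (hp w)⟩
  · intro h p₀ τ hτ hs
    obtain ⟨V', hd, hp⟩ := h p₀ τ hτ hs
    refine ⟨hd.differentiableAt, fun w => ?_⟩
    have h1 := (key p₀ τ hτ hs V' w).symm.trans (hp w)
    rw [← hd.deriv] at h1
    exact h1

theorem IsGeodesicOn.contMDiffAt {c : ℝ → ℝ × S} {J : Set ℝ} (h : g.IsGeodesicOn c J) {τ : ℝ}
    (hτ : τ ∈ J) : ContMDiffAt 𝓘(ℝ, ℝ) I4 2 c τ :=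
  h.smooth.contMDiffAt (h.isOpen.mem_nhds hτ)

theorem IsGeodesicOn.mdifferentiableAt {c : ℝ → ℝ × S} {J : Set ℝ} (h : g.IsGeodesicOn c J)
    {τ : ℝ} (hτ : τ ∈ J) : MDifferentiableAt 𝓘(ℝ, ℝ) I4 c τ :=
  (h.contMDiffAt hτ).mdifferentiableAt two_ne_zero

theorem IsGeodesicOn.continuousAt {c : ℝ → ℝ × S} {J : Set ℝ} (h : g.IsGeodesicOn c J)
    {τ : ℝ} (hτ : τ ∈ J) : ContinuousAt c τ :=
  (h.contMDiffAt hτ).continuousAt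

theorem IsGeodesicOn.continuousOn {c : ℝ → ℝ × S} {J : Set ℝ} (h : g.IsGeodesicOn c J) :
    ContinuousOn c J := fun _ hτ => (h.continuousAt hτ).continuousWithinAt

/-- In a chart, geodesics are integral curves of the geodesic field. -/
theorem IsGeodesicOn.isGeodAt {c : ℝ → ℝ × S} {J : Set ℝ} (h : g.IsGeodesicOn c J)
    {p₀ : ℝ × S} {τ : ℝ} (hτ : τ ∈ J) (hs : c τ ∈ (extChartAt I4 p₀).source) :
    MetricCoeff.IsGeodAt (g.chartG p₀) (chartState p₀ c) τ := by
  obtain ⟨V', hd, hp⟩ := (isParallelOn_iff fun _ => h.mdifferentiableAt).1 h.parallel p₀ τ hτ hs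
  have hV' : V' = MetricCoeff.accel (g.chartG p₀) (chartState p₀ c τ) :=
    (g.isMetricOn_chartG p₀).accel_eq (z := chartState p₀ c τ)
      ((extChartAt I4 p₀).map_source hs) hp
  exact (hasDerivAt_chart (h.mdifferentiableAt hτ) hs).prodMk (hV' ▸ hd)

theorem energy_chartState {p₀ : ℝ × S} {c : ℝ → ℝ × S} {τ : ℝ}
    (hs : c τ ∈ (extChartAt I4 p₀).source) :
    MetricCoeff.energy (g.chartG p₀) (chartState p₀ c τ) =
      (1 / 2) * g.metric (c τ) (velocity c τ) (velocity c τ) := by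
  rw [MetricCoeff.energy, g.chartG_apply, ← g.chartMetric_chartD hs]
  rfl

/-- Conservation of energy is local, so the chart centred at `c τ` suffices. -/
theorem IsGeodesicOn.hasDerivAt_energy {c : ℝ → ℝ × S} {J : Set ℝ} (h : g.IsGeodesicOn c J)
    {τ : ℝ} (hτ : τ ∈ J) :
    HasDerivAt (fun r => g.metric (c r) (velocity c r) (velocity c r)) 0 τ := by
  have hs : c τ ∈ (extChartAt I4 (c τ)).source := mem_extChartAt_source (c τ)
  have h1 := (g.isMetricOn_chartG (c τ)).hasDerivAt_energy (h.isGeodAt hτ hs)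
    ((extChartAt I4 (c τ)).map_source hs)
  have h2 := (h1.const_mul 2)
  rw [mul_zero] at h2
  refine h2.congr_of_eventuallyEq ?_
  filter_upwards [(h.continuousAt hτ).preimage_mem_nhds
    ((isOpen_extChartAt_source (c τ)).mem_nhds hs)] with r hr
  rw [energy_chartState hr]
  ring

theorem IsGeodesicOn.energy_eq {c : ℝ → ℝ × S} {J : Set ℝ} (h : g.IsGeodesicOn c J)
    {τ σ : ℝ} (hτ : τ ∈ J) (hσ : σ ∈ J) :
    g.metric (c τ) (velocity c τ) (velocity c τ) =
      g.metric (c σ) (velocity c σ) (velocity c σ) :=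
  h.isOpen.is_const_of_deriv_eq_zero h.ordConnected.isPreconnected
    (fun _ hr => (h.hasDerivAt_energy hr).differentiableAt.differentiableWithinAt)
    (fun _ hr => (h.hasDerivAt_energy hr).deriv) hτ hσ

/-! ### Parallel fields -/

theorem IsParallelOn.sub {c : ℝ → ℝ × S} {V W : ℝ → E4} {J : Set ℝ}
    (hc : ∀ τ ∈ J, MDifferentiableAt 𝓘(ℝ, ℝ) I4 c τ) (hV : g.IsParallelOn c V J)
    (hW : g.IsParallelOn c W J) : g.IsParallelOn c (fun r => V r - W r) J := by
  rw [isParallelOn_iff hc] at hV hW ⊢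
  intro p₀ τ hτ hs
  obtain ⟨V', hV1, hV2⟩ := hV p₀ τ hτ hs
  obtain ⟨W', hW1, hW2⟩ := hW p₀ τ hτ hs
  refine ⟨V' - W', (hV1.sub hW1).congr_of_eventuallyEq (Eventually.of_forall fun r =>
    (chartD p₀ (c r)).map_sub (V r) (W r)), fun w => ?_⟩
  have h1 := hV2 w
  have h2 := hW2 w
  simp only [map_sub, sub_apply] at h1 h2 ⊢
  linarith

theorem IsParallelOn.const_smul {c : ℝ → ℝ × S} {V : ℝ → E4} {J : Set ℝ}
    (hc : ∀ τ ∈ J, MDifferentiableAt 𝓘(ℝ, ℝ) I4 c τ)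
    (hV : g.IsParallelOn c V J) (k : ℝ) : g.IsParallelOn c (fun r => k • V r) J := by
  rw [isParallelOn_iff hc] at hV ⊢
  intro p₀ τ hτ hs
  obtain ⟨V', hV1, hV2⟩ := hV p₀ τ hτ hs
  refine ⟨k • V', (hV1.const_smul k).congr_of_eventuallyEq (Eventually.of_forall fun r =>
    (chartD p₀ (c r)).map_smul k (V r)), fun w => ?_⟩
  have h1 := hV2 w
  simp only [map_smul, smul_apply, smul_eq_mul] at h1 ⊢
  rw [← mul_add, h1, mul_zero]

/-- A parallel field along a geodesic which vanishes at one point vanishes. -/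
theorem IsParallelOn.eq_zero {c : ℝ → ℝ × S} {V : ℝ → E4} {J : Set ℝ} (hc : g.IsGeodesicOn c J)
    (hV : g.IsParallelOn c V J) {τ₀ : ℝ} (hτ₀ : τ₀ ∈ J) (h0 : V τ₀ = 0) :
    ∀ τ ∈ J, V τ = 0 := by
  have key : ∀ τ ∈ J, ∃ a b, τ ∈ Ioo a b ∧ Ioo a b ⊆ J ∧
      ∀ r ∈ Ioo a b, V r = 0 → ∀ r' ∈ Ioo a b, V r' = 0 := by
    intro τ hτ
    set p₀ := c τ
    have hs : c τ ∈ (extChartAt I4 p₀).source := mem_extChartAt_source (c τ)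
    have hmem : J ∩ c ⁻¹' (extChartAt I4 p₀).source ∈ 𝓝 τ :=
      inter_mem (hc.isOpen.mem_nhds hτ) ((hc.continuousAt hτ).preimage_mem_nhds
        ((isOpen_extChartAt_source p₀).mem_nhds hs))
    obtain ⟨a, b, hab, hsub⟩ := mem_nhds_iff_exists_Ioo_subset.1 hmem
    have hJ : ∀ r ∈ Ioo a b, r ∈ J := fun r hr => (hsub hr).1
    have hS : ∀ r ∈ Ioo a b, c r ∈ (extChartAt I4 p₀).source := fun r hr => (hsub hr).2
    refine ⟨a, b, hab, hJ, fun r hr hr0 r' hr' => ?_⟩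
    have hz : ∀ t ∈ Ioo a b, ContinuousAt (chartState p₀ c) t := fun t ht =>
      (hc.isGeodAt (hJ t ht) (hS t ht)).continuousAt
    have hpar : ∀ t ∈ Ioo a b, _ := fun t ht =>
      (isParallelOn_iff fun _ => hc.mdifferentiableAt).1 hV p₀ t (hJ t ht) (hS t ht)
    choose! V' hd hp using hpar
    have := (g.isMetricOn_chartG p₀).parallel_eq_zero (a := a) (b := b)
      (u := fun t => (chartState p₀ c t).1) (u' := fun t => (chartState p₀ c t).2)
      (V := fun t => chartD p₀ (c t) (V t)) (V' := V')
      (fun t ht => (hz t ht).fst.continuousWithinAt)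
      (fun t ht => (extChartAt I4 p₀).map_source (hS t ht))
      (fun t ht => (hz t ht).snd.continuousWithinAt) hd hp
      hr (by simp only [hr0, map_zero]) hr'
    rw [← chartSymmD_comp_chartD (hS r' hr') (V r')]
    simp only at this
    rw [this, Pi.zero_apply, map_zero]
  -- By local uniqueness the zero set of `V` and its complement in `J` are both open; `J` is
  -- connected.
  have hopen : IsOpen {τ | τ ∈ J ∧ V τ = 0} := by
    rw [isOpen_iff_mem_nhds]
    rintro τ ⟨hτ, hz⟩
    obtain ⟨a, b, hab, hJ, h⟩ := key τ hτ
    filter_upwards [Ioo_mem_nhds hab.1 hab.2] with r hr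
    exact ⟨hJ hr, h τ hab hz r hr⟩
  have hopen' : IsOpen {τ | τ ∈ J ∧ V τ ≠ 0} := by
    rw [isOpen_iff_mem_nhds]
    rintro τ ⟨hτ, hz⟩
    obtain ⟨a, b, hab, hJ, h⟩ := key τ hτ
    filter_upwards [Ioo_mem_nhds hab.1 hab.2] with r hr
    exact ⟨hJ hr, fun h0 => hz (h r hr h0 τ hab)⟩
  intro τ hτ
  by_contra hne
  obtain ⟨r, -, hr1, hr2⟩ := hc.ordConnected.isPreconnected _ _ hopen hopen'
    (fun r hr => (em (V r = 0)).imp (fun h => ⟨hr, h⟩) (fun h => ⟨hr, h⟩))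
    ⟨τ₀, hτ₀, hτ₀, h0⟩ ⟨τ, hτ, hτ, hne⟩
  exact hr2.2 hr1.2

/-- A parallel field which is initially a multiple of the velocity remains so. -/
theorem IsParallelOn.eq_smul_velocity {c : ℝ → ℝ × S} {V : ℝ → E4} {J : Set ℝ}
    (hc : g.IsGeodesicOn c J) (hV : g.IsParallelOn c V J) {τ₀ k : ℝ} (hτ₀ : τ₀ ∈ J)
    (h0 : V τ₀ = k • velocity c τ₀) {τ : ℝ} (hτ : τ ∈ J) : V τ = k • velocity c τ :=
  sub_eq_zero.1 (IsParallelOn.eq_zero hc (hV.sub (fun _ => hc.mdifferentiableAt)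
    (hc.parallel.const_smul (fun _ => hc.mdifferentiableAt) k)) hτ₀
    (sub_eq_zero.2 h0) τ hτ)

/-- The velocity is itself a parallel field. -/
theorem IsGeodesicOn.velocity_ne_zero {c : ℝ → ℝ × S} {J : Set ℝ} (hc : g.IsGeodesicOn c J)
    {τ₀ τ : ℝ} (hτ₀ : τ₀ ∈ J) (hτ : τ ∈ J) (h0 : velocity c τ₀ ≠ 0) : velocity c τ ≠ 0 :=
  fun h => h0 (IsParallelOn.eq_zero hc hc.parallel hτ h τ₀ hτ₀)

/-! ### Affine reparametrisation -/

theorem velocity_comp_mul {c : ℝ → ℝ × S} {k τ : ℝ}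
    (hc : MDifferentiableAt 𝓘(ℝ, ℝ) I4 c (k * τ)) :
    velocity (fun r => c (k * r)) τ = k • velocity c (k * τ) := by
  have h1 : HasFDerivAt (fun r : ℝ => k * r) (k • ContinuousLinearMap.id ℝ ℝ) τ :=
    (hasFDerivAt_id τ).const_mul k
  have h2 : HasMFDerivAt 𝓘(ℝ, ℝ) I4 (c ∘ fun r => k * r) τ _ :=
    hc.hasMFDerivAt.comp τ h1.hasMFDerivAt
  have h3 : mfderiv 𝓘(ℝ, ℝ) I4 (fun r => c (k * r)) τ = _ := h2.mfderiv
  rw [velocity, h3]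
  have h4 : (k • ContinuousLinearMap.id ℝ ℝ : ℝ →L[ℝ] ℝ) (1 : ℝ) = k • (1 : ℝ) := by simp
  have h5 := (mfderiv 𝓘(ℝ, ℝ) I4 c (k * τ)).map_smul k (1 : ℝ)
  refine Eq.trans ?_ h5
  exact congrArg (fun x : ℝ => mfderiv 𝓘(ℝ, ℝ) I4 c (k * τ) x) h4

/-- Acceleration and the Christoffel term both scale by `k²`. General `k` gives homogeneity of the
exponential map; `k = -1` reduces negative parameters to positive ones. -/
theorem IsGeodesicOn.comp_mul {c : ℝ → ℝ × S} {J : Set ℝ} (hc : g.IsGeodesicOn c J) (k : ℝ) :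
    g.IsGeodesicOn (fun r => c (k * r)) ((fun r => k * r) ⁻¹' J) where
  isOpen := hc.isOpen.preimage (by fun_prop)
  ordConnected := by
    refine ⟨fun x hx y hy z hz => ?_⟩
    have : k * z ∈ uIcc (k * x) (k * y) := by
      rcases le_total 0 k with hk | hk
      · exact Icc_subset_uIcc ⟨mul_le_mul_of_nonneg_left hz.1 hk,
          mul_le_mul_of_nonneg_left hz.2 hk⟩
      · exact Icc_subset_uIcc' ⟨mul_le_mul_of_nonpos_left hz.2 hk,
          mul_le_mul_of_nonpos_left hz.1 hk⟩
    exact hc.ordConnected.uIcc_subset hx hy this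
  smooth := by
    refine hc.smooth.comp (t := J) (f := fun r => k * r) ?_ (fun r hr => hr)
    exact (contDiff_const.mul contDiff_id).contMDiff.contMDiffOn
  parallel := by
    have hm : ∀ τ : ℝ, HasDerivAt (fun r : ℝ => k * r) k τ := fun τ => by
      simpa using (hasDerivAt_id τ).const_mul k
    have hck : ∀ τ ∈ (fun r => k * r) ⁻¹' J,
        MDifferentiableAt 𝓘(ℝ, ℝ) I4 (fun r => c (k * r)) τ := fun τ hτ =>
      MDifferentiableAt.comp (f := fun r => k * r) τ
        (hc.mdifferentiableAt hτ) (hm τ).differentiableAt.mdifferentiableAt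
    rw [isParallelOn_iff hck]
    intro p₀ τ hτ hs
    obtain ⟨V', hd, hp⟩ := (isParallelOn_iff fun _ => hc.mdifferentiableAt).1 hc.parallel
      p₀ (k * τ) hτ hs
    refine ⟨k • k • V', ((hd.scomp τ (hm τ)).const_smul k).congr_of_eventuallyEq ?_,
      fun w => ?_⟩
    · filter_upwards [(hc.isOpen.preimage (f := fun r : ℝ => k * r) (by fun_prop)).mem_nhds hτ]
        with r hr
      rw [velocity_comp_mul (hc.mdifferentiableAt hr)]
      exact (chartD p₀ (c (k * r))).map_smul k _
    · rw [velocity_comp_mul (hc.mdifferentiableAt hτ)]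
      have hlin : ∀ (A : E4 →L[ℝ] E4) (B : E4 →L[ℝ] E4 →L[ℝ] ℝ)
          (G : E4 → E4 →L[ℝ] E4 →L[ℝ] ℝ) (u v : E4),
          B (k • k • V') w + MetricCoeff.chr G u (A (k • v)) (A (k • v)) w =
            k * (k * (B V' w + MetricCoeff.chr G u (A v) (A v) w)) := by
        intro A B G u v
        simp only [MetricCoeff.chr_apply, map_smul, smul_apply, smul_eq_mul]
        ring
      have h5 := hlin (chartD p₀ (c (k * τ))) (g.chartG p₀ (extChartAt I4 p₀ (c (k * τ))))
        (g.chartG p₀) (extChartAt I4 p₀ (c (k * τ))) (velocity c (k * τ))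
      rw [hp w, mul_zero, mul_zero] at h5
      exact h5

/-! ### Null geodesics and time -/

theorem hasDerivAt_time {c : ℝ → ℝ × S} {τ : ℝ} (hc : MDifferentiableAt 𝓘(ℝ, ℝ) I4 c τ) :
    HasDerivAt (fun r => (c r).1) (velocity c τ).1 τ := by
  have h1 : HasMFDerivAt 𝓘(ℝ, ℝ) 𝓘(ℝ, ℝ) (Prod.fst ∘ c) τ _ :=
    mdifferentiableAt_fst.hasMFDerivAt.comp τ hc.hasMFDerivAt
  rw [mfderiv_fst] at h1
  have h2 : HasFDerivAt (fun r => (c r).1)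
      ((ContinuousLinearMap.fst ℝ ℝ E3).comp (mfderiv 𝓘(ℝ, ℝ) I4 c τ : ℝ →L[ℝ] E4)) τ :=
    h1.hasFDerivAt
  exact h2.hasDerivAt

/-- The metric is positive definite on the slices `{t} × S`, so no nonzero null vector is tangent to
one. -/
theorem velocity_fst_ne_zero {p : ℝ × S} {v : E4} (hv : v ≠ 0) (hn : g.metric p v v = 0) :
    v.1 ≠ 0 := by
  intro h1
  refine hv (Prod.ext h1 ?_)
  by_contra h2
  have := g.h_pos p v.2 h2
  rw [metric, h1] at hn
  linarith

/-- By Rolle's theorem two equal times would force the time component of the velocity to vanish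
somewhere, but the velocity stays null and nonzero. -/
theorem IsGeodesicOn.time_injOn {c : ℝ → ℝ × S} {J : Set ℝ} (hc : g.IsGeodesicOn c J)
    (h0 : (0 : ℝ) ∈ J) (hv : velocity c 0 ≠ 0)
    (hn : g.metric (c 0) (velocity c 0) (velocity c 0) = 0) : InjOn (fun r => (c r).1) J := by
  have hne : ∀ τ ∈ J, (velocity c τ).1 ≠ 0 := fun τ hτ =>
    velocity_fst_ne_zero (hc.velocity_ne_zero h0 hτ hv) ((hc.energy_eq hτ h0).trans hn)
  have key : ∀ a ∈ J, ∀ b ∈ J, a < b → (c a).1 ≠ (c b).1 := by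
    intro a ha b hb hab heq
    have hsub : Icc a b ⊆ J := hc.ordConnected.out ha hb
    obtain ⟨r, hr, hr0⟩ := exists_hasDerivAt_eq_zero hab
      (fun r hr => (hasDerivAt_time (hc.mdifferentiableAt (hsub hr))).continuousAt.continuousWithinAt)
      heq (fun r hr => hasDerivAt_time (hc.mdifferentiableAt (hsub (Ioo_subset_Icc_self hr))))
    exact hne r (hsub (Ioo_subset_Icc_self hr)) hr0
  intro a ha b hb hab
  rcases lt_trichotomy a b with h | h | h
  · exact (key a ha b hb h hab).elim
  · exact h
  · exact (key b hb a ha h hab.symm).elim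

theorem IsGeodesicOn.time_strictMonoOn {c : ℝ → ℝ × S} {J : Set ℝ} (hc : g.IsGeodesicOn c J)
    (h0 : (0 : ℝ) ∈ J) (hv : 0 < (velocity c 0).1)
    (hn : g.metric (c 0) (velocity c 0) (velocity c 0) = 0) :
    StrictMonoOn (fun r => (c r).1) J := by
  have hv0 : velocity c 0 ≠ 0 := fun h => by simp [h] at hv
  have hne : ∀ τ ∈ J, (velocity c τ).1 ≠ 0 := fun τ hτ =>
    velocity_fst_ne_zero (hc.velocity_ne_zero h0 hτ hv0) ((hc.energy_eq hτ h0).trans hn)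
  have hconv : Convex ℝ J := hc.ordConnected.convex
  have hder : ∀ τ ∈ J, HasDerivAt (fun r => (c r).1) (velocity c τ).1 τ := fun τ hτ =>
    hasDerivAt_time (hc.mdifferentiableAt hτ)
  have hpos : ∀ τ ∈ J, 0 < (velocity c τ).1 := by
    -- Darboux: a derivative without zeros has constant sign, here the sign at `0`.
    rcases hasDerivWithinAt_forall_lt_or_forall_gt_of_forall_ne hconv
      (fun τ hτ => (hder τ hτ).hasDerivWithinAt) hne with h | h
    · exact absurd (h 0 h0) (not_lt.2 hv.le)
    · exact h
  refine strictMonoOn_of_deriv_pos hconv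
    (fun τ hτ => (hder τ hτ).continuousAt.continuousWithinAt) fun τ hτ => ?_
  rw [(hder τ (interior_subset hτ)).deriv]
  exact hpos τ (interior_subset hτ)

end Spacetime

namespace Spacetime

variable {S : Type*} [TopologicalSpace S] [ChartedSpace E3 S] [IsManifold I3 ∞ S]
  {g : Spacetime S}

/-! ### Dependence of geodesics on their initial data -/

variable (g) in
/-- The pairing of the velocity of `c` with the displacement from `c` to `c'` in the chart at
`p₀`. -/
noncomputable def pairing (p₀ : ℝ × S) (c c' : ℝ → ℝ × S) (r : ℝ) : ℝ :=
  g.chartG p₀ (chartState p₀ c r).1 (chartState p₀ c r).2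
    ((chartState p₀ c' r).1 - (chartState p₀ c r).1)

variable (g) in
/-- The squared length of the velocity of a curve. -/
noncomputable def speedSq (c : ℝ → ℝ × S) (r : ℝ) : ℝ :=
  g.metric (c r) (velocity c r) (velocity c r)

/-- Geodesics which are close at time `a` in a chart remain close while the first one is in the
domain of the chart, with uniform estimates. -/
theorem IsGeodesicOn.exists_chart_stability [T2Space S] {c : ℝ → ℝ × S} {J : Set ℝ}
    (hc : g.IsGeodesicOn c J) {p₀ : ℝ × S} {a b : ℝ} (hab : a ≤ b) (hJ : Icc a b ⊆ J)
    (hs : ∀ r ∈ Icc a b, c r ∈ (extChartAt I4 p₀).source) :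
    ∃ κ > 0, ∃ L ≥ 0, ∀ (c' : ℝ → ℝ × S) (J' : Set ℝ), g.IsGeodesicOn c' J' → ∀ ρ ∈ Icc a b,
      Icc a ρ ⊆ J' → c' a ∈ (extChartAt I4 p₀).source →
      ‖chartState p₀ c' a - chartState p₀ c a‖ ≤ κ →
      c' ρ ∈ (extChartAt I4 p₀).source ∧
      ‖chartState p₀ c' ρ - chartState p₀ c ρ‖ ≤ L * ‖chartState p₀ c' a - chartState p₀ c a‖ ∧
      |g.pairing p₀ c c' ρ - g.pairing p₀ c c' a| ≤
        L * (‖chartState p₀ c' a - chartState p₀ c a‖ ^ 2 + |g.speedSq c' a - g.speedSq c a|) := by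
  set Ω := (extChartAt I4 p₀).target
  set z := chartState p₀ c
  have hΩ := g.isMetricOn_chartG p₀
  obtain ⟨κ₀, hκ₀, L₀, hL₀, hball, hstab⟩ := hΩ.exists_stability (z := z) (a := a) (b := b)
    (fun t ht => hc.isGeodAt (hJ ht) (hs t ht))
    (fun t ht => (extChartAt I4 p₀).map_source (hs t ht))
  set M := Real.exp (L₀ * (b - a)) with hM
  have hM1 : 1 ≤ M := Real.one_le_exp (mul_nonneg hL₀ (sub_nonneg.2 hab))
  have hM0 : 0 < M := by linarith
  have hzc : ContinuousOn z (Icc a b) := fun t ht =>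
    (hc.isGeodAt (hJ ht) (hs t ht)).continuousAt.continuousWithinAt
  -- the positions of the geodesics which stay close form a compact subset of the chart domain
  set C₁ : Set E4 := (fun q : ℝ × E4 × E4 => (z q.1).1 + q.2.1) ''
    (Icc a b ×ˢ Metric.closedBall 0 (κ₀ / 2)) with hC₁
  have hC₁c : IsCompact C₁ := by
    refine (isCompact_Icc.prod (isCompact_closedBall _ _)).image_of_continuousOn ?_
    exact (hzc.fst.comp continuousOn_fst fun q hq => hq.1).add
      (continuous_snd.fst).continuousOn
  have hC₁Ω : C₁ ⊆ Ω := by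
    rintro _ ⟨⟨r, d⟩, ⟨hr, hd⟩, rfl⟩
    have hmem : z r + d ∈ Metric.closedBall (z r) κ₀ := by
      rw [Metric.mem_closedBall, dist_eq_norm, add_sub_cancel_left]
      rw [mem_closedBall_zero_iff] at hd
      exact hd.trans (by linarith)
    exact (hball r hr hmem).1
  set C₂ : Set (ℝ × S) := (extChartAt I4 p₀).symm '' C₁ with hC₂
  have hC₂c : IsClosed C₂ :=
    (hC₁c.image_of_continuousOn ((continuousOn_extChartAt_symm p₀).mono hC₁Ω)).isClosed
  have hC₂s : C₂ ⊆ (extChartAt I4 p₀).source := by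
    rintro _ ⟨u, hu, rfl⟩
    exact (extChartAt I4 p₀).map_target (hC₁Ω hu)
  -- Growth by at most `M` turns an initial distance `κ₀ / (2 * M)` into at most `κ₀ / 2`. The
  -- second constant covers both this growth and the bound `(L₀ * (d * M) ^ 2 + e) * (b - a)` for
  -- the pairing.
  refine ⟨κ₀ / (2 * M), by positivity, max M ((L₀ * M ^ 2 + 1) * (b - a)),
    hM0.le.trans (le_max_left _ _), ?_⟩
  intro c' J' hc' ρ hρ hJ' hsa hclose
  set y := chartState p₀ c'
  have hsub : Icc a ρ ⊆ Icc a b := Icc_subset_Icc_right hρ.2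
  have hexp : ∀ r ∈ Icc a ρ, Real.exp (L₀ * (r - a)) ≤ M := fun r hr =>
    Real.exp_le_exp.2 (mul_le_mul_of_nonneg_left (by linarith [(hsub hr).2]) hL₀)
  have hhalf : ‖y a - z a‖ * M ≤ κ₀ / 2 := by
    calc ‖y a - z a‖ * M ≤ κ₀ / (2 * M) * M := mul_le_mul_of_nonneg_right hclose hM0.le
      _ = κ₀ / 2 := by field_simp
  -- Continuous induction: the stability estimate presupposes closeness, so `T` is shown to be
  -- closed and extendable to the right.
  set T : Set ℝ := {r | c' r ∈ (extChartAt I4 p₀).source ∧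
    ‖y r - z r‖ ≤ ‖y a - z a‖ * Real.exp (L₀ * (r - a))} with hT
  have hyc : ∀ r ∈ Icc a ρ, c' r ∈ (extChartAt I4 p₀).source → ContinuousAt y r :=
    fun r hr h => (hc'.isGeodAt (hJ' hr) h).continuousAt
  have hTκ : ∀ r ∈ T ∩ Icc a ρ, ‖y r - z r‖ ≤ κ₀ / 2 := fun r hr =>
    (hr.1.2.trans (mul_le_mul_of_nonneg_left (hexp r hr.2) (norm_nonneg _))).trans hhalf
  have hTall : Icc a ρ ⊆ T := by
    refine IsClosed.Icc_subset_of_forall_exists_gt ?_ ⟨hsa, by simp⟩ ?_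
    -- Membership in the open chart domain is not a closed condition. The distance bound places `c'
    -- r` in the closed set `C₂` inside that domain.
    · have hA : IsClosed (Icc a ρ ∩ c' ⁻¹' C₂) :=
        (hc'.continuousOn.mono hJ').preimage_isClosed_of_isClosed isClosed_Icc hC₂c
      have hTA : T ∩ Icc a ρ = (Icc a ρ ∩ c' ⁻¹' C₂) ∩
          (fun r => ‖y r - z r‖ - ‖y a - z a‖ * Real.exp (L₀ * (r - a))) ⁻¹' Iic 0 := by
        ext r
        constructor
        · intro hr
          refine ⟨⟨hr.2, extChartAt I4 p₀ (c' r), ⟨(r, y r - z r), ⟨hsub hr.2, ?_⟩, ?_⟩,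
            (extChartAt I4 p₀).left_inv hr.1.1⟩, sub_nonpos.2 hr.1.2⟩
          · rw [mem_closedBall_zero_iff]
            exact hTκ r hr
          · exact add_sub_cancel _ _
        · rintro ⟨⟨h1, h2⟩, h3⟩
          exact ⟨⟨hC₂s h2, sub_nonpos.1 h3⟩, h1⟩
      rw [hTA]
      refine ContinuousOn.preimage_isClosed_of_isClosed (fun r hr => ?_) hA isClosed_Iic
      have h1 := (hyc r hr.1 (hC₂s hr.2)).continuousWithinAt (s := Icc a ρ ∩ c' ⁻¹' C₂)
      have h2 := (hzc r (hsub hr.1)).mono (inter_subset_left.trans hsub : Icc a ρ ∩ c' ⁻¹' C₂ ⊆ _)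
      exact (h1.sub h2).norm.sub (by fun_prop)
    -- The distance at `x` is at most `κ₀ / 2`, so it stays below `κ₀` a little longer; the
    -- exponential factors from `a` to `x` and from `x` onwards multiply.
    · rintro x ⟨hxT, hx⟩ x' hx'
      have hxI : x ∈ Icc a ρ := Ico_subset_Icc_self hx
      have hev : ∀ᶠ r in 𝓝 x, c' r ∈ (extChartAt I4 p₀).source ∧ ‖y r - z r‖ < κ₀ := by
        refine Eventually.and ((hc'.continuousAt (hJ' hxI)).preimage_mem_nhds
          ((isOpen_extChartAt_source p₀).mem_nhds hxT.1)) ?_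
        have h1 : ContinuousAt (fun r => ‖y r - z r‖) x :=
          ((hyc x hxI hxT.1).sub
            (hc.isGeodAt (hJ (hsub hxI)) (hs x (hsub hxI))).continuousAt).norm
        exact h1.eventually (gt_mem_nhds (lt_of_le_of_lt (hTκ x ⟨hxT, hxI⟩) (by linarith)))
      obtain ⟨δ, hδ, hδ'⟩ := Metric.eventually_nhds_iff.1 hev
      set r₂ := min (min x' ρ) (x + δ / 2)
      have hxr : x < r₂ := lt_min (lt_min hx' hx.2) (by linarith)
      have hr₂ρ : r₂ ≤ ρ := (min_le_left _ _).trans (min_le_right _ _)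
      have hnear : ∀ t ∈ Icc x r₂, c' t ∈ (extChartAt I4 p₀).source ∧ ‖y t - z t‖ < κ₀ := by
        intro t ht
        refine hδ' ?_
        have : t ≤ x + δ / 2 := ht.2.trans (min_le_right _ _)
        rw [Real.dist_eq, abs_lt]
        constructor <;> linarith [ht.1]
      have hst := (hstab y x r₂ hx.1 hxr.le (hr₂ρ.trans hρ.2)
        (fun t ht => hc'.isGeodAt (hJ' ⟨hx.1.trans ht.1, ht.2.trans hr₂ρ⟩) (hnear t ht).1)
        (fun t ht => (hnear t ht).2.le)).1
      refine ⟨r₂, ⟨(hnear r₂ (right_mem_Icc.2 hxr.le)).1, hst.trans ?_⟩, hxr,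
        (min_le_left _ _).trans (min_le_left _ _)⟩
      calc ‖y x - z x‖ * Real.exp (L₀ * (r₂ - x))
          ≤ ‖y a - z a‖ * Real.exp (L₀ * (x - a)) * Real.exp (L₀ * (r₂ - x)) :=
            mul_le_mul_of_nonneg_right hxT.2 (Real.exp_nonneg _)
        _ = ‖y a - z a‖ * Real.exp (L₀ * (r₂ - a)) := by
            rw [mul_assoc, ← Real.exp_add]
            ring_nf
  have hM' : ∀ r ∈ Icc a ρ, ‖y r - z r‖ ≤ ‖y a - z a‖ * M := fun r hr =>
    (hTall hr).2.trans (mul_le_mul_of_nonneg_left (hexp r hr) (norm_nonneg _))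
  have hρI : ρ ∈ Icc a ρ := right_mem_Icc.2 hρ.1
  have haI : a ∈ Icc a ρ := left_mem_Icc.2 hρ.1
  refine ⟨(hTall hρI).1, ?_, ?_⟩
  · rw [mul_comm]
    exact (hM' ρ hρI).trans (mul_le_mul_of_nonneg_left (le_max_left _ _) (norm_nonneg _))
  · have hst := (hstab y a ρ le_rfl hρ.1 hρ.2
      (fun t ht => hc'.isGeodAt (hJ' ht) (hTall ht).1)
      (fun t ht => (hTκ t ⟨hTall ht, ht⟩).trans (by linarith))).2 (‖y a - z a‖ * M)
      (|g.speedSq c' a - g.speedSq c a|) hM' (fun t ht => by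
        rw [energy_chartState (hTall ht).1, energy_chartState (hs t (hsub ht)),
          hc'.energy_eq (hJ' ht) (hJ' haI), hc.energy_eq (hJ (hsub ht)) (hJ (hsub haI)),
          ← mul_sub, abs_mul]
        have : |(1 / 2 : ℝ)| ≤ 1 := by rw [abs_of_pos] <;> norm_num
        exact mul_le_of_le_one_left (abs_nonneg _) this)
    refine hst.trans ?_
    have h1 : (L₀ * M ^ 2 + 1) * (b - a) ≤ max M ((L₀ * M ^ 2 + 1) * (b - a)) := le_max_right _ _
    have h2 : 0 ≤ ρ - a := sub_nonneg.2 hρ.1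
    have h3 : ρ - a ≤ b - a := by linarith [hρ.2]
    set e := |g.speedSq c' a - g.speedSq c a|
    have he : 0 ≤ e := abs_nonneg _
    set d := ‖y a - z a‖
    calc (L₀ * (d * M) ^ 2 + e) * (ρ - a)
        ≤ ((L₀ * M ^ 2 + 1) * (d ^ 2 + e)) * (b - a) := by
          refine mul_le_mul ?_ h3 h2 (by positivity)
          have : 0 ≤ L₀ * M ^ 2 * e := by positivity
          nlinarith [sq_nonneg d]
      _ = ((L₀ * M ^ 2 + 1) * (b - a)) * (d ^ 2 + e) := by ring
      _ ≤ _ := mul_le_mul_of_nonneg_right h1 (by positivity)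

/-! #### Changes of charts -/

/-- The change of charts. -/
noncomputable def coordChange (p₀ p₁ : ℝ × S) (u : E4) : E4 :=
  extChartAt I4 p₁ ((extChartAt I4 p₀).symm u)

/-- The domain of the change of charts. -/
def coordDomain (p₀ p₁ : ℝ × S) : Set E4 :=
  (extChartAt I4 p₀).target ∩ (extChartAt I4 p₀).symm ⁻¹' (extChartAt I4 p₁).source

theorem isOpen_coordDomain (p₀ p₁ : ℝ × S) : IsOpen (coordDomain p₀ p₁) :=
  (continuousOn_extChartAt_symm p₀).isOpen_inter_preimage (isOpen_extChartAt_target p₀)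
    (isOpen_extChartAt_source p₁)

theorem contDiffOn_coordChange (p₀ p₁ : ℝ × S) :
    ContDiffOn ℝ ∞ (coordChange p₀ p₁) (coordDomain p₀ p₁) := by
  rw [← contMDiffOn_iff_contDiffOn]
  refine ContMDiffOn.comp (t := (extChartAt I4 p₁).source) (I' := I4) ?_
    ((contMDiffOn_chart_symm p₀).mono inter_subset_left) inter_subset_right
  have := contMDiffOn_extChartAt (I := I4) (n := ∞) (x := p₁)
  rwa [← extChartAt_source I4] at this

theorem mem_coordDomain {p₀ p₁ p : ℝ × S} (h0 : p ∈ (extChartAt I4 p₀).source)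
    (h1 : p ∈ (extChartAt I4 p₁).source) : extChartAt I4 p₀ p ∈ coordDomain p₀ p₁ := by
  refine ⟨(extChartAt I4 p₀).map_source h0, ?_⟩
  rw [mem_preimage, (extChartAt I4 p₀).left_inv h0]
  exact h1

theorem coordChange_extChartAt {p₀ p₁ p : ℝ × S} (h0 : p ∈ (extChartAt I4 p₀).source) :
    coordChange p₀ p₁ (extChartAt I4 p₀ p) = extChartAt I4 p₁ p := by
  rw [coordChange, (extChartAt I4 p₀).left_inv h0]

theorem chartD_eq_fderiv_coordChange {p₀ p₁ p : ℝ × S} (h0 : p ∈ (extChartAt I4 p₀).source)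
    (h1 : p ∈ (extChartAt I4 p₁).source) (v : E4) :
    chartD p₁ p v = fderiv ℝ (coordChange p₀ p₁) (extChartAt I4 p₀ p) (chartD p₀ p v) := by
  have hd : DifferentiableAt ℝ (coordChange p₀ p₁) (extChartAt I4 p₀ p) :=
    ((contDiffOn_coordChange p₀ p₁).differentiableOn (by simp)).differentiableAt
      ((isOpen_coordDomain p₀ p₁).mem_nhds (mem_coordDomain h0 h1))
  have h2 : mfderiv I4 𝓘(ℝ, E4) (coordChange p₀ p₁ ∘ extChartAt I4 p₀) p =
      (mfderiv 𝓘(ℝ, E4) 𝓘(ℝ, E4) (coordChange p₀ p₁) (extChartAt I4 p₀ p)).comp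
        (mfderiv I4 𝓘(ℝ, E4) (extChartAt I4 p₀) p) :=
    mfderiv_comp p hd.mdifferentiableAt (mdifferentiableAt_chart h0)
  have h3 : coordChange p₀ p₁ ∘ extChartAt I4 p₀ =ᶠ[𝓝 p] extChartAt I4 p₁ := by
    filter_upwards [(isOpen_extChartAt_source (I := I4) p₀).mem_nhds h0] with q hq
    exact coordChange_extChartAt hq
  rw [h3.mfderiv_eq, mfderiv_eq_fderiv] at h2
  exact congrArg (fun L : E4 →L[ℝ] E4 => L v) h2

/-- The action of the change of charts on positions and velocities. -/
noncomputable def coordChangeState (p₀ p₁ : ℝ × S) (z : E4 × E4) : E4 × E4 :=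
  (coordChange p₀ p₁ z.1, fderiv ℝ (coordChange p₀ p₁) z.1 z.2)

theorem contDiffOn_coordChangeState (p₀ p₁ : ℝ × S) :
    ContDiffOn ℝ ∞ (coordChangeState p₀ p₁) (coordDomain p₀ p₁ ×ˢ univ) := by
  have h1 : ContDiffOn ℝ ∞ (fun z : E4 × E4 => coordChange p₀ p₁ z.1)
      (coordDomain p₀ p₁ ×ˢ univ) :=
    (contDiffOn_coordChange p₀ p₁).comp contDiff_fst.contDiffOn (fun z hz => hz.1)
  have h2 : ContDiffOn ℝ ∞ (fun z : E4 × E4 => fderiv ℝ (coordChange p₀ p₁) z.1)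
      (coordDomain p₀ p₁ ×ˢ univ) :=
    ((contDiffOn_coordChange p₀ p₁).fderiv_of_isOpen (isOpen_coordDomain p₀ p₁) (m := ∞)
      (by simp)).comp contDiff_fst.contDiffOn (fun z hz => hz.1)
  exact h1.prodMk (h2.clm_apply contDiff_snd.contDiffOn)

theorem coordChangeState_chartState {p₀ p₁ : ℝ × S} {c : ℝ → ℝ × S} {r : ℝ}
    (h0 : c r ∈ (extChartAt I4 p₀).source) (h1 : c r ∈ (extChartAt I4 p₁).source) :
    coordChangeState p₀ p₁ (chartState p₀ c r) = chartState p₁ c r :=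
  Prod.ext (coordChange_extChartAt h0) (chartD_eq_fderiv_coordChange h0 h1 _).symm

theorem chartG_coordChange {p₀ p₁ p : ℝ × S} (h0 : p ∈ (extChartAt I4 p₀).source)
    (h1 : p ∈ (extChartAt I4 p₁).source) (v w : E4) :
    g.chartG p₁ (extChartAt I4 p₁ p) (fderiv ℝ (coordChange p₀ p₁) (extChartAt I4 p₀ p) v)
      (fderiv ℝ (coordChange p₀ p₁) (extChartAt I4 p₀ p) w) =
    g.chartG p₀ (extChartAt I4 p₀ p) v w := by
  have hv : ∀ v : E4, ∃ v', v = chartD p₀ p v' := fun v => by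
    have h2 := chartD_comp_chartSymmD ((extChartAt I4 p₀).map_source h0) v
    rw [(extChartAt I4 p₀).left_inv h0] at h2
    exact ⟨_, h2.symm⟩
  obtain ⟨v', rfl⟩ := hv v
  obtain ⟨w', rfl⟩ := hv w
  rw [← chartD_eq_fderiv_coordChange h0 h1, ← chartD_eq_fderiv_coordChange h0 h1,
    g.chartG_apply, g.chartG_apply, g.chartMetric_chartD h0, g.chartMetric_chartD h1]

/-! #### Families of geodesics -/

open Asymptotics

variable {α : Type*}

variable (g) in
/-- At the times `ρ k`, the curves `C k` are close to `c` to first order in `e k`, in the chart at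
`p₀`, and the displacement is orthogonal to `c` to second order. -/
structure IsCloseAt (l : Filter α) (e : α → ℝ) (c : ℝ → ℝ × S) (C : α → ℝ → ℝ × S)
    (p₀ : ℝ × S) (ρ : α → ℝ) : Prop where
  mem : ∀ᶠ k in l, C k (ρ k) ∈ (extChartAt I4 p₀).source
  state : (fun k => chartState p₀ (C k) (ρ k) - chartState p₀ c (ρ k)) =O[l] e
  pairing : (fun k => g.pairing p₀ c (C k) (ρ k)) =O[l] fun k => e k ^ 2

variable {l : Filter α} {e : α → ℝ} {c : ℝ → ℝ × S} {C : α → ℝ → ℝ × S}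

/-- A coordinate displacement is not a tangent vector: the derivative of the coordinate change
transforms it only up to a quadratic error. That error is `O(e²)`, exactly the precision asked of
the pairing, and the main term is invariant because coordinate changes are isometries. -/
theorem IsCloseAt.change_chart (he : Tendsto e l (𝓝 0)) {p₀ p₁ : ℝ × S} {r : ℝ}
    (h : g.IsCloseAt l e c C p₀ fun _ => r) (h0 : c r ∈ (extChartAt I4 p₀).source)
    (h1 : c r ∈ (extChartAt I4 p₁).source) : g.IsCloseAt l e c C p₁ fun _ => r := by
  have hdom := mem_coordDomain h0 h1
  have ho := isOpen_coordDomain p₀ p₁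
  obtain ⟨κ₁, hκ₁, L₁, -, hL₁⟩ := (isCompact_singleton (x := chartState p₀ c r)).exists_lipschitz_closedBall
    (ho.prod isOpen_univ) (by rintro _ rfl; exact ⟨hdom, mem_univ _⟩)
    ((contDiffOn_coordChangeState p₀ p₁).of_le (by simp))
  obtain ⟨κ₂, hκ₂, L₂, hL₂0, hL₂⟩ := (isCompact_singleton (x := (chartState p₀ c r).1)).exists_taylor_closedBall
    ho (by rintro _ rfl; exact hdom)
    ((contDiffOn_coordChange p₀ p₁).of_le (m := 2) (by norm_cast))
  obtain ⟨hb₁, hL₁⟩ := hL₁ _ rfl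
  obtain ⟨hb₂, hL₂⟩ := hL₂ _ rfl
  have hsm := (h.state.trans_tendsto he).norm
  rw [norm_zero] at hsm
  have hev := (h.mem.and (hsm.eventually (gt_mem_nhds (lt_min hκ₁ hκ₂))))
  have hmem : ∀ᶠ k in l, C k r ∈ (extChartAt I4 p₁).source := by
    filter_upwards [hev] with k hk
    have : chartState p₀ (C k) r ∈ Metric.closedBall (chartState p₀ c r) κ₁ := by
      rw [Metric.mem_closedBall, dist_eq_norm]
      exact hk.2.le.trans (min_le_left _ _)
    have h2 := (hb₁ this).1.2
    rwa [mem_preimage, chartState, (extChartAt I4 p₀).left_inv hk.1] at h2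
  refine ⟨hmem, ?_, ?_⟩
  · refine IsBigO.trans (IsBigO.of_bound L₁ ?_) h.state
    filter_upwards [hev, hmem] with k hk hk1
    rw [← coordChangeState_chartState h0 h1, ← coordChangeState_chartState hk.1 hk1]
    refine hL₁ _ (Metric.mem_closedBall_self hκ₁.le) _ ?_
    rw [Metric.mem_closedBall, dist_eq_norm]
    exact hk.2.le.trans (min_le_left _ _)
  · have hδ : (fun k => (chartState p₀ (C k) r).1 - (chartState p₀ c r).1) =O[l] e :=
      (IsBigO.of_bound 1 (Eventually.of_forall fun k => by
        rw [one_mul]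
        exact norm_fst_le (chartState p₀ (C k) r - chartState p₀ c r))).trans h.state
    set B := g.chartG p₁ (chartState p₁ c r).1 (chartState p₁ c r).2 with hB
    have hrem : (fun k => B ((chartState p₁ (C k) r).1 - (chartState p₁ c r).1 -
        fderiv ℝ (coordChange p₀ p₁) (chartState p₀ c r).1
          ((chartState p₀ (C k) r).1 - (chartState p₀ c r).1))) =O[l] fun k => e k ^ 2 := by
      refine (B.isBigO_comp _ _).trans (IsBigO.trans (IsBigO.of_bound L₂ ?_) (hδ.norm_left.pow 2))
      filter_upwards [hev, hmem] with k hk hk1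
      have := hL₂ (chartState p₀ (C k) r).1 (by
        rw [Metric.mem_closedBall, dist_eq_norm]
        exact (norm_fst_le (chartState p₀ (C k) r - chartState p₀ c r)).trans
          (hk.2.le.trans (min_le_right _ _)))
      rw [chartState, coordChange_extChartAt hk.1, chartState, coordChange_extChartAt h0] at this
      rw [norm_pow, norm_norm]
      exact this
    refine (hrem.add h.pairing).congr_left fun k => ?_
    have h3 := chartG_coordChange (g := g) h0 h1 (chartState p₀ c r).2
      ((chartState p₀ (C k) r).1 - (chartState p₀ c r).1)
    have h4 : (chartState p₁ c r).2 = fderiv ℝ (coordChange p₀ p₁) (extChartAt I4 p₀ (c r))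
      (chartState p₀ c r).2 := chartD_eq_fderiv_coordChange h0 h1 _
    have h5 : B (fderiv ℝ (coordChange p₀ p₁) (chartState p₀ c r).1
        ((chartState p₀ (C k) r).1 - (chartState p₀ c r).1)) = g.pairing p₀ c (C k) r := by
      rw [hB, h4]
      exact h3
    rw [map_sub B, h5]
    exact sub_add_cancel _ _

variable {J : Set ℝ} {J' : α → Set ℝ}

/-- Closeness is propagated along the part of `c` in the domain of a chart. -/
theorem IsCloseAt.advance [T2Space S] (he : Tendsto e l (𝓝 0)) (hc : g.IsGeodesicOn c J)
    (hC : ∀ᶠ k in l, g.IsGeodesicOn (C k) (J' k)) {p₀ : ℝ × S} {a b : ℝ} (hab : a ≤ b)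
    (hJ : Icc a b ⊆ J) (hs : ∀ r ∈ Icc a b, c r ∈ (extChartAt I4 p₀).source)
    (h : g.IsCloseAt l e c C p₀ fun _ => a)
    (hE : (fun k => g.speedSq (C k) a - g.speedSq c a) =O[l] fun k => e k ^ 2)
    {ρ : α → ℝ} (hρ : ∀ᶠ k in l, ρ k ∈ Icc a b) (hJ' : ∀ᶠ k in l, Icc a (ρ k) ⊆ J' k) :
    g.IsCloseAt l e c C p₀ ρ := by
  obtain ⟨κ, hκ, L, hL0, hL⟩ := hc.exists_chart_stability hab hJ hs
  have hsm := (h.state.trans_tendsto he).norm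
  rw [norm_zero] at hsm
  have key := (hC.and (hρ.and (hJ'.and (h.mem.and (hsm.eventually (gt_mem_nhds hκ)))))).mono
    fun k hk => hL (C k) (J' k) hk.1 (ρ k) hk.2.1 hk.2.2.1 hk.2.2.2.1 hk.2.2.2.2.le
  refine ⟨key.mono fun k hk => hk.1, ?_, ?_⟩
  · exact (IsBigO.of_bound L (key.mono fun k hk => hk.2.1)).trans h.state
  · have h1 : (fun k => g.pairing p₀ c (C k) (ρ k) - g.pairing p₀ c (C k) a)
        =O[l] fun k => e k ^ 2 := by
      refine IsBigO.trans (IsBigO.of_bound L (key.mono fun k hk => ?_))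
        ((h.state.norm_left.pow 2).add hE.abs_left)
      refine hk.2.2.trans (mul_le_mul_of_nonneg_left (le_abs_self _) hL0)
    exact (h1.add h.pairing).congr_left fun k => sub_add_cancel _ _

/-- Geodesics with nearby initial data remain close. -/
theorem IsGeodesicOn.isCloseAt [T2Space S] (he : Tendsto e l (𝓝 0)) (hc : g.IsGeodesicOn c J)
    (h0J : (0 : ℝ) ∈ J) (hC : ∀ᶠ k in l, g.IsGeodesicOn (C k) (J' k) ∧ (0 : ℝ) ∈ J' k)
    (h0 : ∀ p₀ : ℝ × S, c 0 ∈ (extChartAt I4 p₀).source → g.IsCloseAt l e c C p₀ fun _ => 0)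
    (hE : (fun k => g.speedSq (C k) 0 - g.speedSq c 0) =O[l] fun k => e k ^ 2)
    {T : ℝ} (hT : 0 ≤ T) (hTJ : T ∈ J) (hTC : ∀ᶠ k in l, T ∈ J' k)
    {p₀ : ℝ × S} (hp₀ : c T ∈ (extChartAt I4 p₀).source) : g.IsCloseAt l e c C p₀ fun _ => T := by
  have hsub : Icc 0 T ⊆ J := hc.ordConnected.out h0J hTJ
  -- By compactness `[0, T]` is cut into finitely many pieces, each mapped by `c` into one chart.
  obtain ⟨t, ht0, htm, ⟨m, hm⟩, ht⟩ := exists_monotone_Icc_subset_open_cover_Icc hT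
    (c := fun p₀ : ℝ × S => {r : Icc 0 T | c r ∈ (extChartAt I4 p₀).source})
    (fun p₀ => by
      have hcc : Continuous fun r : Icc 0 T => c r :=
        (hc.continuousOn.mono hsub).domRestrict
      exact (isOpen_extChartAt_source p₀).preimage hcc)
    (fun r _ => mem_iUnion.2 ⟨c r, mem_extChartAt_source (I := I4) (c r)⟩)
  -- The quantifier over all charts at `c (t n)` lets the induction enter the next piece in the
  -- chart that contains it.
  have key : ∀ n, ∀ p₀ : ℝ × S, c (t n) ∈ (extChartAt I4 p₀).source →
      g.IsCloseAt l e c C p₀ fun _ => (t n : ℝ) := by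
    intro n
    induction n with
    | zero =>
      rw [ht0]
      exact h0
    | succ n ih =>
      intro p₀ hp₀
      obtain ⟨p₁, hp₁⟩ := ht n
      have hle : (t n : ℝ) ≤ t (n + 1) := htm n.le_succ
      have hmem : ∀ r ∈ Icc (t n : ℝ) (t (n + 1)), c r ∈ (extChartAt I4 p₁).source :=
        fun r hr => hp₁ (a := ⟨r, (t n).2.1.trans hr.1, hr.2.trans (t (n + 1)).2.2⟩) hr
      have hsubn : Icc (t n : ℝ) (t (n + 1)) ⊆ Icc 0 T :=
        Icc_subset_Icc (t n).2.1 (t (n + 1)).2.2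
      refine IsCloseAt.change_chart he (IsCloseAt.advance he hc (hC.mono fun k hk => hk.1) hle
        (hsubn.trans hsub) hmem (ih p₁ (hmem _ (left_mem_Icc.2 hle))) ?_
        (Eventually.of_forall fun k => right_mem_Icc.2 hle) ?_)
        (hmem _ (right_mem_Icc.2 hle)) hp₀
      · refine hE.congr' ?_ EventuallyEq.rfl
        filter_upwards [hC, hTC] with k hk hk'
        have hJk : Icc 0 T ⊆ J' k := hk.1.ordConnected.out hk.2 hk'
        rw [speedSq, speedSq, speedSq, speedSq, hk.1.energy_eq hk.2 (hJk (t n).2),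
          hc.energy_eq h0J (hsub (t n).2)]
      · filter_upwards [hC, hTC] with k hk hk'
        exact hsubn.trans (hk.1.ordConnected.out hk.2 hk')
  have := key m p₀
  rw [hm m le_rfl] at this
  exact this hp₀

/-- Initial closeness of curves through a common point. -/
theorem isCloseAt_of_velocity (hp : ∀ᶠ k in l, C k 0 = c 0)
    (hv : (fun k => velocity (C k) 0 - velocity c 0 : α → E4) =O[l] e) {p₀ : ℝ × S}
    (hs : c 0 ∈ (extChartAt I4 p₀).source) : g.IsCloseAt l e c C p₀ fun _ => 0 := by
  refine ⟨hp.mono fun k hk => by rwa [hk], ?_, ?_⟩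
  · have h1 : (fun k => ((0 : E4), chartD p₀ (c 0) (velocity (C k) 0 - velocity c 0)))
        =O[l] e := (isBigO_zero e l).prod_left (((chartD p₀ (c 0)).isBigO_comp _ _).trans hv)
    refine h1.congr' (hp.mono fun k hk => ?_) EventuallyEq.rfl
    refine Prod.ext ?_ ?_
    · simp only [chartState, hk, Prod.fst_sub, sub_self]
    · simp only [chartState, hk, Prod.snd_sub, map_sub]
  · refine (isBigO_zero _ l).congr' (hp.mono fun k hk => ?_) EventuallyEq.rfl
    simp only [Spacetime.pairing, chartState, hk, sub_self, map_zero]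

/-- Geodesics with the same initial data agree. -/
theorem IsGeodesicOn.eq_of_nonneg [T2Space S] {c c' : ℝ → ℝ × S} {J J' : Set ℝ}
    (hc : g.IsGeodesicOn c J) (hc' : g.IsGeodesicOn c' J') (h0 : (0 : ℝ) ∈ J) (h0' : (0 : ℝ) ∈ J')
    (hp : c' 0 = c 0) (hv : velocity c' 0 = velocity c 0) {T : ℝ} (hT : 0 ≤ T) (hTJ : T ∈ J)
    (hTJ' : T ∈ J') : c' T = c T ∧ velocity c' T = velocity c T := by
  have hs := mem_extChartAt_source (I := I4) (c T)
  -- For the error `0` and a one-point filter, being `O(e)` is equality.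
  have h := hc.isCloseAt (l := pure ()) (e := fun _ => 0) (C := fun _ => c') (J' := fun _ => J')
    tendsto_const_nhds h0 (eventually_pure.2 ⟨hc', h0'⟩)
    (fun p₀ hp₀ => isCloseAt_of_velocity (eventually_pure.2 hp) (by
      simp only [hv]
      exact (isBigO_zero _ _).congr_left fun k => (sub_self _).symm) hp₀)
    (by
      simp only [speedSq, hp, hv, sub_self]
      exact isBigO_zero _ _) hT hTJ (eventually_pure.2 hTJ') hs
  have hm := eventually_pure.1 h.mem
  have h1 := eventually_pure.1 (isBigO_zero_right_iff.1 h.state)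
  have h2 : chartState (c T) c' T = chartState (c T) c T := sub_eq_zero.1 h1
  have h3 : c' T = c T := (extChartAt I4 (c T)).injOn hm hs (congrArg Prod.fst h2)
  refine ⟨h3, ?_⟩
  have h4 := congrArg Prod.snd h2
  have h5 := chartSymmD_comp_chartD (p₀ := c T) hs (velocity c T)
  have h6 := chartSymmD_comp_chartD (p₀ := c T) hm (velocity c' T)
  simp only [chartState] at h4
  rw [← h5, ← h6, h4, h3]

end Spacetime

namespace Spacetime

variable {S : Type*} [TopologicalSpace S] [ChartedSpace E3 S] [IsManifold I3 ∞ S]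
  {g : Spacetime S}

/-! ### The world function of a normal neighbourhood -/

section Normal

variable [T2Space S] {p : ℝ × S} {C : Set (ℝ × S)}

/-- The exponential map is homogeneous. -/
theorem IsGeodesicOn.eq_of_velocity_eq_smul {c c' : ℝ → ℝ × S} {J J' : Set ℝ}
    (hc : g.IsGeodesicOn c J) (hc' : g.IsGeodesicOn c' J') (h0 : (0 : ℝ) ∈ J)
    (hJ' : Icc (0 : ℝ) 1 ⊆ J') (hp : c' 0 = c 0) {k : ℝ} (hk : k ∈ J)
    (hv : velocity c' 0 = k • velocity c 0) : c' 1 = c k := by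
  have hk0 : k * 0 ∈ J := by rwa [mul_zero]
  have h1 := (hc.comp_mul k).eq_of_nonneg hc' hk0
    (hJ' (left_mem_Icc.2 zero_le_one)) (by rw [hp, mul_zero])
    (by rw [velocity_comp_mul (hc.mdifferentiableAt hk0), mul_zero, hv])
    zero_le_one (by rwa [mem_preimage, mul_one]) (hJ' (right_mem_Icc.2 zero_le_one))
  rw [h1.1, mul_one]

/-- A normal neighbourhood has a smooth logarithm, inverse to the exponential map, which computes
the world function. -/
theorem IsNormalNhd.exists_log (h : g.IsNormalNhd p C) :
    ∃ l : ℝ × S → E4, ContMDiffOn I4 𝓘(ℝ, E4) ∞ l C ∧ p ∈ C ∧ l p = 0 ∧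
      (∀ v : E4, (mfderiv I4 𝓘(ℝ, E4) l p v : E4) = v) ∧
      (∀ Z ∈ C, g.worldFunction C p Z = (1 / 2) * g.metric p (l Z) (l Z)) ∧
      ∀ Z ∈ C, ∃ (c : ℝ → ℝ × S) (J : Set ℝ), g.IsGeodesicOn c J ∧ Icc (0 : ℝ) 1 ⊆ J ∧
        c 0 = p ∧ velocity c 0 = l Z ∧ c 1 = Z := by
  obtain ⟨hCo, D, e, l, hDo, h0D, hD, hexp, he, hl, heC, hlC, hle, hel⟩ := h
  have hscale : ∀ (c : ℝ → ℝ × S) (J : Set ℝ), g.IsGeodesicOn c J → (0 : ℝ) ∈ J → c 0 = p →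
      ∀ k ∈ J, k • velocity c 0 ∈ D → e (k • velocity c 0) = c k := by
    intro c J hc h0 hcp k hk hkD
    obtain ⟨c', J', hc', hJ', hp', hv', he'⟩ := hexp _ hkD
    rw [← he']
    exact hc.eq_of_velocity_eq_smul hc' h0 hJ' (hp'.trans hcp.symm) hk hv'
  have hgeo : ∀ Z ∈ C, ∃ (c : ℝ → ℝ × S) (J : Set ℝ), g.IsGeodesicOn c J ∧
      Icc (0 : ℝ) 1 ⊆ J ∧ c 0 = p ∧ velocity c 0 = l Z ∧ c 1 = Z := by
    intro Z hZ
    obtain ⟨c, J, h1, h2, h3, h4, h5⟩ := hexp _ (hlC hZ)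
    exact ⟨c, J, h1, h2, h3, h4, h5.trans (hel hZ)⟩
  have he0 : e 0 = p := by
    obtain ⟨c, J, h1, h2, h3, h4, h5⟩ := hexp 0 h0D
    have h00 : (0 : ℝ) ∈ J := h2 (left_mem_Icc.2 zero_le_one)
    have := hscale c J h1 h00 h3 0 h00 (by rwa [zero_smul])
    rwa [zero_smul, h3] at this
  have hpC : p ∈ C := he0 ▸ heC h0D
  have hlp : l p = 0 := by rw [← he0, hle h0D]
  refine ⟨l, hl, hpC, hlp, ?_, ?_, hgeo⟩
  · have hlin : ∀ v ∈ D, (mfderiv I4 𝓘(ℝ, E4) l p v : E4) = v := by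
      intro v hv
      obtain ⟨c, J, hc, hJ, hcp, hcv, -⟩ := hexp v hv
      have h0 : (0 : ℝ) ∈ J := hJ (left_mem_Icc.2 zero_le_one)
      have hlm : MDifferentiableAt I4 𝓘(ℝ, E4) l (c 0) := by
        rw [hcp]
        exact (hl.contMDiffAt (hCo.mem_nhds hpC)).mdifferentiableAt (by simp)
      have h1 : HasMFDerivAt 𝓘(ℝ, ℝ) 𝓘(ℝ, E4) (l ∘ c) 0 _ :=
        hlm.hasMFDerivAt.comp 0 (hc.mdifferentiableAt h0).hasMFDerivAt
      let A : E4 →L[ℝ] E4 := mfderiv I4 𝓘(ℝ, E4) l (c 0)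
      let B : ℝ →L[ℝ] E4 := mfderiv 𝓘(ℝ, ℝ) I4 c 0
      have h2 : HasFDerivAt (fun r => l (c r)) (A.comp B) 0 := h1.hasFDerivAt
      have h3 : HasDerivAt (fun r : ℝ => r • v) v 0 := by
        simpa using (hasDerivAt_id (0 : ℝ)).smul_const v
      -- The logarithm straightens radial geodesics; differentiating at `0` shows that its
      -- differential fixes `v`.
      have h4 : (fun r => l (c r)) =ᶠ[𝓝 0] fun r => r • v := by
        have hDv : ∀ᶠ r : ℝ in 𝓝 0, r • v ∈ D := by
          have hcont : ContinuousAt (fun r : ℝ => r • v) 0 := by fun_prop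
          exact hcont.preimage_mem_nhds (hDo.mem_nhds (by rwa [zero_smul]))
        filter_upwards [hc.isOpen.mem_nhds h0, hDv] with r hr hrD
        rw [← hscale c J hc h0 hcp r hr (by rwa [hcv]), hcv, hle hrD]
      have h5 := h2.hasDerivAt.unique (h3.congr_of_eventuallyEq h4)
      have h6 : (mfderiv I4 𝓘(ℝ, E4) l (c 0) : E4 →L[ℝ] E4) (velocity c 0) = v := h5
      rw [hcv, hcp] at h6
      exact h6
    intro v
    have hcont : ContinuousAt (fun r : ℝ => r • v) 0 := by fun_prop
    have hDv : ∀ᶠ r : ℝ in 𝓝[≠] 0, r • v ∈ D := nhdsWithin_le_nhds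
      (hcont.preimage_mem_nhds (hDo.mem_nhds (by rwa [zero_smul])))
    obtain ⟨r, hrD, hr0⟩ := (hDv.and self_mem_nhdsWithin).exists
    have h1 := hlin _ hrD
    have h2 := (mfderiv I4 𝓘(ℝ, E4) l p : E4 →L[ℝ] E4).map_smul r v
    have h3 : r • ((mfderiv I4 𝓘(ℝ, E4) l p : E4 →L[ℝ] E4) v) = r • v := h2.symm.trans h1
    exact smul_right_injective E4 hr0 h3
  · intro Z hZ
    have hex : ∃ r : ℝ, ∃ (c : ℝ → ℝ × S) (J : Set ℝ), g.IsGeodesicOn c J ∧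
        Icc (0 : ℝ) 1 ⊆ J ∧ MapsTo c (Icc 0 1) C ∧ c 0 = p ∧ c 1 = Z ∧
        r = (1 / 2) * g.metric p (velocity c 0) (velocity c 0) := by
      obtain ⟨c, J, h1, h2, h3, h4, h5⟩ := hgeo Z hZ
      refine ⟨_, c, J, h1, h2, fun k hk => ?_, h3, h5, rfl⟩
      have hkD : k • velocity c 0 ∈ D := by
        rw [h4]
        exact hD.smul_mem (hlC hZ) hk.1 hk.2
      rw [← hscale c J h1 (h2 (left_mem_Icc.2 zero_le_one)) h3 k (h2 hk) hkD]
      exact heC hkD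
    obtain ⟨c, J, hc, hJ, hcC, hc0, hc1, hr⟩ := Classical.epsilon_spec hex
    -- The geodesic picked in the definition of the world function must be shown to be the radial
    -- one. The multiples of its velocity that lie in `D` form an open set of parameters, which is
    -- also closed in `[0, 1]`, since there `k • velocity c 0 = l (c k)` while `c` stays in `C`.
    have hkey : Icc (0 : ℝ) 1 ⊆ {k | k • velocity c 0 ∈ D} := by
      have h00 : (0 : ℝ) ∈ J := hJ (left_mem_Icc.2 zero_le_one)
      have hset : {k | k • velocity c 0 ∈ D} ∩ Icc 0 1 =
          Icc 0 1 ∩ (fun k => l (c k) - k • velocity c 0) ⁻¹' {0} := by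
        ext k
        constructor
        · rintro ⟨h1, h2⟩
          refine ⟨h2, sub_eq_zero.2 ?_⟩
          rw [← hscale c J hc h00 hc0 k (hJ h2) h1, hle h1]
        · rintro ⟨h1, h2⟩
          refine ⟨?_, h1⟩
          rw [mem_ofPred_eq, ← sub_eq_zero.1 h2]
          exact hlC (hcC h1)
      refine IsClosed.Icc_subset_of_forall_exists_gt ?_ (by simpa using h0D) ?_
      · rw [hset]
        refine ContinuousOn.preimage_isClosed_of_isClosed ?_ isClosed_Icc isClosed_singleton
        exact (hl.continuousOn.comp (hc.continuousOn.mono hJ) hcC).sub (by fun_prop)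
      · rintro x ⟨hxD, hx⟩ y hy
        have hopen : IsOpen {k : ℝ | k • velocity c 0 ∈ D} :=
          hDo.preimage (by fun_prop)
        have h1 : ∀ᶠ k in 𝓝[>] x, k • velocity c 0 ∈ D :=
          nhdsWithin_le_nhds (hopen.mem_nhds hxD)
        obtain ⟨k, hk, hk'⟩ := (h1.and (Ioc_mem_nhdsGT hy)).exists
        exact ⟨k, hk, hk'⟩
    have h1 := hkey (right_mem_Icc.2 zero_le_one)
    have h2 := hscale c J hc (hJ (left_mem_Icc.2 zero_le_one)) hc0 1
      (hJ (right_mem_Icc.2 zero_le_one)) h1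
    have h3 : l Z = velocity c 0 := by
      rw [← hc1, ← h2, hle h1, one_smul]
    rw [h3]
    exact hr

/-- Points of a convex normal neighbourhood at the same time with vanishing world function
coincide. -/
theorem IsNormalNhd.eq_of_worldFunction_eq_zero (h : g.IsNormalNhd p C) {Z : ℝ × S} (hZ : Z ∈ C)
    (ht : Z.1 = p.1) (hσ : g.worldFunction C p Z = 0) : Z = p := by
  obtain ⟨l, -, hp, hlp, -, hw, hgeo⟩ := h.exists_log
  obtain ⟨c, J, hc, hJ, hc0, hv, hc1⟩ := hgeo Z hZ
  have h0 : (0 : ℝ) ∈ J := hJ (left_mem_Icc.2 zero_le_one)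
  have h1 : (1 : ℝ) ∈ J := hJ (right_mem_Icc.2 zero_le_one)
  rw [hw Z hZ, ← hv] at hσ
  by_cases hv0 : velocity c 0 = 0
  -- A zero velocity is `0` times itself, so homogeneity gives `c 1 = c 0`.
  · have := hc.eq_of_velocity_eq_smul hc h0 hJ rfl h0 (k := 0) (by rw [hv0, smul_zero])
    rw [← hc1, ← hc0, this]
  · have hn : g.metric (c 0) (velocity c 0) (velocity c 0) = 0 := by
      rw [hc0]
      linarith
    have := hc.time_injOn h0 hv0 hn h1 h0 (by simp only [hc1, hc0, ht])
    exact absurd this one_ne_zero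

/-- The differential of the world function in terms of the logarithm. -/
theorem mfderiv_worldFunction (hC : IsOpen C) {l : ℝ × S → E4}
    (hl : ContMDiffOn I4 𝓘(ℝ, E4) ∞ l C)
    (hw : ∀ Z ∈ C, g.worldFunction C p Z = (1 / 2) * g.metric p (l Z) (l Z)) {Z : ℝ × S}
    (hZ : Z ∈ C) (v : E4) :
    (mfderiv I4 𝓘(ℝ, ℝ) (fun Z' => g.worldFunction C p Z') Z v : ℝ) =
      g.metric p (l Z) (mfderiv I4 𝓘(ℝ, E4) l Z v) := by
  have hlm : MDifferentiableAt I4 𝓘(ℝ, E4) l Z :=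
    (hl.contMDiffAt (hC.mem_nhds hZ)).mdifferentiableAt (by simp)
  have hq : HasFDerivAt (fun w : E4 => (1 / 2 : ℝ) * g.metricL p w w) _ (l Z) :=
    (((g.metricL p).hasFDerivAt (x := l Z)).clm_apply (hasFDerivAt_id _)).const_mul (1 / 2 : ℝ)
  have hev : (fun Z' => g.worldFunction C p Z') =ᶠ[𝓝 Z]
      (fun w : E4 => (1 / 2 : ℝ) * g.metricL p w w) ∘ l := by
    filter_upwards [hC.mem_nhds hZ] with Z' hZ'
    rw [hw Z' hZ', Function.comp_apply, metricL_apply]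
  have h1 : HasMFDerivAt I4 𝓘(ℝ, ℝ) ((fun w : E4 => (1 / 2 : ℝ) * g.metricL p w w) ∘ l) Z _ :=
    hq.hasMFDerivAt.comp Z hlm.hasMFDerivAt
  rw [hev.mfderiv_eq, h1.mfderiv]
  set w : E4 := mfderiv I4 𝓘(ℝ, E4) l Z v with hwdef
  have h2 : (1 / 2 : ℝ) * (g.metricL p (l Z) w + g.metricL p w (l Z)) = g.metric p (l Z) w := by
    rw [metricL_apply, metricL_apply, g.metric_symm p w]
    ring
  exact h2

end Normal

end Spacetime

namespace Spacetime

variable {S : Type*} [TopologicalSpace S] [ChartedSpace E3 S] [IsManifold I3 ∞ S]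
  {g : Spacetime S}

/-! ### Families of null geodesics at a given time -/

open Asymptotics

variable {α : Type*} {l : Filter α} {e : α → ℝ} {c : ℝ → ℝ × S} {C : α → ℝ → ℝ × S}
  {J : Set ℝ} {J' : α → Set ℝ} {θ τ : ℝ} {σ : α → ℝ}

variable (g) in
/-- The geodesics `C k` start at the same point as the geodesic `c`, with velocities which agree to
first order in `e k` and have the same squared length, and reach at the parameter `σ k ≥ 0` the time
which `c` reaches at `τ ≥ 0`. Up to the sign of `θ`, time increases along the geodesics. -/
structure IsNearFamily (l : Filter α) (e : α → ℝ) (c : ℝ → ℝ × S) (J : Set ℝ)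
    (C : α → ℝ → ℝ × S) (J' : α → Set ℝ) (θ τ : ℝ) (σ : α → ℝ) : Prop where
  tendsto_zero : Tendsto e l (𝓝 0)
  geodesic : g.IsGeodesicOn c J
  zero_mem : (0 : ℝ) ∈ J
  mono : StrictMonoOn (fun r => θ * (c r).1) J
  mem : τ ∈ J
  nonneg : 0 ≤ τ
  family : ∀ᶠ k in l, g.IsGeodesicOn (C k) (J' k) ∧ (0 : ℝ) ∈ J' k ∧ σ k ∈ J' k ∧
    StrictMonoOn (fun r => θ * (C k r).1) (J' k) ∧ C k 0 = c 0 ∧ (C k (σ k)).1 = (c τ).1 ∧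
    g.speedSq (C k) 0 = g.speedSq c 0
  velocity : (fun k => velocity (C k) 0 - velocity c 0 : α → E4) =O[l] e

namespace IsNearFamily

theorem filter_mono {l' : Filter α} (h : g.IsNearFamily l e c J C J' θ τ σ) (hl : l' ≤ l) :
    g.IsNearFamily l' e c J C J' θ τ σ :=
  { h with
    tendsto_zero := h.tendsto_zero.mono_left hl
    family := h.family.filter_mono hl
    velocity := h.velocity.mono hl }

theorem isCloseAt [T2Space S] (h : g.IsNearFamily l e c J C J' θ τ σ) {T : ℝ} (hT : 0 ≤ T)
    (hTJ : T ∈ J) (hTC : ∀ᶠ k in l, T ∈ J' k) {p₀ : ℝ × S}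
    (hp₀ : c T ∈ (extChartAt I4 p₀).source) : g.IsCloseAt l e c C p₀ fun _ => T := by
  refine h.geodesic.isCloseAt h.tendsto_zero h.zero_mem
    (h.family.mono fun k hk => ⟨hk.1, hk.2.1⟩)
    (fun p₁ hp₁ => isCloseAt_of_velocity (h.family.mono fun k hk => hk.2.2.2.2.1)
      h.velocity hp₁)
    ((isBigO_zero _ l).congr' (h.family.mono fun k hk => ?_) EventuallyEq.rfl) hT hTJ hTC hp₀
  exact (sub_eq_zero.2 hk.2.2.2.2.2.2).symm

theorem tendsto_time {p₀ : ℝ × S} {ρ : α → ℝ} (he : Tendsto e l (𝓝 0))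
    (h : g.IsCloseAt l e c C p₀ ρ) : Tendsto (fun k => (C k (ρ k)).1 - (c (ρ k)).1) l (𝓝 0) :=
  (h.state.trans_tendsto he).fst_nhds.fst_nhds

theorem eventually_nonneg (h : g.IsNearFamily l e c J C J' θ τ σ) : ∀ᶠ k in l, 0 ≤ σ k := by
  filter_upwards [h.family] with k hk
  have h1 := h.mono.monotoneOn h.zero_mem h.mem h.nonneg
  rw [← hk.2.2.2.1.le_iff_le hk.2.1 hk.2.2.1]
  simp only [hk.2.2.2.2.1, hk.2.2.2.2.2.1]
  exact h1

/-- Closeness at the parameters `σ k`, if these converge. -/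
theorem isCloseAt_of_tendsto [T2Space S] (h : g.IsNearFamily l e c J C J' θ τ σ) {ρ₀ : ℝ}
    (hρ₀ : 0 ≤ ρ₀) (hρJ : ρ₀ ∈ J) (hσ : Tendsto σ l (𝓝 ρ₀)) {p₀ : ℝ × S}
    (hp₀ : c ρ₀ ∈ (extChartAt I4 p₀).source) : g.IsCloseAt l e c C p₀ σ := by
  have hmem : J ∩ c ⁻¹' (extChartAt I4 p₀).source ∈ 𝓝 ρ₀ :=
    inter_mem (h.geodesic.isOpen.mem_nhds hρJ)
      ((h.geodesic.continuousAt hρJ).preimage_mem_nhds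
        ((isOpen_extChartAt_source p₀).mem_nhds hp₀))
  obtain ⟨δ, hδ, hsub⟩ := Metric.mem_nhds_iff.1 hmem
  -- Closeness propagates forward from parameter `0`, so the interval around `ρ₀` is cut off there.
  set a := max 0 (ρ₀ - δ / 2)
  obtain ⟨b, hb⟩ : ∃ b, b = ρ₀ + δ / 2 := ⟨_, rfl⟩
  have haρ : a ≤ ρ₀ := max_le hρ₀ (by linarith)
  have hab : a ≤ b := by linarith
  have hIcc : Icc a b ⊆ J ∩ c ⁻¹' (extChartAt I4 p₀).source := by
    intro r hr
    refine hsub ?_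
    have : ρ₀ - δ / 2 ≤ a := le_max_right _ _
    rw [Metric.mem_ball, Real.dist_eq, abs_lt]
    constructor <;> linarith [hr.1, hr.2]
  have hσI : ∀ᶠ k in l, σ k ∈ Icc a b := by
    filter_upwards [h.eventually_nonneg, hσ.eventually (Ioo_mem_nhds
      (show ρ₀ - δ / 2 < ρ₀ by linarith) (show ρ₀ < b by linarith))] with k h1 h2
    exact ⟨max_le h1 h2.1.le, h2.2.le⟩
  have hJ' : ∀ᶠ k in l, Icc 0 (σ k) ⊆ J' k :=
    h.family.mono fun k hk => hk.1.ordConnected.out hk.2.1 hk.2.2.1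
  have ha0 : 0 ≤ a := le_max_left _ _
  have haI := left_mem_Icc.2 hab
  have haJ' : ∀ᶠ k in l, a ∈ J' k := by
    filter_upwards [hσI, hJ'] with k h1 h2
    exact h2 ⟨ha0, h1.1⟩
  refine IsCloseAt.advance h.tendsto_zero h.geodesic (h.family.mono fun k hk => hk.1) hab
    (fun r hr => (hIcc hr).1) (fun r hr => (hIcc hr).2)
    (h.isCloseAt ha0 (hIcc haI).1 haJ' (hIcc haI).2)
    ((isBigO_zero _ l).congr' ?_ EventuallyEq.rfl) hσI ?_
  · filter_upwards [h.family, haJ'] with k hk hk'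
    have h1 : g.speedSq (C k) a = g.speedSq (C k) 0 := hk.1.energy_eq hk' hk.2.1
    have h2 : g.speedSq c a = g.speedSq c 0 := h.geodesic.energy_eq (hIcc haI).1 h.zero_mem
    rw [h1, h2, hk.2.2.2.2.2.2, sub_self]
  · filter_upwards [hJ'] with k hk
    exact (Icc_subset_Icc_left ha0).trans hk

/-- If `σ` were frequently at most some `a' < τ`, a limit `ρ₀ ≤ a'` along an ultrafilter would
satisfy time of `c ρ₀` = time of `c τ`, against strict monotonicity. If it exceeded some `T > τ` in
`J`, then `C k T`, close to `c T`, would already be past the time of `c τ` in the sense of `θ`,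
against monotonicity of `C k`. -/
theorem tendsto [T2Space S] (h : g.IsNearFamily l e c J C J' θ τ σ) : Tendsto σ l (𝓝 τ) := by
  have hsubJ : Icc 0 τ ⊆ J := h.geodesic.ordConnected.out h.zero_mem h.mem
  rw [tendsto_order]
  constructor
  · intro a' ha'
    by_contra hcon
    rw [not_eventually] at hcon
    have hcon' : ∃ᶠ k in l, σ k ≤ a' := hcon.mono fun k hk => not_lt.1 hk
    have : (l ⊓ 𝓟 {k | σ k ≤ a'}).NeBot := frequently_mem_iff_neBot.1 hcon'
    set U := Ultrafilter.of (l ⊓ 𝓟 {k | σ k ≤ a'}) with hU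
    have hUl : (U : Filter α) ≤ l ⊓ 𝓟 {k | σ k ≤ a'} := Ultrafilter.of_le _
    have hf := h.filter_mono (hUl.trans inf_le_left)
    have hUa : ∀ᶠ k in (U : Filter α), σ k ≤ a' := hUl.trans inf_le_right (mem_principal_self _)
    have hUI : ∀ᶠ k in (U : Filter α), σ k ∈ Icc 0 a' := hf.eventually_nonneg.and hUa
    obtain ⟨ρ₀, hρ₀, hle⟩ := isCompact_Icc.ultrafilter_le_nhds' (U.map σ) hUI
    have hσ : Tendsto σ U (𝓝 ρ₀) := hle
    have hρJ : ρ₀ ∈ J := hsubJ ⟨hρ₀.1, hρ₀.2.trans ha'.le⟩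
    have h1 := tendsto_time hf.tendsto_zero
      (hf.isCloseAt_of_tendsto hρ₀.1 hρJ hσ (mem_extChartAt_source (I := I4) (c ρ₀)))
    have h2 : Tendsto (fun k => (c (σ k)).1) U (𝓝 (c ρ₀).1) :=
      (h.geodesic.continuousAt hρJ).fst.tendsto.comp hσ
    have h3 : Tendsto (fun k => (C k (σ k)).1) U (𝓝 (0 + (c ρ₀).1)) :=
      (h1.add h2).congr fun k => sub_add_cancel _ _
    have h4 : Tendsto (fun k => (C k (σ k)).1) U (𝓝 (c τ).1) :=
      tendsto_const_nhds.congr' (hf.family.mono fun k hk => hk.2.2.2.2.2.1.symm)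
    have h5 := tendsto_nhds_unique h3 h4
    rw [zero_add] at h5
    have h6 : ρ₀ = τ := h.mono.injOn hρJ h.mem (by simp only [h5])
    exact absurd hρ₀.2 (not_le.2 (h6 ▸ ha'))
  · intro b' hb'
    obtain ⟨u, hu, huJ⟩ := exists_Ico_subset_of_mem_nhds (h.geodesic.isOpen.mem_nhds h.mem)
      ⟨b', hb'⟩
    obtain ⟨T, hτT, hT⟩ := exists_between (lt_min hu hb')
    have hTJ : T ∈ J := huJ ⟨hτT.le, hT.trans_le (min_le_left _ _)⟩
    have hT0 : 0 ≤ T := h.nonneg.trans hτT.le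
    have hfalse : ∀ᶠ k in l ⊓ 𝓟 {k | T ≤ σ k}, False := by
      have hf := h.filter_mono (inf_le_left : l ⊓ 𝓟 {k | T ≤ σ k} ≤ l)
      have hσT : ∀ᶠ k in l ⊓ 𝓟 {k | T ≤ σ k}, T ≤ σ k :=
        (inf_le_right : _ ≤ 𝓟 {k | T ≤ σ k}) (mem_principal_self _)
      have hTJ' : ∀ᶠ k in l ⊓ 𝓟 {k | T ≤ σ k}, T ∈ J' k := by
        filter_upwards [hf.family, hσT] with k hk hk'
        exact hk.1.ordConnected.out hk.2.1 hk.2.2.1 ⟨hT0, hk'⟩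
      have h1 := (tendsto_time hf.tendsto_zero
        (hf.isCloseAt hT0 hTJ hTJ' (mem_extChartAt_source (I := I4) (c T)))).const_mul θ
      have h2 : 0 < θ * (c T).1 - θ * (c τ).1 := sub_pos.2 (h.mono h.mem hTJ hτT)
      rw [mul_zero] at h1
      filter_upwards [hf.family, hσT, hTJ', h1.eventually (lt_mem_nhds (neg_lt_zero.2 h2))]
        with k hk h3 h4 h5
      have h6 := hk.2.2.2.1.monotoneOn h4 hk.2.2.1 h3
      simp only [hk.2.2.2.2.2.1] at h6
      linarith
    rw [eventually_inf_principal] at hfalse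
    filter_upwards [hfalse] with k hk
    exact (not_le.1 hk).trans (hT.trans_le (min_le_right _ _))

/-- Null geodesics with a common starting point are close when they reach a common time, and their
displacement is orthogonal to them to first order. -/
theorem final [T2Space S] (h : g.IsNearFamily l e c J C J' θ τ σ)
    (hn : g.speedSq c 0 = 0) {p₀ : ℝ × S} (hp₀ : c τ ∈ (extChartAt I4 p₀).source) :
    (∀ᶠ k in l, C k (σ k) ∈ (extChartAt I4 p₀).source) ∧
    (fun k => chartState p₀ (C k) (σ k) - chartState p₀ c τ) =O[l] e ∧
    (fun k => g.chartG p₀ (chartState p₀ c τ).1 (chartState p₀ c τ).2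
      ((chartState p₀ (C k) (σ k)).1 - (chartState p₀ c τ).1)) =o[l] e := by
  have hσ := h.tendsto
  have hclose := h.isCloseAt_of_tendsto h.nonneg h.mem hσ hp₀
  have hgeod := h.geodesic.isGeodAt h.mem hp₀
  set z := chartState p₀ c with hz
  set z' := fun k => chartState p₀ (C k) (σ k) with hz'
  have hO : (fun k => z' k - z (σ k)) =O[l] e := hclose.state
  -- A null velocity with zero time component vanishes; it would then vanish along all of `c`,
  -- making time constant against `mono`.
  have hvel : (Spacetime.velocity c τ).1 ≠ 0 := by
    intro h0
    have h1 : Spacetime.velocity c τ = 0 := by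
      by_contra hne
      exact velocity_fst_ne_zero hne ((h.geodesic.energy_eq h.mem h.zero_mem).trans hn) h0
    have h2 : ∀ r ∈ J, Spacetime.velocity c r = 0 :=
      IsParallelOn.eq_zero h.geodesic h.geodesic.parallel h.mem h1
    obtain ⟨u, hu, huJ⟩ := exists_Ico_subset_of_mem_nhds (h.geodesic.isOpen.mem_nhds h.mem)
      ⟨τ + 1, by linarith⟩
    obtain ⟨T, hτT, hT⟩ := exists_between hu
    have hTJ : T ∈ J := huJ ⟨hτT.le, hT⟩
    have h3 := h.geodesic.isOpen.is_const_of_deriv_eq_zero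
      h.geodesic.ordConnected.isPreconnected (f := fun r => (c r).1)
      (fun r hr => (hasDerivAt_time
        (h.geodesic.mdifferentiableAt hr)).differentiableAt.differentiableWithinAt)
      (fun r hr => by
        rw [(hasDerivAt_time (h.geodesic.mdifferentiableAt hr)).deriv, h2 r hr]
        rfl) hTJ h.mem
    exact hτT.ne' (h.mono.injOn hTJ h.mem (congrArg (fun x => θ * x) h3))
  -- As time has nonzero derivative at `τ`, the parameter difference is comparable to the time
  -- difference along `c`. The latter is `O(e)`, because `C k (σ k)` has the time of `c τ` and is
  -- `O(e)`-close to `c (σ k)`.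
  have htime : (fun k => σ k - τ) =O[l] e := by
    have h1 := ((hasDerivAt_time (h.geodesic.mdifferentiableAt h.mem)).isTheta_sub
      hvel).2.comp_tendsto (hσ.prodMk (tendsto_pure.2 (Eventually.of_forall fun _ => rfl)))
    refine h1.trans ?_
    have h2 : (fun k => (z' k - z (σ k)).1.1) =O[l] e :=
      (IsBigO.of_bound 1 (Eventually.of_forall fun k => by
        rw [one_mul]
        exact (norm_fst_le _).trans (norm_fst_le _))).trans hO
    refine h2.neg_left.congr' (h.family.mono fun k hk => ?_) EventuallyEq.rfl
    have h3 : (z' k - z (σ k)).1.1 = (C k (σ k)).1 - (c (σ k)).1 := rfl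
    change -(z' k - z (σ k)).1.1 = (c (σ k)).1 - (c τ).1
    rw [h3, hk.2.2.2.2.2.1, neg_sub]
  have hcz : (fun k => z (σ k) - z τ) =O[l] e :=
    (hgeod.differentiableAt.isBigO_sub.comp_tendsto hσ).trans htime
  have hst : (fun k => z' k - z τ) =O[l] e :=
    (hO.add hcz).congr_left fun k => sub_add_sub_cancel _ _ _
  refine ⟨hclose.mem, hst, ?_⟩
  have hΩ := g.isMetricOn_chartG p₀
  set β : E4 × E4 → (E4 →L[ℝ] ℝ) := fun q => g.chartG p₀ q.1 q.2 with hβ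
  have hG1 : HasFDerivAt (fun q : E4 × E4 => g.chartG p₀ q.1) _ (z τ) :=
    HasFDerivAt.comp (g := g.chartG p₀) (f := Prod.fst) (z τ)
      (hΩ.hasFDerivAt ((extChartAt I4 p₀).map_source hp₀)) hasFDerivAt_fst
  have hβd : DifferentiableAt ℝ β (z τ) := (hG1.clm_apply hasFDerivAt_snd).differentiableAt
  have hztend : Tendsto (fun k => z (σ k)) l (𝓝 (z τ)) := hgeod.continuousAt.tendsto.comp hσ
  have hO1 : (fun k => (z' k).1 - (z (σ k)).1) =O[l] e :=
    (IsBigO.of_bound 1 (Eventually.of_forall fun k => by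
      rw [one_mul]
      exact norm_fst_le (z' k - z (σ k)))).trans hO
  have hsq : (fun k => e k ^ 2) =o[l] e := by
    have h1 : (fun k => e k * e k) =o[l] fun k => 1 * e k :=
      ((isLittleO_one_iff ℝ).2 h.tendsto_zero).mul_isBigO (isBigO_refl e l)
    simpa [pow_two] using h1
  -- The displacement splits at `c (σ k)`. `t2` is the Gauss pairing at `σ k`, `t1` the error of
  -- evaluating the covector at `σ k` instead of `τ`, a product of two `O(e)` terms, and `t3` the
  -- displacement along `c`, negligible because the velocity of `c` is null.
  have t1 : (fun k => (β (z (σ k)) - β (z τ)) ((z' k).1 - (z (σ k)).1)) =o[l] e := by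
    have h1 : (fun k => β (z (σ k)) - β (z τ)) =O[l] e :=
      (hβd.isBigO_sub.comp_tendsto hztend).trans hcz
    have h2 : (fun k => (β (z (σ k)) - β (z τ)) ((z' k).1 - (z (σ k)).1))
        =O[l] fun k => ‖β (z (σ k)) - β (z τ)‖ * ‖(z' k).1 - (z (σ k)).1‖ :=
      IsBigO.of_bound 1 (Eventually.of_forall fun k => by
        rw [one_mul, norm_mul, norm_norm, norm_norm]
        exact ContinuousLinearMap.le_opNorm _ _)
    refine h2.trans_isLittleO (((h1.norm_left.mul hO1.norm_left).congr_right fun k => ?_)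
      |>.trans_isLittleO hsq)
    ring
  have t2 : (fun k => β (z (σ k)) ((z' k).1 - (z (σ k)).1)) =o[l] e :=
    hclose.pairing.trans_isLittleO hsq
  have t3 : (fun k => β (z τ) ((z (σ k)).1 - (z τ).1)) =o[l] e := by
    have h1 : HasDerivAt (fun r => β (z τ) (z r).1) (β (z τ) (z τ).2) τ :=
      (β (z τ)).hasFDerivAt.comp_hasDerivAt τ hgeod.fst
    have h2 : β (z τ) (z τ).2 = 0 := by
      have h3 : MetricCoeff.energy (g.chartG p₀) (z τ) = 0 := by
        rw [hz, energy_chartState hp₀, h.geodesic.energy_eq h.mem h.zero_mem]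
        have : g.metric (c 0) (Spacetime.velocity c 0) (Spacetime.velocity c 0) = 0 := hn
        rw [this, mul_zero]
      have h4 : (1 / 2 : ℝ) * β (z τ) (z τ).2 = 0 := h3
      linarith
    rw [h2] at h1
    have h5 := (h1.isLittleO.comp_tendsto hσ).trans_isBigO htime
    refine h5.congr_left fun k => ?_
    simp [map_sub]
  refine ((t2.sub t1).add t3).congr_left fun k => ?_
  rw [sub_apply, sub_sub_cancel, ← map_add, sub_add_sub_cancel]

end IsNearFamily

end Spacetime

namespace Spacetime

variable {S : Type*} [TopologicalSpace S] [ChartedSpace E3 S] [IsManifold I3 ∞ S]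
  {g : Spacetime S}

/-! ### The logarithm along nearby null geodesics. -/

section Phase

open Asymptotics

theorem isBigO_bilin {α E F : Type*} [NormedAddCommGroup E] [NormedSpace ℝ E]
    [NormedAddCommGroup F] [NormedSpace ℝ F] (B : E →L[ℝ] F →L[ℝ] ℝ) {l : Filter α}
    (a : α → E) (b : α → F) : (fun k => B (a k) (b k)) =O[l] fun k => ‖a k‖ * ‖b k‖ :=
  IsBigO.of_bound ‖B‖ (Eventually.of_forall fun k => by
    rw [norm_mul, norm_norm, norm_norm, ← mul_assoc]
    exact B.le_opNorm₂ _ _)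

variable {α : Type*} {l : Filter α} {e : α → ℝ} {c : ℝ → ℝ × S} {C : α → ℝ → ℝ × S}
  {J : Set ℝ} {J' : α → Set ℝ} {θ τ : ℝ} {σ : α → ℝ}

/-- The logarithm at the end point of a null geodesic is small along nearby null geodesics, and
orthogonal to its derivative, in the sense that the world function and its derivative along the
geodesics are of second order. -/
theorem IsNearFamily.isLittleO_log [T2Space S] (h : g.IsNearFamily l e c J C J' θ τ σ)
    (hn : g.speedSq c 0 = 0) {U : Set (ℝ × S)} (hU : IsOpen U) (hcU : c τ ∈ U)
    {ℓ : ℝ × S → E4} (hℓ : ContMDiffOn I4 𝓘(ℝ, E4) ∞ ℓ U) (hℓ0 : ℓ (c τ) = 0)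
    (hℓd : ∀ v : E4, (mfderiv I4 𝓘(ℝ, E4) ℓ (c τ) v : E4) = v) :
    (fun k => g.metric (c τ) (ℓ (C k (σ k))) (ℓ (C k (σ k)))) =o[l] e ∧
    (fun k => g.metric (c τ) (ℓ (C k (σ k)))
      (mfderiv I4 𝓘(ℝ, E4) ℓ (C k (σ k)) (Spacetime.velocity (C k) (σ k)))) =o[l] e := by
  set p₀ := c τ with hp₀def
  have hp₀ : c τ ∈ (extChartAt I4 p₀).source := mem_extChartAt_source p₀
  obtain ⟨hmem, hO, ho⟩ := h.final hn hp₀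
  set z := chartState p₀ c τ with hz
  set z' := fun k => chartState p₀ (C k) (σ k) with hz'
  set W := (extChartAt I4 p₀).target ∩ (extChartAt I4 p₀).symm ⁻¹' U with hW
  have hWo : IsOpen W := (continuousOn_extChartAt_symm p₀).isOpen_inter_preimage
    (isOpen_extChartAt_target p₀) hU
  set f : E4 → E4 := fun u => ℓ ((extChartAt I4 p₀).symm u) with hf
  have hfW : ContDiffOn ℝ ∞ f W := by
    rw [← contMDiffOn_iff_contDiffOn]
    exact hℓ.comp ((contMDiffOn_chart_symm p₀).mono inter_subset_left) inter_subset_right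
  have hfd : ∀ q ∈ (extChartAt I4 p₀).source, q ∈ U → ∀ v : E4,
      (mfderiv I4 𝓘(ℝ, E4) ℓ q v : E4) =
        fderiv ℝ f (extChartAt I4 p₀ q) (chartD p₀ q v) := by
    intro q hq hqU v
    have hqW : extChartAt I4 p₀ q ∈ W := by
      refine ⟨(extChartAt I4 p₀).map_source hq, ?_⟩
      rw [mem_preimage, (extChartAt I4 p₀).left_inv hq]
      exact hqU
    have hd : DifferentiableAt ℝ f (extChartAt I4 p₀ q) :=
      (hfW.differentiableOn (by simp)).differentiableAt (hWo.mem_nhds hqW)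
    have h2 : mfderiv I4 𝓘(ℝ, E4) (f ∘ extChartAt I4 p₀) q =
        (mfderiv 𝓘(ℝ, E4) 𝓘(ℝ, E4) f (extChartAt I4 p₀ q)).comp
          (mfderiv I4 𝓘(ℝ, E4) (extChartAt I4 p₀) q) :=
      mfderiv_comp q hd.mdifferentiableAt (mdifferentiableAt_chart hq)
    have h3 : f ∘ extChartAt I4 p₀ =ᶠ[𝓝 q] ℓ := by
      filter_upwards [(isOpen_extChartAt_source (I := I4) p₀).mem_nhds hq] with r hr
      rw [Function.comp_apply, hf]
      simp only [(extChartAt I4 p₀).left_inv hr]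
    rw [h3.mfderiv_eq, mfderiv_eq_fderiv] at h2
    exact congrArg (fun L : E4 →L[ℝ] E4 => L v) h2
  have hzW : z.1 ∈ W := by
    refine ⟨(extChartAt I4 p₀).map_source hp₀, ?_⟩
    rw [hz, mem_preimage, chartState, (extChartAt I4 p₀).left_inv hp₀]
    exact hcU
  have hz0 : f z.1 = 0 := by
    rw [hf, hz]
    simp only [chartState, (extChartAt I4 p₀).left_inv hp₀]
    exact hℓ0
  set A : E4 →L[ℝ] E4 := fderiv ℝ f z.1 with hA
  have hAD : ∀ v, A (chartD p₀ (c τ) v) = v := fun v => (hfd (c τ) hp₀ hcU v).symm.trans (hℓd v)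
  -- Since `ℓ` has identity differential at `c τ`, its chart derivative `A` inverts the chart
  -- differential, hence is an isometry.
  have hsub : ∀ v w : E4, g.metricL p₀ (A v) (A w) = g.chartG p₀ z.1 v w := by
    intro v w
    have h1 : ∀ v : E4, ∃ v', v = chartD p₀ (c τ) v' := fun v => by
      have h2 := chartD_comp_chartSymmD ((extChartAt I4 p₀).map_source hp₀) v
      rw [(extChartAt I4 p₀).left_inv hp₀] at h2
      exact ⟨_, h2.symm⟩
    obtain ⟨v', rfl⟩ := h1 v
    obtain ⟨w', rfl⟩ := h1 w
    rw [hAD, hAD, g.metricL_apply, g.chartG_apply]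
    exact (g.chartMetric_chartD hp₀ v' w').symm
  have hzt : Tendsto z' l (𝓝 z) := by
    have h1 := hO.trans_tendsto h.tendsto_zero
    simpa using h1.add_const z
  have hzt1 : Tendsto (fun k => (z' k).1) l (𝓝 z.1) := hzt.fst_nhds
  set δ := fun k => (z' k).1 - z.1 with hδ
  have hδO : δ =O[l] e := (IsBigO.of_bound 1 (Eventually.of_forall fun k => by
    rw [one_mul]
    exact norm_fst_le (z' k - z))).trans hO
  have hfz : HasFDerivAt f A z.1 :=
    ((hfW.differentiableOn (by simp)).differentiableAt (hWo.mem_nhds hzW)).hasFDerivAt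
  set a := fun k => ℓ (C k (σ k)) with ha
  have haf : ∀ᶠ k in l, a k = f (z' k).1 := hmem.mono fun k hk => by
    rw [ha, hf, hz']
    simp only [chartState, (extChartAt I4 p₀).left_inv hk]
  have ho1 : (fun k => a k - A (δ k)) =o[l] e := by
    have h1 := (hasFDerivAt_iff_isLittleO.1 hfz).comp_tendsto hzt1
    refine (h1.trans_isBigO hδO).congr' (haf.mono fun k hk => ?_) EventuallyEq.rfl
    simp only [Function.comp_apply, hz0, sub_zero, hk, hδ]
  have hAO : (fun k => A (δ k)) =O[l] e := (A.isBigO_comp δ l).trans hδO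
  have haO : a =O[l] e :=
    (ho1.isBigO.add hAO).congr_left fun k => sub_add_cancel _ _
  have hsq : (fun k => e k * e k) =o[l] e := by
    simpa using ((isLittleO_one_iff ℝ).2 h.tendsto_zero).mul_isBigO (isBigO_refl e l)
  constructor
  · have h1 := isBigO_bilin (g.metricL p₀) (l := l) a a
    exact ((h1.trans (haO.norm_left.mul haO.norm_left)).trans_isLittleO hsq).congr_left
      fun k => g.metricL_apply _ _ _
  · set b : α → E4 := fun k =>
      mfderiv I4 𝓘(ℝ, E4) ℓ (C k (σ k)) (Spacetime.velocity (C k) (σ k)) with hb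
    have hbt : Tendsto b l (𝓝 (A z.2)) := by
      have hc : ContinuousAt (fun u => fderiv ℝ f u) z.1 :=
        (hfW.continuousOn_fderiv_of_isOpen hWo (by simp)).continuousAt (hWo.mem_nhds hzW)
      have h1 : Tendsto (fun k => fderiv ℝ f (z' k).1 (z' k).2) l (𝓝 (A z.2)) :=
        ((isBoundedBilinearMap_apply (𝕜 := ℝ) (E := E4) (F := E4)).continuous.tendsto
          (A, z.2)).comp ((hc.tendsto.comp hzt1).prodMk_nhds hzt.snd_nhds)
      refine h1.congr' ?_
      filter_upwards [hmem, hzt1.eventually (hWo.mem_nhds hzW)] with k hk hkW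
      have hkU : C k (σ k) ∈ U := by
        have h2 := hkW.2
        change (extChartAt I4 p₀).symm (extChartAt I4 p₀ (C k (σ k))) ∈ U at h2
        rwa [(extChartAt I4 p₀).left_inv hk] at h2
      exact (hfd _ hk hkU _).symm
    have hb1 : (fun k => b k - A z.2) =o[l] fun _ => (1 : ℝ) := by
      rw [isLittleO_one_iff]
      simpa using hbt.sub_const (A z.2)
    have hbO : b =O[l] fun _ => (1 : ℝ) := hbt.isBigO_one ℝ
    -- The pairing of `a` and `b` is split through their linearisations `A δ` and `A z.2`; only `t3`
    -- needs the Gauss orthogonality.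
    have t1 : (fun k => g.metricL p₀ (a k - A (δ k)) (b k)) =o[l] e := by
      simpa using (isBigO_bilin (g.metricL p₀) (l := l) (fun k => a k - A (δ k))
        b).trans_isLittleO (ho1.norm_left.mul_isBigO hbO.norm_left)
    have t2 : (fun k => g.metricL p₀ (A (δ k)) (b k - A z.2)) =o[l] e := by
      simpa using (isBigO_bilin (g.metricL p₀) (l := l) (fun k => A (δ k))
        (fun k => b k - A z.2)).trans_isLittleO (hAO.norm_left.mul_isLittleO hb1.norm_left)
    have t3 : (fun k => g.metricL p₀ (A (δ k)) (A z.2)) =o[l] e := by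
      refine ho.congr_left fun k => ?_
      rw [hsub]
      exact (g.isMetricOn_chartG p₀).symm _ ((extChartAt I4 p₀).map_source hp₀) _ _
    refine ((t1.add t2).add t3).congr_left fun k => ?_
    refine Eq.trans ?_ (g.metricL_apply p₀ (a k) (b k))
    simp only [map_sub, sub_apply]
    ring

end Phase

end Spacetime

namespace Spacetime

variable {S : Type*} [TopologicalSpace S] [ChartedSpace E3 S] [IsManifold I3 ∞ S]
  {g : Spacetime S}

/-! ### Scaling and smoothness of the initial data of the flow -/

theorem eq_sharp {p : ℝ × S} {v : E4} {ξ : E4 →L[ℝ] ℝ} (h : ∀ w, g.metric p v w = ξ w) :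
    v = g.sharp p ξ := by
  rw [← sub_eq_zero]
  refine g.metric_nondeg p _ fun w => ?_
  rw [← metricL_apply, map_sub, sub_apply, metricL_apply, metricL_apply, h, metric_sharp, sub_self]

theorem sharp_smul (p : ℝ × S) (k : ℝ) (ξ : E4 →L[ℝ] ℝ) :
    g.sharp p (k • ξ) = k • g.sharp p ξ := by
  refine (eq_sharp fun w => ?_).symm
  rw [← metricL_apply, map_smul, smul_apply, smul_apply, metricL_apply, metric_sharp]

variable (g) in
/-- The metric `h_t` at a point as a bilinear map. -/
noncomputable def hL (p : ℝ × S) : E3 →L[ℝ] E3 →L[ℝ] ℝ := (g.spatial p.1).inner p.2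

theorem hL_apply (p : ℝ × S) (v w : E3) : g.hL p v w = g.h p v w := rfl

theorem hL_nondeg (p : ℝ × S) (v : E3) (hv : ∀ w, g.hL p v w = 0) : v = 0 := by
  by_contra hne
  exact (g.h_pos p v hne).ne' (hv v)

variable (g) in
/-- The isomorphism of the cotangent space with the tangent space given by `h_t`. -/
noncomputable def spatialSharpL (p : ℝ × S) : (E3 →L[ℝ] ℝ) →L[ℝ] E3 :=
  ((MetricCoeff.dualEquiv (g.hL p) (hL_nondeg p)).symm : (E3 →L[ℝ] ℝ) →L[ℝ] E3)

theorem spatialSharpL_apply (p : ℝ × S) (η : E3 →L[ℝ] ℝ) :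
    g.spatialSharpL p η = g.spatialSharp p η := by
  refine g.eq_of_h_eq p _ _ fun w => ?_
  rw [g.spatialSharp_spec, ← hL_apply]
  exact congrArg (fun L : E3 →L[ℝ] ℝ => L w)
    ((MetricCoeff.dualEquiv (g.hL p) (hL_nondeg p)).apply_symm_apply η)

theorem apply_spatialSharp_pos (p : ℝ × S) {η : E3 →L[ℝ] ℝ} (hη : η ≠ 0) :
    0 < η (g.spatialSharp p η) := by
  rw [← g.spatialSharp_spec p η]
  refine g.h_pos p _ fun h0 => hη (ContinuousLinearMap.ext fun w => ?_)
  rw [← g.spatialSharp_spec p η w, h0, g.h_symm, g.h_zero_right]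
  rfl

theorem conorm_pos (p : ℝ × S) {η : E3 →L[ℝ] ℝ} (hη : η ≠ 0) : 0 < g.conorm p η :=
  Real.sqrt_pos.2 (apply_spatialSharp_pos p hη)

theorem conorm_smul (p : ℝ × S) {k : ℝ} (hk : 0 ≤ k) (η : E3 →L[ℝ] ℝ) :
    g.conorm p (k • η) = k * g.conorm p η := by
  rw [conorm, conorm, ← spatialSharpL_apply, map_smul, ← spatialSharpL_apply, map_smul, smul_apply,
    smul_eq_mul, smul_eq_mul, ← mul_assoc, Real.sqrt_mul (mul_nonneg hk hk), Real.sqrt_mul_self hk]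

theorem differentiableAt_conorm (p : ℝ × S) {η : E3 →L[ℝ] ℝ} (hη : η ≠ 0) :
    DifferentiableAt ℝ (g.conorm p) η := by
  have h1 : g.conorm p = fun η => Real.sqrt (η (g.spatialSharpL p η)) :=
    funext fun η => by rw [conorm, spatialSharpL_apply]
  rw [h1]
  refine DifferentiableAt.sqrt ?_ ?_
  · exact differentiableAt_id.clm_apply (g.spatialSharpL p).differentiableAt
  · rw [spatialSharpL_apply]
    exact (apply_spatialSharp_pos p hη).ne'

theorem nullLift_smul (ε : ℤˣ) (p : ℝ × S) {k : ℝ} (hk : 0 ≤ k) (η : E3 →L[ℝ] ℝ) :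
    g.nullLift ε p (k • η) = k • g.nullLift ε p η := by
  rw [nullLift, nullLift, conorm_smul p hk, smul_add, smul_smul, ContinuousLinearMap.smul_comp]
  congr 2
  ring

theorem sq_unit (ε : ℤˣ) : ((ε : ℤ) : ℝ) * ((ε : ℤ) : ℝ) = 1 := by
  rcases Int.units_eq_one_or ε with rfl | rfl <;> simp

variable (g) in
/-- The initial velocity of the flow. -/
noncomputable def flowVelocity (ε : ℤˣ) (p : ℝ × S) (η : E3 →L[ℝ] ℝ) : E4 :=
  g.sharp p ((((ε : ℤ) : ℝ) / g.conorm p η) • g.nullLift ε p η)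

theorem flowVelocity_smul (ε : ℤˣ) (p : ℝ × S) {k : ℝ} (hk : 0 < k) (η : E3 →L[ℝ] ℝ) :
    g.flowVelocity ε p (k • η) = g.flowVelocity ε p η := by
  rw [flowVelocity, flowVelocity, nullLift_smul ε p hk.le, conorm_smul p hk.le, smul_smul]
  congr 2
  field_simp

/-- The prefactor `ε` cancels the sign of the null lift in the time component, so both flows run to
the future; the formula also exhibits differentiability in `η`. -/
theorem flowVelocity_eq (ε : ℤˣ) (p : ℝ × S) {η : E3 →L[ℝ] ℝ} (hη : η ≠ 0) :
    g.flowVelocity ε p η = ((g.lapse p)⁻¹,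
      (((ε : ℤ) : ℝ) / g.conorm p η) • g.spatialSharpL p η) := by
  have hb := g.lapse_pos p
  have hc := g.conorm_pos p hη
  rw [flowVelocity, sharp_eq]
  refine Prod.ext ?_ ?_
  · have h1 : ((((ε : ℤ) : ℝ) / g.conorm p η) • g.nullLift ε p η) (1, 0) = -g.lapse p := by
      have h2 : g.nullLift ε p η (1, 0) = -((ε : ℤ) : ℝ) * g.lapse p * g.conorm p η := by
        simp [nullLift]
      rw [smul_apply, h2, smul_eq_mul]
      have := sq_unit ε
      field_simp
      linear_combination (-1 : ℝ) * this
    simp only [h1]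
    field_simp
  · have h1 : (((((ε : ℤ) : ℝ) / g.conorm p η) • g.nullLift ε p η).comp
        (ContinuousLinearMap.inr ℝ ℝ E3)) = (((ε : ℤ) : ℝ) / g.conorm p η) • η := by
      ext w
      simp [nullLift]
    simp only
    rw [h1, ← spatialSharpL_apply, map_smul]

theorem differentiableAt_flowVelocity (ε : ℤˣ) (p : ℝ × S) {η : E3 →L[ℝ] ℝ} (hη : η ≠ 0) :
    DifferentiableAt ℝ (g.flowVelocity ε p) η := by
  have h1 : (fun η => ((g.lapse p)⁻¹, (((ε : ℤ) : ℝ) / g.conorm p η) • g.spatialSharpL p η))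
      =ᶠ[𝓝 η] g.flowVelocity ε p := by
    filter_upwards [isOpen_ne.mem_nhds hη] with η' hη'
    exact (flowVelocity_eq ε p hη').symm
  refine DifferentiableAt.congr_of_eventuallyEq ?_ h1.symm
  simp only [div_eq_mul_inv]
  exact (differentiableAt_const _).prodMk
    ((((differentiableAt_conorm p hη).fun_inv (conorm_pos p hη).ne').const_mul _).smul
      (g.spatialSharpL p).differentiableAt)

theorem flowVelocity_null (ε : ℤˣ) (p : ℝ × S) {η : E3 →L[ℝ] ℝ} (hη : η ≠ 0) :
    g.metric p (g.flowVelocity ε p η) (g.flowVelocity ε p η) = 0 := by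
  have h1 := ((g.nullLift_unique ε p η hη _).1 rfl).2.1
  rw [flowVelocity, metric_sharp, sharp_smul, smul_apply, map_smul, h1, smul_zero, smul_zero]

theorem flowVelocity_fst_pos (ε : ℤˣ) (p : ℝ × S) {η : E3 →L[ℝ] ℝ} (hη : η ≠ 0) :
    0 < (g.flowVelocity ε p η).1 := by
  rw [flowVelocity_eq ε p hη]
  exact inv_pos.2 (g.lapse_pos p)

/-! ### Values of the flow -/

theorem IsFlowValue.smul {ε : ℤˣ} {t s : ℝ} {y : S} {η : E3 →L[ℝ] ℝ} {x : S} {Ξ : E4 →L[ℝ] ℝ}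
    (h : g.IsFlowValue ε t s y η x Ξ) {k : ℝ} (hk : 0 < k) :
    g.IsFlowValue ε t s y (k • η) x (k • Ξ) := by
  obtain ⟨c, V, J, τ, hc, hV, h0, hτ, hc0, hv, hV0, hcτ, hVτ⟩ := h
  refine ⟨c, fun r => k • V r, J, τ, hc, hV.const_smul (fun _ => hc.mdifferentiableAt) k, h0, hτ,
    hc0, hv.trans (flowVelocity_smul ε (s, y) hk η).symm, ?_, hcτ, ?_⟩
  · simp only [hV0]
    rw [nullLift_smul ε (s, y) hk.le, sharp_smul]
  · simp only [hVτ]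
    rw [sharp_smul]

/-- `V` is parallel and starts as `ε ‖η‖` times the velocity, so it stays so. Pairing `Ξ` with a
gradient is therefore differentiation along the flow line. -/
theorem IsFlowValue.exists_geodesic {ε : ℤˣ} {t s : ℝ} {y : S} {η : E3 →L[ℝ] ℝ} {x : S}
    {Ξ : E4 →L[ℝ] ℝ} (h : g.IsFlowValue ε t s y η x Ξ) (hη : η ≠ 0) :
    ∃ (c : ℝ → ℝ × S) (J : Set ℝ) (τ : ℝ), g.IsGeodesicOn c J ∧ (0 : ℝ) ∈ J ∧ τ ∈ J ∧
      StrictMonoOn (fun r => (c r).1) J ∧ c 0 = (s, y) ∧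
      velocity c 0 = g.flowVelocity ε (s, y) η ∧ g.speedSq c 0 = 0 ∧ c τ = (t, x) ∧
      ∀ ζ : E4 →L[ℝ] ℝ, Ξ (g.sharp (t, x) ζ) =
        ((ε : ℤ) : ℝ) * g.conorm (s, y) η * ζ (velocity c τ) := by
  obtain ⟨c, V, J, τ, hc, hV, h0, hτ, hc0, hv, hV0, hcτ, hVτ⟩ := h
  have hv' : velocity c 0 = g.flowVelocity ε (s, y) η := hv
  have hn : g.metric (c 0) (velocity c 0) (velocity c 0) = 0 := by
    rw [hc0, hv']
    exact flowVelocity_null ε (s, y) hη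
  refine ⟨c, J, τ, hc, h0, hτ, hc.time_strictMonoOn h0 ?_ hn, hc0, hv', hn, hcτ, fun ζ => ?_⟩
  · rw [hv']
    exact flowVelocity_fst_pos ε (s, y) hη
  · have hcn := g.conorm_pos (s, y) hη
    have h1 : V 0 = (((ε : ℤ) : ℝ) * g.conorm (s, y) η) • velocity c 0 := by
      rw [hV0, hv, sharp_smul, smul_smul]
      have h2 : ((ε : ℤ) : ℝ) * g.conorm (s, y) η * (((ε : ℤ) : ℝ) / g.conorm (s, y) η) = 1 := by
        have := sq_unit ε
        field_simp
        linear_combination this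
      rw [h2, one_smul]
    have h3 := IsParallelOn.eq_smul_velocity hc hV h0 h1 hτ
    rw [← metric_sharp (g := g) (t, x) Ξ, ← hVτ, g.metric_symm, metric_sharp, h3, map_smul,
      smul_eq_mul]

theorem IsGeodesicOn.eq_of_mem [T2Space S] {c c' : ℝ → ℝ × S} {J J' : Set ℝ}
    (hc : g.IsGeodesicOn c J) (hc' : g.IsGeodesicOn c' J') (h0 : (0 : ℝ) ∈ J) (h0' : (0 : ℝ) ∈ J')
    (hp : c' 0 = c 0) (hv : velocity c' 0 = velocity c 0) {T : ℝ} (hTJ : T ∈ J)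
    (hTJ' : T ∈ J') : c' T = c T := by
  rcases le_total 0 T with hT | hT
  · exact (hc.eq_of_nonneg hc' h0 h0' hp hv hT hTJ hTJ').1
  · have hm : -1 * (0 : ℝ) = 0 := by simp
    have hT' : -1 * -T = T := by ring
    have := ((hc.comp_mul (-1)).eq_of_nonneg (hc'.comp_mul (-1)) (T := -T)
      (by rwa [mem_preimage, hm]) (by rwa [mem_preimage, hm]) (by rw [hm, hp])
      (by rw [velocity_comp_mul (hc.mdifferentiableAt (by rwa [hm])),
        velocity_comp_mul (hc'.mdifferentiableAt (by rwa [hm])), hm, hv])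
      (by linarith) (by rwa [mem_preimage, hT']) (by rwa [mem_preimage, hT'])).1
    rwa [hT'] at this

/-- The two witnessing geodesics may have different domains. Both parameters lie on the same side of
`0`, so the one nearer to `0` belongs to both domains; there the curves agree, and injectivity of
time identifies the parameters. -/
theorem IsFlowValue.position_unique [T2Space S] {ε : ℤˣ} {t s : ℝ} {y : S} {η : E3 →L[ℝ] ℝ}
    {x x' : S} {Ξ Ξ' : E4 →L[ℝ] ℝ} (hη : η ≠ 0) (h : g.IsFlowValue ε t s y η x Ξ)
    (h' : g.IsFlowValue ε t s y η x' Ξ') : x = x' := by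
  obtain ⟨c, J, τ, hc, h0, hτ, hm, hc0, hv, -, hcτ, -⟩ := h.exists_geodesic hη
  obtain ⟨c', J', τ', hc', h0', hτ', hm', hc0', hv', -, hcτ', -⟩ := h'.exists_geodesic hη
  have heq : ∀ T ∈ J, T ∈ J' → c' T = c T := fun T hT hT' =>
    hc.eq_of_mem hc' h0 h0' (hc0'.trans hc0.symm) (hv'.trans hv.symm) hT hT'
  have key : τ = τ' → x = x' := by
    rintro rfl
    have := heq τ hτ hτ'
    rw [hcτ, hcτ'] at this
    exact (congrArg Prod.snd this).symm
  have k1 : τ ∈ J' → x = x' := fun hmem => key (hm'.injOn hmem hτ' (by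
    simp only [heq τ hτ hmem, hcτ, hcτ']))
  have k2 : τ' ∈ J → x = x' := fun hmem => key (hm.injOn hτ hmem (by
    simp only [← heq τ' hmem hτ', hcτ, hcτ']))
  have s1 : 0 ≤ τ ↔ s ≤ t := by
    rw [← hm.le_iff_le h0 hτ]
    simp only [hc0, hcτ]
  have s2 : 0 ≤ τ' ↔ s ≤ t := by
    rw [← hm'.le_iff_le h0' hτ']
    simp only [hc0', hcτ']
  by_cases hst : s ≤ t
  · have p1 := s1.2 hst
    have p2 := s2.2 hst
    rcases le_total τ τ' with h | h
    · exact k1 (hc'.ordConnected.out h0' hτ' ⟨p1, h⟩)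
    · exact k2 (hc.ordConnected.out h0 hτ ⟨p2, h⟩)
  · have p1 := (not_le.1 (fun h => hst (s1.1 h))).le
    have p2 := (not_le.1 (fun h => hst (s2.1 h))).le
    rcases le_total τ τ' with h | h
    · exact k2 (hc.ordConnected.out hτ h0 ⟨h, p2⟩)
    · exact k1 (hc'.ordConnected.out hτ' h0' ⟨h, p1⟩)

/-! ### Restriction to the fibres of the cotangent bundle -/

theorem contMDiff_fibre (X : ℝ × S) (s : ℝ) (y : S) :
    ContMDiff 𝓘(ℝ, E3 →L[ℝ] ℝ) IPhase ∞
      (fun η : E3 →L[ℝ] ℝ => ((X, s, ⟨y, η⟩) : PhasePoint S)) := by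
  refine contMDiff_const.prodMk (contMDiff_const.prodMk ?_)
  intro η₀
  refine contMDiffAt_totalSpace.2 ⟨contMDiffAt_const, ?_⟩
  have hy : y ∈ (trivializationAt (E3 →L[ℝ] ℝ) (fun y : S => TangentSpace I3 y →L[ℝ] ℝ) y).baseSet :=
    mem_baseSet_trivializationAt _ _ y
  let L : (E3 →L[ℝ] ℝ) →L[ℝ] (E3 →L[ℝ] ℝ) :=
    (trivializationAt (E3 →L[ℝ] ℝ) (fun y : S => TangentSpace I3 y →L[ℝ] ℝ) y).continuousLinearMapAt
      ℝ y
  refine ContMDiffAt.congr_of_eventuallyEq (f := L) L.contDiff.contMDiff.contMDiffAt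
    (Eventually.of_forall fun η => ?_)
  exact (congrFun (Trivialization.coe_linearMapAt_of_mem _ hy) η).symm

end Spacetime

namespace Spacetime

variable {S : Type*} [TopologicalSpace S] [ChartedSpace E3 S] [IsManifold I3 ∞ S]
  {g : Spacetime S}

/-! ### The critical set of a phase function -/

theorem IsLeviCivitaPhase.differentiableAt {ε : ℤˣ} {φ : PhasePoint S → ℂ}
    (hφ : g.IsLeviCivitaPhase ε φ) (X : ℝ × S) (s : ℝ) (y : S) {η : E3 →L[ℝ] ℝ} (hη : η ≠ 0) :
    DifferentiableAt ℝ (fun η' : E3 →L[ℝ] ℝ => φ (X, s, ⟨y, η'⟩)) η := by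
  have h1 : ContMDiffOn 𝓘(ℝ, E3 →L[ℝ] ℝ) 𝓘(ℝ, ℂ) ∞
      (fun η' : E3 →L[ℝ] ℝ => φ (X, s, ⟨y, η'⟩)) {η' | η' ≠ 0} :=
    hφ.smooth.comp (contMDiff_fibre X s y).contMDiffOn fun η' hη' => hη'
  exact ((contMDiffOn_iff_contDiffOn.1 h1).differentiableOn (by simp)).differentiableAt
    (isOpen_ne.mem_nhds hη)

/-- Euler's identity for the degree 1 homogeneous `Im φ` forces the world function to vanish between
two points at the same time. -/
theorem mem_flowSet_of_dEta_eq_zero [T2Space S] {ε : ℤˣ} {φ : PhasePoint S → ℂ}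
    (hφ : g.IsLeviCivitaPhase ε φ) {t s : ℝ} {x y : S} {η : E3 →L[ℝ] ℝ} (hη : η ≠ 0)
    (hd : dEta φ ((t, x), s, ⟨y, η⟩) = 0) :
    (((t, x), s, ⟨y, η⟩) : PhasePoint S) ∈ g.flowSet ε := by
  set f : (E3 →L[ℝ] ℝ) → ℂ := fun η' => φ ((t, x), s, ⟨y, η'⟩) with hf
  have hf0 : HasFDerivAt f (0 : (E3 →L[ℝ] ℝ) →L[ℝ] ℂ) η := by
    have h1 := (hφ.differentiableAt (t, x) s y hη).hasFDerivAt
    have h2 : fderiv ℝ f η = 0 := hd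
    rwa [h2] at h1
  have hgeo : (((t, x), s, ⟨y, η⟩) : PhasePoint S) ∈ g.geometricRegion ε φ := by
    by_contra hne
    exact hφ.elsewhere _ hη hne hd
  obtain ⟨C, hC, hev⟩ := hgeo
  obtain ⟨x₀, Ξ₀, hF, hX, hZ, -⟩ := hev.self_of_nhds
  replace hF : g.IsFlowValue ε t s y η x₀ Ξ₀ := hF
  replace hX : (t, x) ∈ C := hX
  replace hZ : (t, x₀) ∈ C := hZ
  set a := g.conorm (s, y) η * g.worldFunction C (t, x) (t, x₀) with ha
  have hsc : HasDerivAt (fun k : ℝ => k • η) η 1 := by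
    simpa using (hasDerivAt_id (1 : ℝ)).smul_const (η : E3 →L[ℝ] ℝ)
  have hcont : Tendsto (fun k : ℝ => (((t, x), s, ⟨y, k • η⟩) : PhasePoint S)) (𝓝 1)
      (𝓝 ((t, x), s, ⟨y, η⟩)) := by
    have h1 := ((contMDiff_fibre (t, x) s y).continuous.tendsto ((1 : ℝ) • η)).comp
      ((by simpa using hsc.continuousAt.tendsto :
        Tendsto (fun k : ℝ => k • η) (𝓝 1) (𝓝 ((1 : ℝ) • η))))
    rw [one_smul] at h1
    exact h1
  -- Along the ray the position `x₀` is fixed and only `‖η‖` scales. One neighbourhood `C` serves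
  -- for all `k` near `1`.
  have him : (fun k : ℝ => (f (k • η)).im) =ᶠ[𝓝 1] fun k => k * a := by
    filter_upwards [hcont.eventually hev, Ioi_mem_nhds zero_lt_one] with k hk hk0
    obtain ⟨x', Ξ', hF', -, -, hφ'⟩ := hk
    have hk0' : 0 < k := hk0
    have hx : x' = x₀ := IsFlowValue.position_unique (smul_ne_zero hk0'.ne' hη) hF'
      (IsFlowValue.smul hF hk0')
    subst hx
    have h1 : f (k • η) = g.localPhase C (t, x) (t, x') Ξ' (g.conorm (s, y) (k • η)) := hφ'
    rw [h1, conorm_smul _ hk0'.le, localPhase, ha]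
    simp
    ring
  have hdim : HasDerivAt (fun k : ℝ => (f (k • η)).im) 0 1 := by
    have h1 : HasFDerivAt f (0 : (E3 →L[ℝ] ℝ) →L[ℝ] ℂ) ((1 : ℝ) • η) := by
      rwa [one_smul]
    have h2 := Complex.imCLM.hasFDerivAt.comp_hasDerivAt (1 : ℝ) (h1.comp_hasDerivAt (1 : ℝ) hsc)
    rwa [zero_apply, map_zero] at h2
  have ha0 : a = 0 := by
    have h1 : HasDerivAt (fun k : ℝ => k * a) a 1 := by
      simpa using (hasDerivAt_id (1 : ℝ)).mul_const a
    exact (h1.congr_of_eventuallyEq him).unique hdim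
  have hσ : g.worldFunction C (t, x) (t, x₀) = 0 :=
    (mul_eq_zero.1 ha0).resolve_left (conorm_pos (s, y) hη).ne'
  have hxx : x₀ = x := congrArg Prod.snd
    ((hC.2 _ hX).eq_of_worldFunction_eq_zero hZ rfl hσ)
  subst hxx
  exact ⟨t, s, y, η, x₀, Ξ₀, hη, hF, rfl⟩

open Asymptotics

/-- Both parts of `φ` are shown to be `o(‖η' - η‖)` on the fibre, by comparing the flow lines of
`η'` with that of `η`. -/
theorem dEta_eq_zero_of_isFlowValue [T2Space S] {ε : ℤˣ} {φ : PhasePoint S → ℂ}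
    (hφ : g.IsLeviCivitaPhase ε φ) {t s : ℝ} {x y : S} {η : E3 →L[ℝ] ℝ} {Ξ : E4 →L[ℝ] ℝ}
    (hη : η ≠ 0) (hF : g.IsFlowValue ε t s y η x Ξ) :
    dEta φ (((t, x), s, ⟨y, η⟩) : PhasePoint S) = 0 := by
  obtain ⟨C, hC, hev⟩ := hφ.geometric ⟨t, s, y, η, x, Ξ, hη, hF, rfl⟩
  obtain ⟨-, -, -, hX, -, -⟩ := hev.self_of_nhds
  replace hX : (t, x) ∈ C := hX
  obtain ⟨c, J, τ, hc, h0, hτ, hm, hc0, hv, hn, hcτ, -⟩ := IsFlowValue.exists_geodesic hF hη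
  obtain ⟨ℓ, hℓ, -, hℓ0, hℓd, hw, -⟩ := (hC.2 _ hX).exists_log
  set f : (E3 →L[ℝ] ℝ) → ℂ := fun η' => φ ((t, x), s, ⟨y, η'⟩) with hf
  let dℓ : ℝ × S → E4 →L[ℝ] E4 := fun Z => mfderiv I4 𝓘(ℝ, E4) ℓ Z
  have hdata : ∀ᶠ η' : E3 →L[ℝ] ℝ in 𝓝 η, ∃ d : (ℝ → ℝ × S) × Set ℝ × ℝ,
      g.IsGeodesicOn d.1 d.2.1 ∧ (0 : ℝ) ∈ d.2.1 ∧ d.2.2 ∈ d.2.1 ∧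
      StrictMonoOn (fun r => (d.1 r).1) d.2.1 ∧ d.1 0 = (s, y) ∧
      velocity d.1 0 = g.flowVelocity ε (s, y) η' ∧ g.speedSq d.1 0 = 0 ∧
      (d.1 d.2.2).1 = t ∧ d.1 d.2.2 ∈ C ∧
      f η' = -((((ε : ℤ) : ℝ) * g.conorm (s, y) η' * g.metric (t, x) (ℓ (d.1 d.2.2))
          (dℓ (d.1 d.2.2) (velocity d.1 d.2.2)) : ℝ) : ℂ) +
        Complex.I * (g.conorm (s, y) η' : ℂ) *
          (((1 / 2) * g.metric (t, x) (ℓ (d.1 d.2.2)) (ℓ (d.1 d.2.2)) : ℝ) : ℂ) := by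
    have hcont := (contMDiff_fibre (t, x) s y).continuous.tendsto (η : E3 →L[ℝ] ℝ)
    filter_upwards [hcont.eventually hev, isOpen_ne.mem_nhds hη] with η' hη' hne
    obtain ⟨x', Ξ', hF', -, hZ', hφ'⟩ := hη'
    replace hF' : g.IsFlowValue ε t s y η' x' Ξ' := hF'
    replace hZ' : (t, x') ∈ C := hZ'
    obtain ⟨c', J', τ', hc', h0', hτ', hm', hc0', hv', hn', hcτ', hΞ⟩ :=
      IsFlowValue.exists_geodesic hF' hne
    refine ⟨(c', J', τ'), hc', h0', hτ', hm', hc0', hv', hn', by simp only [hcτ'],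
      by simpa only [hcτ'] using hZ', ?_⟩
    have h1 : f η' = g.localPhase C (t, x) (t, x') Ξ' (g.conorm (s, y) η') := hφ'
    have h2 : Ξ' (g.gradWorldFunction C (t, x) (t, x')) = ((ε : ℤ) : ℝ) * g.conorm (s, y) η' *
        g.metric (t, x) (ℓ (t, x')) (dℓ (t, x') (velocity c' τ')) :=
      (hΞ _).trans (congrArg _ (mfderiv_worldFunction hC.1 hℓ hw hZ' _))
    rw [h1, localPhase, h2, hw _ hZ']
    simp only [hcτ']
  -- A flow line is chosen for each `η'` separately; no regularity of the choice in `η'` is needed,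
  -- as the estimates depend only on the initial velocity.
  obtain ⟨d, hd⟩ := hdata.choice
  -- The stability estimates run forward in the parameter; for `τ < 0` all geodesics are reversed
  -- with `κ = -1`, and the stray factor disappears at the end through `κ * κ = 1`.
  obtain ⟨κ, hκ, hκτ⟩ : ∃ κ : ℝ, (κ = 1 ∨ κ = -1) ∧ 0 ≤ κ * τ := by
    rcases le_total 0 τ with h | h
    · exact ⟨1, Or.inl rfl, by simpa using h⟩
    · exact ⟨-1, Or.inr rfl, by simpa using h⟩
  have hκκ : κ * κ = 1 := by rcases hκ with rfl | rfl <;> norm_num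
  have hκr : ∀ r, κ * (κ * r) = r := fun r => by rw [← mul_assoc, hκκ, one_mul]
  have hmono : ∀ {b : ℝ → ℝ × S} {K : Set ℝ}, StrictMonoOn (fun r => (b r).1) K →
      StrictMonoOn (fun r => κ * (b (κ * r)).1) ((fun r => κ * r) ⁻¹' K) := by
    intro b K hb r hr r' hr' hlt
    rcases hκ with rfl | rfl
    · simpa using hb hr hr' (by simpa using hlt)
    · simpa using hb hr' hr (by simpa using hlt)
  have hvel : ∀ {b : ℝ → ℝ × S} {K : Set ℝ}, g.IsGeodesicOn b K → ∀ {r : ℝ}, r ∈ K →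
      velocity (fun r => b (κ * r)) (κ * r) = κ • velocity b r := by
    intro b K hb r hr
    rw [velocity_comp_mul (hb.mdifferentiableAt (by rwa [hκr])), hκr]
  have hvel0 : ∀ {b : ℝ → ℝ × S} {K : Set ℝ}, g.IsGeodesicOn b K → (0 : ℝ) ∈ K →
      velocity (fun r => b (κ * r)) 0 = κ • velocity b 0 := by
    intro b K hb h0
    simpa using hvel hb h0
  have hspeed : ∀ {b : ℝ → ℝ × S} {K : Set ℝ}, g.IsGeodesicOn b K → (0 : ℝ) ∈ K →
      g.speedSq b 0 = 0 → g.speedSq (fun r => b (κ * r)) 0 = 0 := by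
    intro b K hb h0 hb0
    have h1 : g.metric (b 0) (velocity b 0) (velocity b 0) = 0 := hb0
    rw [speedSq, hvel0 hb h0, mul_zero, ← metricL_apply, map_smul, map_smul, smul_apply,
      metricL_apply, h1, smul_zero, smul_zero]
  have hnear : g.IsNearFamily (𝓝 η) (fun η' => ‖η' - η‖) (fun r => c (κ * r))
      ((fun r => κ * r) ⁻¹' J) (fun η' r => (d η').1 (κ * r))
      (fun η' => (fun r => κ * r) ⁻¹' (d η').2.1) κ (κ * τ) (fun η' => κ * (d η').2.2) := by
    refine ⟨tendsto_norm_sub_self _, hc.comp_mul κ, by simpa using h0, hmono hm,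
      by simpa [hκr] using hτ, hκτ, ?_, ?_⟩
    · filter_upwards [hd] with η' hη'
      obtain ⟨k1, k2, k3, k4, k5, k6, k7, k8, k9, k10⟩ := hη'
      refine ⟨k1.comp_mul κ, by simpa using k2, by simpa [hκr] using k3, hmono k4, ?_, ?_, ?_⟩
      · simp only [mul_zero, k5, hc0]
      · simp only [hκr, k8, hcτ]
      · rw [hspeed k1 k2 k7, hspeed hc h0 hn]
    · have h1 := (differentiableAt_flowVelocity (g := g) ε (s, y) hη).isBigO_sub
      refine ((h1.norm_right).const_smul_left κ).congr' ?_ EventuallyEq.rfl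
      filter_upwards [hd] with η' hη'
      simp only [Pi.smul_apply]
      rw [hvel0 hη'.1 hη'.2.1, hvel0 hc h0, hη'.2.2.2.2.2.1, hv, smul_sub]
  have hend : c (κ * (κ * τ)) = (t, x) := by rw [hκr, hcτ]
  have ho1 : (fun η' => g.metric (t, x) (ℓ ((d η').1 (d η').2.2)) (ℓ ((d η').1 (d η').2.2)))
      =o[𝓝 η] fun η' => ‖η' - η‖ := by
    have h1 := (hnear.isLittleO_log (hspeed hc h0 hn) hC.1 (hend.symm ▸ hX) hℓ
      (hend.symm ▸ hℓ0) (hend.symm ▸ hℓd)).1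
    simpa only [hκr, hcτ] using h1
  have ho2 : (fun η' => g.metric (t, x) (ℓ ((d η').1 (d η').2.2)) (dℓ ((d η').1 (d η').2.2)
      (velocity (fun r => (d η').1 (κ * r)) (κ * (d η').2.2)))) =o[𝓝 η] fun η' => ‖η' - η‖ := by
    have h1 : (fun η' => g.metric (c (κ * (κ * τ))) (ℓ ((d η').1 (κ * (κ * (d η').2.2))))
        (dℓ ((d η').1 (κ * (κ * (d η').2.2)))
          (velocity (fun r => (d η').1 (κ * r)) (κ * (d η').2.2)))) =o[𝓝 η] fun η' => ‖η' - η‖ :=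
      (hnear.isLittleO_log (hspeed hc h0 hn) hC.1 (hend.symm ▸ hX) hℓ
        (hend.symm ▸ hℓ0) (hend.symm ▸ hℓd)).2
    simpa only [hκr, hcτ] using h1
  have hcn : (fun η' => g.conorm (s, y) η') =O[𝓝 (η : E3 →L[ℝ] ℝ)] fun _ => (1 : ℝ) :=
    (differentiableAt_conorm (s, y) hη).continuousAt.isBigO_one ℝ
  have hA := hcn.mul_isLittleO ho1
  have hB := hcn.mul_isLittleO ho2
  simp only [one_mul] at hA hB
  have hfo : f =o[𝓝 (η : E3 →L[ℝ] ℝ)] fun η' => η' - η := by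
    rw [← isLittleO_norm_right]
    refine (((Complex.isLittleO_ofReal_left.2 hB).const_mul_left (-((ε : ℤ) : ℂ) * κ)).add
      ((Complex.isLittleO_ofReal_left.2 hA).const_mul_left (Complex.I / 2))).congr' ?_
      EventuallyEq.rfl
    filter_upwards [hd] with η' hη'
    obtain ⟨k1, k2, k3, k4, k5, k6, k7, k8, k9, k10⟩ := hη'
    rw [k10, hvel k1 k3]
    rw [map_smul, ← metricL_apply, ← metricL_apply, ← metricL_apply, map_smul]
    simp only [smul_eq_mul]
    have hκκ' : (κ : ℂ) * κ = 1 := by exact_mod_cast hκκ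
    push_cast
    linear_combination (-((ε : ℤ) : ℂ) * (g.conorm (s, y) η' : ℂ) *
      (g.metricL (t, x) (ℓ ((d η').1 (d η').2.2)) (dℓ ((d η').1 (d η').2.2)
        (velocity (d η').1 (d η').2.2)) : ℂ)) * hκκ'
  -- At `η' = η` the comparison function is zero, so the bound forces `f η = 0`, and the `o`
  -- estimate says that the derivative vanishes.
  have hfη : f η = 0 := by
    have := (hfo.isBigO.eq_zero_imp).self_of_nhds
    exact this (sub_self _)
  have hfd : HasFDerivAt f (0 : (E3 →L[ℝ] ℝ) →L[ℝ] ℂ) η := by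
    refine HasFDerivAt.of_isLittleO ?_
    simpa [hfη] using hfo
  exact hfd.fderiv

end Spacetime

theorem proposition3p10 {S : Type*} [TopologicalSpace S] [T2Space S] [CompactSpace S]
    [ChartedSpace E3 S] [IsManifold I3 ∞ S] (g : Spacetime S)
    (ε : ℤˣ) (φ : PhasePoint S → ℂ) (hφ : g.IsLeviCivitaPhase ε φ) :
    Spacetime.criticalSet φ = g.flowSet ε :=
  Set.Subset.antisymm (fun _ hp => Spacetime.mem_flowSet_of_dEta_eq_zero hφ hp.1 hp.2)
    (by
      rintro _ ⟨t, s, y, η, x, Ξ, hη, hF, rfl⟩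
      exact ⟨hη, Spacetime.dEta_eq_zero_of_isFlowValue hφ hη hF⟩)
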